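/- Let $N\ge 3$, $2<q<\frac4N+2$ and $\gamma>0$; all functions are complex valued. Let $\mathcal H$ be the completion of $C_0^\infty(\mathbb R^N)$ under the norm $$\|v\|_{\mathcal H}^2=\int_{\mathbb R^N}|x|^{-(N-2)}|\nabla v|^2\,dx+\int_{\mathbb R^N}|x|^{-(N-2)}|v|^2\,dx ,$$ regarded as a real Hilbert space, and let $\mathcal H_r$ be its subspace of radial functions, with the same norm. Let $H=\{|x|^{-\frac{N-2}2}v: v\in\mathcal H\}$. For $u\in H$ put $$E(u)=\frac12\lim_{\varepsilon\downarrow0}\Big(\int_{|x|\ge\varepsilon}|\nabla u|^2dx-\Big(\tfrac{N-2}2\Big)^2\int_{|x|\ge\varepsilon}\frac{|u|^2}{|x|^2}dx-\frac{N-2}{2\varepsilon}\int_{|x|=\varepsilon}|u|^2dS\Big)-\frac1q\int_{\mathbb R^N}|u|^q\,dx .$$ Let $\Gamma=\{u\in H:\int_{\mathbb R^N}|u|^2dx=\gamma\}$ and $\widetilde\Gamma=\{v\in\mathcal H_r:\ |x|^{-\frac{N-2}2}v\in\Gamma\}$. For $v\in\mathcal H_r$ put $$J(v)=E\big(|x|^{-\frac{N-2}2}v\big)+\frac12\int_{\mathbb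 R^N}|x|^{-(N-2)}|v|^2dx,\qquad \widetilde k_\gamma=\inf\{J(v):v\in\widetilde\Gamma\}.$$ Let $(v_n)$ be a sequence in $\widetilde\Gamma$ such that $J(v_n)\to\widetilde k_\gamma$ and $J'(v_n)\to0$. Here $J'(v_n)\to 0$ may be understood either in the dual of $\mathcal H_r$, or only in the weaker sense of the derivative of $J$ on the constraint set, that is, the norm of the restriction of $J'(v_n)$ to the tangent space $\{w\in\mathcal H_r:\ \mathrm{Re}\int_{\mathbb R^N}|x|^{-(N-2)}v_n\bar w\,dx=0\}$ tends to $0$. Then $(v_n)$ has a subsequence that converges strongly in $\mathcal H_r$ to some $v$, and this limit solves the minimization problem: $v\in\widetilde\Gamma$ and $J(v)=\min\{J(z):z\in\widetilde\Gamma\}$. -/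

import Mathlib

open MeasureTheory Filter Topology
open scoped ContDiff

noncomputable section

namespace HardyNLS

/-- Euclidean space `ℝ^N`. -/
abbrev Pt (N : ℕ) : Type := EuclideanSpace ℝ (Fin N)

/-- Gradients of complex valued functions on `ℝ^N` take values in `ℂ^N`. -/
abbrev Grad (N : ℕ) : Type := EuclideanSpace ℂ (Fin N)

/-- The measure `dμ = |x|^{-(N-2)} dx` on `ℝ^N`. -/
def wMeasure (N : ℕ) : Measure (Pt N) :=
  volume.withDensity fun x => ENNReal.ofReal (‖x‖ ^ (-((N : ℝ) - 2)))

/-- The classical gradient `(∂₁φ, …, ∂_Nφ)` of a function `φ : ℝ^N → ℂ`. -/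
def classicalGrad {N : ℕ} (φ : Pt N → ℂ) (x : Pt N) : Grad N :=
  WithLp.toLp 2 fun i => fderiv ℝ φ x (EuclideanSpace.single i 1)

/-- The real Hilbert space `L²(dμ; ℂ) × L²(dμ; ℂ^N)` with the norm
`‖(v, g)‖² = ∫ |x|^{-(N-2)} |v|² dx + ∫ |x|^{-(N-2)} |g|² dx`. -/
abbrev Ambient (N : ℕ) : Type :=
  WithLp 2 (Lp ℂ 2 (wMeasure N) × Lp (Grad N) 2 (wMeasure N))

/-- The pairs `(φ, ∇φ)` with `φ ∈ C₀^∞(ℝ^N; ℂ)`; the norm of such a pair in `Ambient N` is the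
weighted norm of `φ`. -/
def smoothGraph (N : ℕ) : Submodule ℝ (Ambient N) where
  carrier := {p | ∃ φ : Pt N → ℂ, ContDiff ℝ ∞ φ ∧ HasCompactSupport φ ∧
    (⇑p.fst =ᵐ[wMeasure N] φ) ∧ (⇑p.snd =ᵐ[wMeasure N] classicalGrad φ)}
  zero_mem' := by
    refine ⟨0, contDiff_const, HasCompactSupport.zero, ?_, ?_⟩
    · exact Lp.coeFn_zero ℂ 2 (wMeasure N)
    · refine (Lp.coeFn_zero (Grad N) 2 (wMeasure N)).trans (Eventually.of_forall fun x => ?_)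
      ext i
      simp [classicalGrad]
  add_mem' := by
    rintro p p' ⟨φ, h1, h2, h3, h4⟩ ⟨φ', h1', h2', h3', h4'⟩
    refine ⟨φ + φ', h1.add h1', h2.add h2', ?_, ?_⟩
    · exact (Lp.coeFn_add p.fst p'.fst).trans (h3.add h3')
    · refine (Lp.coeFn_add p.snd p'.snd).trans ((h4.add h4').trans
        (Eventually.of_forall fun x => ?_))
      ext i
      have e1 : DifferentiableAt ℝ φ x := (h1.differentiable (by simp)) x
      have e2 : DifferentiableAt ℝ φ' x := (h1'.differentiable (by simp)) x
      simp [classicalGrad, fderiv_add e1 e2]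
  smul_mem' := by
    rintro c p ⟨φ, h1, h2, h3, h4⟩
    refine ⟨c • φ, contDiff_const.smul h1, h2.smul_left (f := fun _ => c), ?_, ?_⟩
    · exact (Lp.coeFn_smul c p.fst).trans (h3.const_smul c)
    · refine (Lp.coeFn_smul c p.snd).trans ((h4.const_smul c).trans
        (Eventually.of_forall fun x => ?_))
      ext i
      have e1 : DifferentiableAt ℝ φ x := (h1.differentiable (by simp)) x
      simp [classicalGrad, fderiv_const_smul e1]

/-- The space `𝓗`: the completion of `C₀^∞(ℝ^N)` under the norm
`‖v‖² = ∫ |x|^{-(N-2)} |∇v|² dx + ∫ |x|^{-(N-2)} |v|² dx`, realised as the closure of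
`{(φ, ∇φ)}` in `L²(dμ) × L²(dμ)`. The element `p` stands for the function `p.fst`, and `p.snd`
is its gradient. -/
def SpaceH (N : ℕ) : Submodule ℝ (Ambient N) := (smoothGraph N).topologicalClosure

/-- `v` agrees almost everywhere with a function of `|x|` (`dμ` and `dx` have the same null sets). -/
def IsRadial {N : ℕ} (v : Pt N → ℂ) : Prop :=
  ∃ f : ℝ → ℂ, Measurable f ∧ v =ᵐ[wMeasure N] fun x => f ‖x‖

/-- The subspace `𝓗_r` of the radial functions in `𝓗`. -/
def SpaceHr (N : ℕ) : Submodule ℝ (Ambient N) where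
  carrier := {p | p ∈ SpaceH N ∧ IsRadial (⇑p.fst)}
  zero_mem' := by
    refine ⟨Submodule.zero_mem _, fun _ => 0, measurable_const, ?_⟩
    exact Lp.coeFn_zero ℂ 2 (wMeasure N)
  add_mem' := by
    rintro p p' ⟨h, f, hf, hpf⟩ ⟨h', f', hf', hpf'⟩
    refine ⟨Submodule.add_mem _ h h', f + f', hf.add hf', ?_⟩
    exact (Lp.coeFn_add p.fst p'.fst).trans (hpf.add hpf')
  smul_mem' := by
    rintro c p ⟨h, f, hf, hpf⟩
    refine ⟨Submodule.smul_mem _ c h, c • f, hf.const_smul c, ?_⟩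
    exact (Lp.coeFn_smul c p.fst).trans (hpf.const_smul c)

/-- The transformation `u = 𝒯(v) = |x|^{-(N-2)/2} v`. -/
def transf {N : ℕ} (v : Pt N → ℂ) (x : Pt N) : ℂ :=
  ((‖x‖ ^ (-(((N : ℝ) - 2) / 2)) : ℝ) : ℂ) * v x

/-- The space `H = 𝒯(𝓗)`, as a set of functions on `ℝ^N`. -/
def MemH {N : ℕ} (u : Pt N → ℂ) : Prop :=
  ∃ p ∈ SpaceH N, u =ᵐ[volume] transf ⇑p.fst

/-- `G` is the weak (distributional) gradient of `u` on `ℝ^N ∖ {0}`. -/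
def IsWeakGrad {N : ℕ} (u : Pt N → ℂ) (G : Pt N → Grad N) : Prop :=
  LocallyIntegrableOn u {0}ᶜ ∧ LocallyIntegrableOn G {0}ᶜ ∧
    ∀ φ : Pt N → ℝ, ContDiff ℝ ∞ φ → HasCompactSupport φ → tsupport φ ⊆ {0}ᶜ → ∀ i : Fin N,
      ∫ x, fderiv ℝ φ x (EuclideanSpace.single i 1) • u x = -∫ x, φ x • G x i

open Classical in
/-- The weak gradient of `u` on `ℝ^N ∖ {0}` (unique almost everywhere). -/
def weakGrad {N : ℕ} (u : Pt N → ℂ) : Pt N → Grad N :=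
  if h : ∃ G, IsWeakGrad u G then h.choose else 0

/-- The Hardy functional on the complement of the ball `B_ε`:
`I(u) = ∫_{B_ε^c} |∇u|² dx - ((N-2)/2)² ∫_{B_ε^c} |u|²/|x|² dx`. -/
def hardyExterior {N : ℕ} (ε : ℝ) (u : Pt N → ℂ) : ℝ :=
  (∫ x in (Metric.ball (0 : Pt N) ε)ᶜ, ‖weakGrad u x‖ ^ 2) -
    (((N : ℝ) - 2) / 2) ^ 2 * ∫ x in (Metric.ball (0 : Pt N) ε)ᶜ, ‖u x‖ ^ 2 / ‖x‖ ^ 2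

/-- The surface integral `∫_{|x|=ε} |u|² dS`. As `u` is only defined almost everywhere, it is taken
through the coarea formula as the derivative at `r = ε` of `∫_{|x|<r} |u|² dx`. -/
def sphereIntegral {N : ℕ} (ε : ℝ) (u : Pt N → ℂ) : ℝ :=
  deriv (fun r : ℝ => ∫ x in Metric.ball (0 : Pt N) r, ‖u x‖ ^ 2) ε

/-- The Hardy energy at the singularity: `Λ_ε(u) = (N-2)/2 ε⁻¹ ∫_{|x|=ε} |u|² dS`. -/
def hardySurface {N : ℕ} (ε : ℝ) (u : Pt N → ℂ) : ℝ :=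
  ((N : ℝ) - 2) / 2 * ε⁻¹ * sphereIntegral ε u

/-- The energy
`E(u) = ½ lim_{ε ↓ 0} (I_{B_ε^c}(u) - Λ_ε(u)) - (1/q) ∫ |u|^q dx`. -/
def energy {N : ℕ} (q : ℝ) (u : Pt N → ℂ) : ℝ :=
  1 / 2 * limUnder (𝓝[>] (0 : ℝ)) (fun ε => hardyExterior ε u - hardySurface ε u) -
    1 / q * ∫ x, ‖u x‖ ^ q

/-- The `L²`-sphere `Γ = {u ∈ H : ∫ |u|² dx = γ}`. -/
def Gam (N : ℕ) (γ : ℝ) : Set (Pt N → ℂ) :=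
  {u | MemH u ∧ ∫ x, ‖u x‖ ^ 2 = γ}

/-- The functional `J(v) = E(|x|^{-(N-2)/2} v) + ½ ∫ |x|^{-(N-2)} |v|² dx` on `𝓗_r`. -/
def J {N : ℕ} (q : ℝ) (v : SpaceHr N) : ℝ :=
  energy q (transf ⇑v.1.fst) + 1 / 2 * ∫ x, ‖x‖ ^ (-((N : ℝ) - 2)) * ‖v.1.fst x‖ ^ 2

/-- The constraint set `Γ̃ = {v ∈ 𝓗_r : |x|^{-(N-2)/2} v ∈ Γ}`. -/
def GamTilde (N : ℕ) (γ : ℝ) : Set (SpaceHr N) :=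
  {v | transf ⇑v.1.fst ∈ Gam N γ}

/-- The constrained infimum `k̃_γ = inf {J(v) : v ∈ Γ̃}`. -/
def kTilde (N : ℕ) (q γ : ℝ) : ℝ := sInf (J q '' GamTilde N γ)

/-- The tangent space at `v` to the constraint set:
`{w ∈ 𝓗_r : Re ∫ |x|^{-(N-2)} v \bar w dx = 0}`. -/
def tangentSpace {N : ℕ} (v : SpaceHr N) : Submodule ℝ (SpaceHr N) where
  carrier := {w | inner ℝ v.1.fst w.1.fst = 0}
  zero_mem' := by simp
  add_mem' := by
    intro w w' h h'
    simp only [Set.mem_ofPred_eq] at h h' ⊢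
    simp [inner_add_right, h, h']
  smul_mem' := by
    intro c w h
    simp only [Set.mem_ofPred_eq] at h ⊢
    simp [inner_smul_right, h]

/-- The derivative of the restriction of `J` to the constraint set: `J'(v)` restricted to the
tangent space at `v`. -/
def constrainedDeriv {N : ℕ} (q : ℝ) (v : SpaceHr N) : tangentSpace v →L[ℝ] ℝ :=
  (fderiv ℝ (J q) v).comp (tangentSpace v).subtypeL

end HardyNLS

end

/-! In polar coordinates the measure |x|^{-(N-2)} dx becomes r dr dσ, so radial elements of 𝓗 behave
like radial H¹ functions on the plane. For u = |x|^{-(N-2)/2} v, expanding |∇u|² gives the weighted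
density of |∇v|², the Hardy density, and a cross term that is a multiple of the radial derivative of
|v|². Over |x| > ε the Hardy densities cancel and the cross term integrates to the surface term Λ_ε.
Hence the limit in E equals ‖∇v‖² (`tendsto_hardy`), and on the constraint set J is the constant γ/2
plus `redEnergy` = ½‖∇v‖² - (1/q)∫|u|^q (`J_eq`).

Elements of 𝓗 are limits of smooth pairs and are known only almost everywhere. Their spherical means
are therefore defined through integrals over annuli (`radT`), which are continuous for L¹
convergence of a function and its radial derivative (`RadPair`). A radial element thus has a
continuous profile `prof`, growing at most like the square root of a logarithm near 0
(`norm_prof_sub_le`) and decaying like r^{-1/2} at infinity (`sq_prof_le`). These bounds control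
∫|u|^q at fixed mass by the power N(q-2)/2 of the gradient norm (`potential_le`). This power is
below 2 exactly when q < 2 + 4/N. Evaluation of the profile at a radius is a bounded functional, so
profiles converge pointwise under weak convergence, and the nonlinear term converges with them
(`tendsto_potential`).

Consequently `redEnergy` is coercive on the constraint set (`potential_coercive`), and its infimum κ
is negative, as a widely spread bump shows (`exists_neg_energy`). A minimising sequence is bounded;
let w be a weak subsequential limit. Weak lower semicontinuity gives `redEnergy` of w at most κ < 0,
so w ≠ 0. Had w lost mass, multiplying it by the t > 1 that restores the mass would give energy at
most t²κ < κ (`redEnergy_smul_le`), a contradiction. So the mass is preserved, w is a minimiser, the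
gradient norms converge as well, and weak convergence becomes strong. -/

noncomputable section

namespace HardyNLS

/-! ### The polar measure `|x|^{1-N} dx` -/

/-- The unit sphere of `ℝ^N`. -/
abbrev Sph (N : ℕ) : Type := Metric.sphere (0 : Pt N) 1

/-- The surface measure of the unit sphere. -/
abbrev sphM (N : ℕ) : Measure (Sph N) := (volume : Measure (Pt N)).toSphere

/-- The measure `|x|^{1-N} dx`, defined in polar coordinates as `dσ(ω) dr`. -/
def polM (N : ℕ) : Measure (Pt N) :=
  Measure.map (fun z : Sph N × ℝ => z.2 • (z.1 : Pt N)) ((sphM N).prod (volume.restrict (Set.Ioi 0)))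

/-- The area of the unit sphere. -/
def sphArea (N : ℕ) : ℝ := (sphM N).real Set.univ

variable {N : ℕ}

lemma sphArea_pos (hN : 3 ≤ N) : 0 < sphArea N := by
  have : Nonempty (Fin N) := ⟨⟨0, by omega⟩⟩
  unfold sphArea
  rw [Measure.real, ENNReal.toReal_pos_iff]
  refine ⟨pos_iff_ne_zero.2 ?_, measure_lt_top _ _⟩
  rw [Ne, Measure.measure_univ_eq_zero]
  exact Measure.toSphere_ne_zero (volume : Measure (Pt N))

lemma continuous_polar : Continuous (fun z : Sph N × ℝ => z.2 • (z.1 : Pt N)) := by fun_prop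

lemma norm_polar (z : Sph N × ℝ) : ‖z.2 • (z.1 : Pt N)‖ = |z.2| := by
  rw [norm_smul, norm_eq_of_mem_sphere, mul_one, Real.norm_eq_abs]

/-- The polar homeomorphism lives on the punctured space and the open half line. The origin is a
null set, and both subtypes are traded for restricted measures. -/
lemma lintegral_volume_polar (hN : 3 ≤ N) {F : Pt N → ENNReal} (hF : Measurable F) :
    ∫⁻ x, F x = ∫⁻ z : Sph N × ℝ, ENNReal.ofReal (z.2 ^ (N - 1)) * F (z.2 • (z.1 : Pt N))
      ∂((sphM N).prod (volume.restrict (Set.Ioi 0))) := by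
  have : Nonempty (Fin N) := ⟨⟨0, by omega⟩⟩
  have hp := Measure.measurePreserving_homeomorphUnitSphereProd (volume : Measure (Pt N))
  have hm : MeasurableSet ({0}ᶜ : Set (Pt N)) := (measurableSet_singleton _).compl
  have e1 : ∫⁻ x, F x = ∫⁻ x : ({0}ᶜ : Set (Pt N)), F (x : Pt N) ∂(Measure.comap Subtype.val volume) := by
    rw [lintegral_subtype_comap hm, restrict_compl_singleton]
  have hG : Measurable fun z : Sph N × Set.Ioi (0 : ℝ) => F ((z.2 : ℝ) • (z.1 : Pt N)) :=
    hF.comp (by fun_prop)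
  have hpos : ∀ r : ℝ, r ∈ Set.Ioi (0 : ℝ) → 0 ≤ r ^ (N - 1) := fun r hr => pow_nonneg (le_of_lt hr) _
  have e2 : ∫⁻ x : ({0}ᶜ : Set (Pt N)), F (x : Pt N) ∂(Measure.comap Subtype.val volume) =
      ∫⁻ z, F ((z.2 : ℝ) • (z.1 : Pt N)) ∂((sphM N).prod (Measure.volumeIoiPow (N - 1))) := by
    have := hp.lintegral_comp hG
    rw [finrank_euclideanSpace_fin] at this
    rw [← this]
    refine lintegral_congr fun x => ?_
    congr 1
    have := homeomorphUnitSphereProd_symm_apply_coe (Pt N) (homeomorphUnitSphereProd (Pt N) x)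
    rw [Homeomorph.symm_apply_apply] at this
    exact this
  rw [e1, e2, lintegral_prod _ hG.aemeasurable, lintegral_prod]
  · refine lintegral_congr fun e => ?_
    rw [Measure.volumeIoiPow, lintegral_withDensity_eq_lintegral_mul]
    · simp only [Pi.mul_apply]
      exact lintegral_subtype_comap measurableSet_Ioi
        (fun r => ENNReal.ofReal (r ^ (N - 1)) * F (r • (e : Pt N)))
    · fun_prop
    · exact hF.comp (by fun_prop)
  · exact (Measurable.mul (by fun_prop) (hF.comp (by fun_prop))).aemeasurable

lemma lintegral_polM {F : Pt N → ENNReal} (hF : Measurable F) :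
    ∫⁻ x, F x ∂(polM N) = ∫⁻ z : Sph N × ℝ, F (z.2 • (z.1 : Pt N))
      ∂((sphM N).prod (volume.restrict (Set.Ioi 0))) := by
  rw [polM, lintegral_map hF continuous_polar.measurable]

lemma ae_pos_prod : ∀ᵐ z : Sph N × ℝ ∂((sphM N).prod (volume.restrict (Set.Ioi 0))), 0 < z.2 := by
  have : ∀ᵐ r : ℝ ∂(volume.restrict (Set.Ioi 0)), 0 < r := ae_restrict_mem measurableSet_Ioi
  exact (Measure.quasiMeasurePreserving_snd).ae this

lemma polM_ae_ne_zero : ∀ᵐ x ∂(polM N), 0 < ‖x‖ := by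
  rw [polM, ae_map_iff continuous_polar.measurable.aemeasurable
    (measurableSet_lt measurable_const measurable_norm)]
  filter_upwards [ae_pos_prod] with z hz
  rw [norm_polar]; positivity

lemma volume_eq_withDensity_polM (hN : 3 ≤ N) :
    (volume : Measure (Pt N)) = (polM N).withDensity fun x => ((‖x‖₊ ^ (N - 1) : NNReal) : ENNReal) := by
  refine Measure.ext_of_lintegral _ fun F hF => ?_
  rw [lintegral_volume_polar hN hF, lintegral_withDensity_eq_lintegral_mul _ (by fun_prop) hF,
    lintegral_polM (Measurable.mul (by fun_prop) hF)]
  refine lintegral_congr_ae ?_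
  filter_upwards [ae_pos_prod] with z hz
  simp only [Pi.mul_apply]
  congr 1
  rw [← ENNReal.ofReal_coe_nnreal]
  congr 1
  push_cast
  rw [norm_polar, abs_of_pos hz]

/-- r^{-(N-2)} · r^{N-1} = r: for radial functions the weight makes every dimension N look like
dimension two. -/
lemma wMeasure_eq_withDensity_polM (hN : 3 ≤ N) :
    wMeasure N = (polM N).withDensity fun x => (‖x‖₊ : ENNReal) := by
  rw [wMeasure, volume_eq_withDensity_polM hN, ← withDensity_mul _ (by fun_prop) (by fun_prop)]
  refine withDensity_congr_ae ?_
  filter_upwards [polM_ae_ne_zero] with x hx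
  simp only [Pi.mul_apply]
  rw [← ENNReal.ofReal_coe_nnreal, ← ENNReal.ofReal_coe_nnreal, ← ENNReal.ofReal_mul (by positivity)]
  congr 1
  push_cast
  rw [← Real.rpow_natCast, ← Real.rpow_add hx, Nat.cast_sub (by omega)]
  convert Real.rpow_one ‖x‖ using 2
  push_cast; ring

/-- A density that can vanish only at the origin does not change the null sets, since the origin is
null for `polM`. Almost everywhere statements can thus be moved between `volume`, `wMeasure` and
`polM`. -/
lemma ae_withDensity_polM_iff {k : Pt N → NNReal} (hk : Measurable k) (hk0 : ∀ x, 0 < ‖x‖ → k x ≠ 0)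
    {p : Pt N → Prop} :
    (∀ᵐ x ∂((polM N).withDensity fun x => (k x : ENNReal)), p x) ↔ ∀ᵐ x ∂(polM N), p x := by
  rw [ae_withDensity_iff (by fun_prop)]
  constructor
  · intro h
    filter_upwards [h, polM_ae_ne_zero] with x hx h0
    exact hx (by simpa using hk0 x h0)
  · intro h
    filter_upwards [h] with x hx _ using hx

lemma ae_volume_iff (hN : 3 ≤ N) {p : Pt N → Prop} :
    (∀ᵐ x : Pt N, p x) ↔ ∀ᵐ x ∂(polM N), p x := by
  conv_lhs => rw [volume_eq_withDensity_polM hN]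
  exact ae_withDensity_polM_iff (by fun_prop) fun x hx => pow_ne_zero _ (nnnorm_pos.2 (norm_pos_iff.1 hx)).ne'

lemma ae_wMeasure_iff (hN : 3 ≤ N) {p : Pt N → Prop} :
    (∀ᵐ x ∂(wMeasure N), p x) ↔ ∀ᵐ x ∂(polM N), p x := by
  rw [wMeasure_eq_withDensity_polM hN]
  exact ae_withDensity_polM_iff (by fun_prop) fun x hx => (nnnorm_pos.2 (norm_pos_iff.1 hx)).ne'

lemma volume_ac_polM (hN : 3 ≤ N) : (volume : Measure (Pt N)) ≪ polM N := by
  conv_lhs => rw [volume_eq_withDensity_polM hN]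
  exact withDensity_absolutelyContinuous _ _

lemma polM_ac_wMeasure (hN : 3 ≤ N) : polM N ≪ wMeasure N :=
  Measure.ae_le_iff_absolutelyContinuous.1 fun _ hs => (ae_wMeasure_iff hN).1 hs

/-! ### Integrals against the three measures and their radial reduction -/

section Integrals

variable {E : Type*} [NormedAddCommGroup E] [NormedSpace ℝ E]

lemma integral_volume (hN : 3 ≤ N) (F : Pt N → E) :
    ∫ x, F x = ∫ x, ‖x‖ ^ (N - 1) • F x ∂(polM N) := by
  conv_lhs => rw [volume_eq_withDensity_polM hN]
  rw [integral_withDensity_eq_integral_smul (by fun_prop)]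
  rfl

lemma integrable_volume (hN : 3 ≤ N) {F : Pt N → E} :
    Integrable F ↔ Integrable (fun x => ‖x‖ ^ (N - 1) • F x) (polM N) := by
  conv_lhs => rw [volume_eq_withDensity_polM hN]
  rw [integrable_withDensity_iff_integrable_smul (by fun_prop)]
  rfl

lemma integral_wMeasure (hN : 3 ≤ N) (F : Pt N → E) :
    ∫ x, F x ∂(wMeasure N) = ∫ x, ‖x‖ • F x ∂(polM N) := by
  rw [wMeasure_eq_withDensity_polM hN, integral_withDensity_eq_integral_smul (by fun_prop)]
  rfl

lemma integrable_wMeasure (hN : 3 ≤ N) {F : Pt N → E} :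
    Integrable F (wMeasure N) ↔ Integrable (fun x => ‖x‖ • F x) (polM N) := by
  rw [wMeasure_eq_withDensity_polM hN, integrable_withDensity_iff_integrable_smul (by fun_prop)]
  rfl

lemma map_norm_polM :
    Measure.map (fun x : Pt N => ‖x‖) (polM N) =
      (sphM N) Set.univ • volume.restrict (Set.Ioi (0 : ℝ)) := by
  rw [polM, Measure.map_map measurable_norm continuous_polar.measurable, ← Measure.map_snd_prod]
  refine Measure.map_congr ?_
  filter_upwards [ae_pos_prod] with z hz
  simp [norm_polar, abs_of_pos hz]

lemma integral_polM_radial {k : ℝ → E}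
    (hk : AEStronglyMeasurable k (volume.restrict (Set.Ioi (0 : ℝ)))) :
    ∫ x, k ‖x‖ ∂(polM N) = sphArea N • ∫ r in Set.Ioi (0 : ℝ), k r := by
  rw [sphArea, Measure.real, ← integral_smul_measure, ← map_norm_polM,
    integral_map measurable_norm.aemeasurable]
  rw [map_norm_polM]
  exact hk.smul_measure _

omit [NormedSpace ℝ E] in
lemma integrable_polM_radial (hN : 3 ≤ N) {k : ℝ → E}
    (hk : AEStronglyMeasurable k (volume.restrict (Set.Ioi (0 : ℝ)))) :
    Integrable (fun x => k ‖x‖) (polM N) ↔ IntegrableOn k (Set.Ioi (0 : ℝ)) := by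
  have h0 : (sphM N) Set.univ ≠ 0 := by
    have := sphArea_pos hN
    rw [sphArea, Measure.real, ENNReal.toReal_pos_iff] at this
    exact this.1.ne'
  rw [IntegrableOn, ← integrable_smul_measure (μ := volume.restrict (Set.Ioi (0 : ℝ))) h0
    (measure_ne_top _ _), ← map_norm_polM, integrable_map_measure _ measurable_norm.aemeasurable]
  · rfl
  · rw [map_norm_polM]
    exact hk.smul_measure _

end Integrals

/-! ### Annuli around the origin -/

/-- The annulus `a < |x| ≤ b`. -/
def ann (N : ℕ) (a b : ℝ) : Set (Pt N) := {x | ‖x‖ ∈ Set.Ioc a b}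

lemma measurableSet_ann (a b : ℝ) : MeasurableSet (ann N a b) :=
  measurable_norm measurableSet_Ioc

lemma polM_ann_lt_top (a b : ℝ) : polM N (ann N a b) < ⊤ := by
  have : polM N (ann N a b) = Measure.map (fun x : Pt N => ‖x‖) (polM N) (Set.Ioc a b) := by
    rw [Measure.map_apply measurable_norm measurableSet_Ioc]; rfl
  rw [this, map_norm_polM]
  simp only [Measure.smul_apply, smul_eq_mul]
  refine ENNReal.mul_lt_top (measure_lt_top _ _) ?_
  refine (Measure.restrict_apply_le _ _).trans_lt ?_
  simp

instance (a b : ℝ) : IsFiniteMeasure ((polM N).restrict (ann N a b)) :=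
  ⟨by simpa using polM_ann_lt_top a b⟩

variable {E : Type*} [NormedAddCommGroup E] [NormedSpace ℝ E]

lemma integral_ann_radial {k : ℝ → E} {a b : ℝ} (ha : 0 < a) (hab : a ≤ b)
    (hk : AEStronglyMeasurable k (volume.restrict (Set.Ioi (0 : ℝ)))) :
    ∫ x in ann N a b, k ‖x‖ ∂(polM N) = sphArea N • ∫ r in a..b, k r := by
  have h1 : ∫ x in ann N a b, k ‖x‖ ∂(polM N) =
      ∫ x, (Set.Ioc a b).indicator k ‖x‖ ∂(polM N) := by
    rw [← integral_indicator (measurableSet_ann a b)]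
    rfl
  rw [h1, integral_polM_radial (hk.indicator measurableSet_Ioc),
    intervalIntegral.integral_of_le hab, integral_indicator measurableSet_Ioc,
    Measure.restrict_restrict measurableSet_Ioc, Set.inter_eq_left.2]
  exact fun r hr => ha.trans hr.1

lemma polM_restrict_ann {a b : ℝ} (ha : 0 < a) :
    (polM N).restrict (ann N a b) = Measure.map (fun z : Sph N × ℝ => z.2 • (z.1 : Pt N))
      ((sphM N).prod (volume.restrict (Set.Ioc a b))) := by
  rw [polM, Measure.restrict_map continuous_polar.measurable (measurableSet_ann a b)]
  congr 1
  have h1 : (volume.restrict (Set.Ioc a b)) =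
      (volume.restrict (Set.Ioi (0 : ℝ))).restrict (Set.Ioc a b) := by
    rw [Measure.restrict_restrict measurableSet_Ioc, Set.inter_eq_left.2]
    exact fun r hr => ha.trans hr.1
  rw [h1]
  conv_rhs => rw [← Measure.restrict_univ (μ := sphM N), Measure.prod_restrict]
  refine Measure.restrict_congr_set ?_
  filter_upwards [ae_pos_prod] with z hz
  refine propext (show ‖z.2 • (z.1 : Pt N)‖ ∈ Set.Ioc a b ↔ z.1 ∈ Set.univ ∧ z.2 ∈ Set.Ioc a b from ?_)
  simp [norm_polar, abs_of_pos hz]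

lemma isCompact_closedAnnulus (a b : ℝ) : IsCompact {x : Pt N | a ≤ ‖x‖ ∧ ‖x‖ ≤ b} := by
  refine Metric.isCompact_of_isClosed_isBounded ?_ ?_
  · exact (isClosed_le continuous_const continuous_norm).inter
      (isClosed_le continuous_norm continuous_const)
  · exact (Metric.isBounded_closedBall (x := (0 : Pt N)) (r := b)).subset
      fun x hx => by simpa using hx.2

omit [NormedSpace ℝ E] in
lemma integrableOn_ann_of_continuousOn {G : Pt N → E} {a b : ℝ} (ha : 0 < a)
    (hG : ContinuousOn G {0}ᶜ) : IntegrableOn G (ann N a b) (polM N) := by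
  have hsub : ∀ x ∈ {x : Pt N | a ≤ ‖x‖ ∧ ‖x‖ ≤ b}, x ∈ ({0}ᶜ : Set (Pt N)) := by
    rintro x ⟨hx, -⟩ rfl
    simp at hx; linarith
  obtain ⟨C, hC⟩ := (isCompact_closedAnnulus a b).exists_bound_of_continuousOn (hG.mono hsub)
  have hin : ∀ x ∈ ann N a b, x ∈ {x : Pt N | a ≤ ‖x‖ ∧ ‖x‖ ≤ b} := fun x hx => ⟨hx.1.le, hx.2⟩
  refine Integrable.of_bound (C := C) ?_ ?_
  · exact (hG.mono fun x hx => hsub x (hin x hx)).aestronglyMeasurable (measurableSet_ann a b)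
  · exact (ae_restrict_iff' (measurableSet_ann a b)).2 (Eventually.of_forall fun x hx => hC x (hin x hx))

lemma integral_ann_polar {G : Pt N → E} {a b : ℝ} (ha : 0 < a) (hab : a ≤ b)
    (hG : ContinuousOn G {0}ᶜ) :
    ∫ x in ann N a b, G x ∂(polM N) = ∫ e : Sph N, (∫ r in a..b, G (r • (e : Pt N))) ∂(sphM N) := by
  have hi := integrableOn_ann_of_continuousOn (b := b) ha hG
  rw [IntegrableOn, polM_restrict_ann ha] at hi
  rw [polM_restrict_ann ha, integral_map continuous_polar.measurable.aemeasurable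
    hi.aestronglyMeasurable, integral_prod]
  · simp only [intervalIntegral.integral_of_le hab]
  · exact (integrable_map_measure hi.aestronglyMeasurable
      continuous_polar.measurable.aemeasurable).1 hi

end HardyNLS

namespace HardyNLS

variable {N : ℕ} {E : Type*} [NormedAddCommGroup E] [NormedSpace ℝ E]

/-! ### Pairs of a function and its radial derivative -/

/-- The integral of `F` over the sphere of radius `r`, normalised to the unit sphere and expressed
through the values of `F` and of its radial derivative `D` on the annulus `r < |x| ≤ r + 1`. -/
def radT (F D : Pt N → E) (r : ℝ) : E :=
  ∫ x in ann N r (r + 1), (F x - (r + 1 - ‖x‖) • D x) ∂(polM N)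

/-- `D` is the radial derivative of `F` in the sense of spherical means. -/
structure RadPair (F D : Pt N → E) : Prop where
  intF : ∀ a b, 0 < a → IntegrableOn F (ann N a b) (polM N)
  intD : ∀ a b, 0 < a → IntegrableOn D (ann N a b) (polM N)
  diff : ∀ a b, 0 < a → a ≤ b → radT F D b - radT F D a = ∫ x in ann N a b, D x ∂(polM N)
  avg : ∀ a b, 0 < a → a ≤ b → ∫ r in a..b, radT F D r = ∫ x in ann N a b, F x ∂(polM N)
  cont : ContinuousOn (radT F D) (Set.Ioi 0)

lemma norm_inv_smul_polar {r : ℝ} (hr : 0 < r) (e : Sph N) :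
    ‖r • (e : Pt N)‖⁻¹ • (r • (e : Pt N)) = e := by
  rw [norm_smul, norm_eq_of_mem_sphere, mul_one, Real.norm_eq_abs, abs_of_pos hr, smul_smul,
    inv_mul_cancel₀ hr.ne', one_smul]

/-- The classical radial derivative. -/
def radDeriv (F : Pt N → E) (x : Pt N) : E := fderiv ℝ F x (‖x‖⁻¹ • x)

lemma continuousOn_radDeriv {F : Pt N → E} (hF : ContDiff ℝ 1 F) :
    ContinuousOn (radDeriv F) {0}ᶜ := by
  have h1 : Continuous (fderiv ℝ F) := hF.continuous_fderiv (by simp)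
  have h2 : ContinuousOn (fun x : Pt N => ‖x‖⁻¹ • x) {0}ᶜ :=
    (continuous_norm.continuousOn.inv₀ fun x hx => by simpa using hx).smul continuousOn_id
  exact h1.continuousOn.clm_apply h2

lemma hasDerivAt_ray {F : Pt N → E} (hF : ContDiff ℝ 1 F) (e : Sph N) {s : ℝ} (hs : 0 < s) :
    HasDerivAt (fun s : ℝ => F (s • (e : Pt N))) (radDeriv F (s • (e : Pt N))) s := by
  have h1 : HasFDerivAt F (fderiv ℝ F (s • (e : Pt N))) (s • (e : Pt N)) :=
    (hF.differentiable (by simp) _).hasFDerivAt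
  have h2 : HasDerivAt (fun s : ℝ => s • (e : Pt N)) ((1 : ℝ) • (e : Pt N)) s :=
    (hasDerivAt_id s).smul_const _
  have := h1.comp_hasDerivAt s h2
  rw [one_smul] at this
  rw [radDeriv, norm_inv_smul_polar hs e]
  exact this

omit [NormedSpace ℝ E] in
lemma continuousOn_ray {G : Pt N → E} (hG : ContinuousOn G {0}ᶜ) (e : Sph N) {a b : ℝ} (ha : 0 < a)
    (hab : a ≤ b) : ContinuousOn (fun s : ℝ => G (s • (e : Pt N))) (Set.uIcc a b) := by
  refine hG.comp (by fun_prop) fun s hs => ?_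
  rw [Set.uIcc_of_le hab] at hs
  have h0 : 0 < s := ha.trans_le hs.1
  have : ‖s • (e : Pt N)‖ ≠ 0 := by rw [norm_smul, norm_eq_of_mem_sphere]; simp [h0.ne']
  simpa using this

/-! ### Smooth functions and their classical radial derivatives -/

section Smooth

variable [CompleteSpace E]

/-- On each ray the integrand is the derivative of -(r+1-s)F(sω). The weight vanishes at s = r+1 and
equals 1 at s = r, so only F(rω) survives. This is the reason for the form of `radT`: it recovers
the trace on a sphere from volume integrals, which make sense for L¹ pairs. -/
lemma radT_smooth {F : Pt N → E} (hF : ContDiff ℝ 1 F) {r : ℝ} (hr : 0 < r) :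
    radT F (radDeriv F) r = ∫ e : Sph N, F (r • (e : Pt N)) ∂(sphM N) := by
  have hc : ContinuousOn (fun x : Pt N => F x - (r + 1 - ‖x‖) • radDeriv F x) {0}ᶜ :=
    hF.continuous.continuousOn.sub
      (ContinuousOn.smul (by fun_prop) (continuousOn_radDeriv hF))
  rw [radT, integral_ann_polar hr (by linarith) hc]
  refine integral_congr_ae (Eventually.of_forall fun e => ?_)
  have hd : ∀ s ∈ Set.uIcc r (r + 1), HasDerivAt (fun s : ℝ => -((r + 1 - s) • F (s • (e : Pt N))))
      (F (s • (e : Pt N)) - (r + 1 - ‖s • (e : Pt N)‖) • radDeriv F (s • (e : Pt N))) s := by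
    intro s hs
    rw [Set.uIcc_of_le (by linarith)] at hs
    have h0 : 0 < s := hr.trans_le hs.1
    have h1 : HasDerivAt (fun s : ℝ => r + 1 - s) (-1) s := by
      simpa using (hasDerivAt_id s).const_sub (r + 1)
    have := (h1.smul (hasDerivAt_ray hF e h0)).neg
    refine this.congr_deriv ?_
    rw [norm_smul, norm_eq_of_mem_sphere, mul_one, Real.norm_eq_abs, abs_of_pos h0]
    simp
    abel
  dsimp only
  rw [intervalIntegral.integral_eq_sub_of_hasDerivAt hd]
  · simp
  · exact (continuousOn_ray hc e hr (by linarith)).intervalIntegrable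

/-- The fundamental theorem of calculus on rays gives `diff`; Fubini between sphere and radius gives
`avg`. -/
lemma RadPair.of_contDiff {F : Pt N → E} (hF : ContDiff ℝ 1 F) : RadPair F (radDeriv F) where
  intF a b ha := integrableOn_ann_of_continuousOn ha hF.continuous.continuousOn
  intD a b ha := integrableOn_ann_of_continuousOn ha (continuousOn_radDeriv hF)
  diff a b ha hab := by
    have hint : ∀ r : ℝ, Integrable (fun e : Sph N => F (r • (e : Pt N))) (sphM N) := fun r =>
      (hF.continuous.comp (by fun_prop)).integrable_of_hasCompactSupport
        (HasCompactSupport.of_compactSpace _)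
    rw [radT_smooth hF ha, radT_smooth hF (ha.trans_le hab), ← integral_sub (hint b) (hint a),
      integral_ann_polar ha hab (continuousOn_radDeriv hF)]
    refine integral_congr_ae (Eventually.of_forall fun e => ?_)
    dsimp only
    rw [intervalIntegral.integral_eq_sub_of_hasDerivAt (fun s hs => hasDerivAt_ray hF e ?_)]
    · exact (continuousOn_ray (continuousOn_radDeriv hF) e ha hab).intervalIntegrable
    · rw [Set.uIcc_of_le hab] at hs
      exact ha.trans_le hs.1
  avg a b ha hab := by
    rw [integral_ann_polar ha hab hF.continuous.continuousOn]
    rw [← intervalIntegral_integral_swap]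
    · refine intervalIntegral.integral_congr fun r hr => ?_
      rw [Set.uIcc_of_le hab] at hr
      exact radT_smooth hF (ha.trans_le hr.1)
    · have hc : Continuous (Function.uncurry fun (r : ℝ) (e : Sph N) => F (r • (e : Pt N))) :=
        hF.continuous.comp (by fun_prop)
      have : (volume.restrict (Set.uIoc a b)).prod (sphM N) =
          (volume.prod (sphM N)).restrict (Set.uIoc a b ×ˢ Set.univ) := by
        rw [← Measure.prod_restrict, Measure.restrict_univ]
      rw [this]
      refine IntegrableOn.mono_set (t := Set.uIcc a b ×ˢ Set.univ) ?_
        (Set.prod_mono_left Set.uIoc_subset_uIcc)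
      exact hc.continuousOn.integrableOn_compact (isCompact_uIcc.prod isCompact_univ)
  cont := by
    have h1 : Continuous fun r : ℝ => ∫ e in Set.univ, F (r • (e : Pt N)) ∂(sphM N) :=
      continuous_parametric_integral_of_continuous
        (f := fun (r : ℝ) (e : Sph N) => F (r • (e : Pt N)))
        (hF.continuous.comp (by fun_prop)) isCompact_univ
    refine h1.continuousOn.congr fun r hr => ?_
    rw [radT_smooth hF hr, Measure.restrict_univ]

end Smooth

/-! ### Stability of radial pairs under limits and recovery of the function -/

lemma ann_mono {a b a' b' : ℝ} (ha : a' ≤ a) (hb : b ≤ b') : ann N a b ⊆ ann N a' b' :=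
  fun _ hx => ⟨ha.trans_lt hx.1, hx.2.trans hb⟩

lemma integrableOn_radT_integrand {F D : Pt N → E} {r : ℝ} 
    (hF : IntegrableOn F (ann N r (r + 1)) (polM N)) (hD : IntegrableOn D (ann N r (r + 1)) (polM N)) :
    IntegrableOn (fun x => F x - (r + 1 - ‖x‖) • D x) (ann N r (r + 1)) (polM N) := by
  refine hF.sub (Integrable.mono hD ?_ ?_)
  · exact AEStronglyMeasurable.smul (by fun_prop) hD.aestronglyMeasurable
  · refine (ae_restrict_iff' (measurableSet_ann _ _)).2 (Eventually.of_forall fun x hx => ?_)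
    rw [norm_smul]
    refine mul_le_of_le_one_left (norm_nonneg _) ?_
    rw [Real.norm_eq_abs, abs_le]
    constructor <;> linarith [hx.1, hx.2]

lemma norm_radT_le {F D : Pt N → E} {r : ℝ} 
    (hF : IntegrableOn F (ann N r (r + 1)) (polM N)) (hD : IntegrableOn D (ann N r (r + 1)) (polM N)) :
    ‖radT F D r‖ ≤ ∫ x in ann N r (r + 1), ‖F x‖ ∂(polM N) +
      ∫ x in ann N r (r + 1), ‖D x‖ ∂(polM N) := by
  rw [← integral_add hF.norm hD.norm]
  refine norm_integral_le_of_norm_le (hF.norm.add hD.norm) ?_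
  refine (ae_restrict_iff' (measurableSet_ann _ _)).2 (Eventually.of_forall fun x hx => ?_)
  refine (norm_sub_le _ _).trans (add_le_add_right ?_ _)
  rw [norm_smul]
  refine mul_le_of_le_one_left (norm_nonneg _) ?_
  rw [Real.norm_eq_abs, abs_le]
  constructor <;> linarith [hx.1, hx.2]

lemma radT_sub {F D F' D' : Pt N → E} {r : ℝ} 
    (hF : IntegrableOn F (ann N r (r + 1)) (polM N)) (hD : IntegrableOn D (ann N r (r + 1)) (polM N))
    (hF' : IntegrableOn F' (ann N r (r + 1)) (polM N))
    (hD' : IntegrableOn D' (ann N r (r + 1)) (polM N)) :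
    radT (fun x => F x - F' x) (fun x => D x - D' x) r = radT F D r - radT F' D' r := by
  unfold radT
  rw [← integral_sub (integrableOn_radT_integrand hF hD) (integrableOn_radT_integrand hF' hD')]
  congr 1
  ext x
  rw [smul_sub]
  exact sub_sub_sub_comm _ _ _ _

lemma tendsto_integral_of_tendsto_norm_sub {α : Type*} [MeasurableSpace α] {μ : Measure α}
    {F : ℕ → α → E} {G : α → E} (hF : ∀ n, Integrable (F n) μ) (hG : Integrable G μ)
    (h : Tendsto (fun n => ∫ x, ‖F n x - G x‖ ∂μ) atTop (𝓝 0)) :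
    Tendsto (fun n => ∫ x, F n x ∂μ) atTop (𝓝 (∫ x, G x ∂μ)) := by
  rw [tendsto_iff_norm_sub_tendsto_zero]
  refine squeeze_zero (fun _ => norm_nonneg _) (fun n => ?_) h
  rw [← integral_sub (hF n) hG]
  exact norm_integral_le_integral_norm _

/-- `RadPair` is closed under convergence in `L¹` on annuli. -/
lemma RadPair.of_tendsto {F D : ℕ → Pt N → E} {F' D' : Pt N → E} (h : ∀ n, RadPair (F n) (D n))
    (hF' : ∀ a b, 0 < a → IntegrableOn F' (ann N a b) (polM N))
    (hD' : ∀ a b, 0 < a → IntegrableOn D' (ann N a b) (polM N))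
    (hF : ∀ a b, 0 < a → 
      Tendsto (fun n => ∫ x in ann N a b, ‖F n x - F' x‖ ∂(polM N)) atTop (𝓝 0))
    (hD : ∀ a b, 0 < a → 
      Tendsto (fun n => ∫ x in ann N a b, ‖D n x - D' x‖ ∂(polM N)) atTop (𝓝 0)) :
    RadPair F' D' := by
  -- The annulus on the right does not depend on r, and reaches to b+1 because `radT` at r looks as
  -- far as r+1. Convergence is therefore uniform on [a, b], which carries continuity to the limit.
  have hbound : ∀ a b r, 0 < a → r ∈ Set.Icc a b → ∀ n, ‖radT (F n) (D n) r - radT F' D' r‖ ≤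
      ∫ x in ann N a (b + 1), ‖F n x - F' x‖ ∂(polM N) +
      ∫ x in ann N a (b + 1), ‖D n x - D' x‖ ∂(polM N) := by
    intro a b r ha hr n
    have hr0 : 0 < r := ha.trans_le hr.1
    have hi1 := fun a b ha => ((h n).intF a b ha).sub (hF' a b ha)
    have hi2 := fun a b ha => ((h n).intD a b ha).sub (hD' a b ha)
    rw [← radT_sub ((h n).intF _ _ hr0) ((h n).intD _ _ hr0) (hF' _ _ hr0) (hD' _ _ hr0)]
    refine (norm_radT_le (hi1 _ _ hr0) (hi2 _ _ hr0)).trans (add_le_add ?_ ?_)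
    · exact setIntegral_mono_set (hi1 _ _ ha).norm (Eventually.of_forall fun _ => norm_nonneg _)
        (LE.le.eventuallyLE (ann_mono hr.1 (by linarith [hr.2])))
    · exact setIntegral_mono_set (hi2 _ _ ha).norm (Eventually.of_forall fun _ => norm_nonneg _)
        (LE.le.eventuallyLE (ann_mono hr.1 (by linarith [hr.2])))
  have hunif : ∀ a b, 0 < a →
      TendstoUniformlyOn (fun n => radT (F n) (D n)) (radT F' D') atTop (Set.Icc a b) := by
    intro a b ha
    rw [Metric.tendstoUniformlyOn_iff]
    intro ε hε
    have := (hF a (b + 1) ha).add (hD a (b + 1) ha)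
    rw [add_zero] at this
    filter_upwards [this.eventually (gt_mem_nhds hε)] with n hn r hr
    rw [dist_comm, dist_eq_norm]
    exact (hbound a b r ha hr n).trans_lt hn
  have hcont : ContinuousOn (radT F' D') (Set.Ioi 0) := by
    refine continuousOn_of_forall_continuousAt fun r hr => ?_
    have hr : 0 < r := hr
    have h1 : ContinuousOn (radT F' D') (Set.Icc (r / 2) (r + 1)) :=
      (hunif _ _ (by linarith)).continuousOn (Frequently.of_forall fun n =>
        (h n).cont.mono fun s hs => (by linarith [hs.1] : (0 : ℝ) < r / 2).trans_le hs.1)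
    exact h1.continuousAt (Icc_mem_nhds (by linarith) (by linarith))
  have hpt : ∀ r, 0 < r → Tendsto (fun n => radT (F n) (D n) r) atTop (𝓝 (radT F' D' r)) :=
    fun r hr => (hunif r r hr).tendsto_at ⟨le_rfl, le_rfl⟩
  refine ⟨hF', hD', fun a b ha hab => ?_, fun a b ha hab => ?_, hcont⟩
  · refine tendsto_nhds_unique ((hpt b (ha.trans_le hab)).sub (hpt a ha)) ?_
    simp only [fun n => (h n).diff a b ha hab]
    exact tendsto_integral_of_tendsto_norm_sub (fun n => (h n).intD a b ha) (hD' a b ha) (hD a b ha)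
  · have hsub : ∀ s ∈ Set.uIcc a b, s ∈ Set.Ioi (0 : ℝ) := fun s hs => by
      rw [Set.uIcc_of_le hab] at hs
      exact ha.trans_le hs.1
    have h1 : Tendsto (fun n => ∫ r in a..b, radT (F n) (D n) r) atTop
        (𝓝 (∫ r in a..b, radT F' D' r)) := by
      rw [tendsto_iff_norm_sub_tendsto_zero]
      have := ((hF a (b + 1) ha).add (hD a (b + 1) ha)).mul_const |b - a|
      rw [add_zero, zero_mul] at this
      refine squeeze_zero (fun _ => norm_nonneg _) (fun n => ?_) this
      rw [← intervalIntegral.integral_sub ((h n).cont.mono hsub).intervalIntegrable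
        (hcont.mono hsub).intervalIntegrable]
      refine intervalIntegral.norm_integral_le_of_norm_le_const fun r hr => hbound a b r ha ?_ n
      rw [Set.uIoc_of_le hab] at hr
      exact ⟨hr.1.le, hr.2⟩
    refine tendsto_nhds_unique h1 ?_
    simp only [fun n => (h n).avg a b ha hab]
    exact tendsto_integral_of_tendsto_norm_sub (fun n => (h n).intF a b ha) (hF' a b ha) (hF a b ha)

/-- If the derivative is integrable near infinity, then `radT` is recovered from it. -/
lemma RadPair.radT_eq {F D : Pt N → E} (h : RadPair F D) {a : ℝ} (ha : 0 < a)
    (hF : IntegrableOn F {x | a < ‖x‖} (polM N)) (hD : IntegrableOn D {x | a < ‖x‖} (polM N)) :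
    radT F D a = -∫ x in {x | a < ‖x‖}, D x ∂(polM N) := by
  have hm : ∀ b : ℝ, MeasurableSet {x : Pt N | b < ‖x‖} := fun b =>
    measurableSet_lt measurable_const measurable_norm
  have hann : ∀ b : ℝ, ann N a b = {x : Pt N | a < ‖x‖} ∩ {x | ‖x‖ ≤ b} := fun b => rfl
  have hlim : ∀ {G : Pt N → E}, IntegrableOn G {x | a < ‖x‖} (polM N) →
      Tendsto (fun n : ℕ => ∫ x in ann N a n, G x ∂(polM N)) atTop
        (𝓝 (∫ x in {x | a < ‖x‖}, G x ∂(polM N))) := by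
    intro G hG
    have hU : {x : Pt N | a < ‖x‖} = ⋃ n : ℕ, ann N a n := by
      ext x
      simp only [Set.mem_iUnion]
      constructor
      · intro hx
        obtain ⟨n, hn⟩ := exists_nat_ge ‖x‖
        exact ⟨n, hx, hn⟩
      · rintro ⟨n, hn⟩
        exact hn.1
    rw [hU]
    refine tendsto_setIntegral_of_monotone (fun n => measurableSet_ann _ _) ?_ (by rwa [← hU])
    exact fun m n hmn => ann_mono le_rfl (by exact_mod_cast hmn)
  have h0 : ∀ {G : Pt N → E}, IntegrableOn G {x | a < ‖x‖} (polM N) →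
      Tendsto (fun n : ℕ => ∫ x in {x : Pt N | (n : ℝ) < ‖x‖}, ‖G x‖ ∂(polM N)) atTop (𝓝 0) := by
    intro G hG
    have hE : (⋂ n : ℕ, {x : Pt N | (n : ℝ) < ‖x‖}) = ∅ := by
      refine Set.eq_empty_of_forall_notMem fun x hx => ?_
      obtain ⟨n, hn⟩ := exists_nat_ge ‖x‖
      exact absurd (Set.mem_iInter.1 hx n) (not_lt.2 hn)
    have := tendsto_setIntegral_of_antitone (μ := polM N) (f := fun x => ‖G x‖)
      (s := fun n : ℕ => {x : Pt N | (n : ℝ) < ‖x‖}) (fun n => hm n)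
      (fun m n hmn x hx => lt_of_le_of_lt (Nat.cast_le.2 hmn : (m : ℝ) ≤ n) hx)
      ⟨⌈a⌉₊, (hG.mono_set fun x hx => lt_of_le_of_lt (Nat.le_ceil a) hx).norm⟩
    rwa [hE, Measure.restrict_empty, integral_zero_measure] at this
  -- `radT` at n is bounded by the L¹ norms of F and D beyond radius n, which are tails of
  -- convergent integrals.
  have hT : Tendsto (fun n : ℕ => radT F D n) atTop (𝓝 0) := by
    rw [tendsto_zero_iff_norm_tendsto_zero]
    have := (h0 hF).add (h0 hD)
    rw [add_zero] at this
    refine squeeze_zero' (Eventually.of_forall fun _ => norm_nonneg _) ?_ this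
    filter_upwards [eventually_ge_atTop ⌈a⌉₊] with n hn
    have hn : a ≤ n := Nat.ceil_le.1 hn
    have hs : {x : Pt N | (n : ℝ) < ‖x‖} ⊆ {x : Pt N | a < ‖x‖} := fun x hx =>
      lt_of_le_of_lt hn hx
    have hs' : ann N n (n + 1) ⊆ {x : Pt N | (n : ℝ) < ‖x‖} := fun x hx => hx.1
    refine (norm_radT_le (h.intF _ _ (ha.trans_le hn)) (h.intD _ _ (ha.trans_le hn))).trans
      (add_le_add ?_ ?_)
    · exact setIntegral_mono_set (hF.mono_set hs).norm
        (Eventually.of_forall fun _ => norm_nonneg _) hs'.eventuallyLE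
    · exact setIntegral_mono_set (hD.mono_set hs).norm
        (Eventually.of_forall fun _ => norm_nonneg _) hs'.eventuallyLE
  have h1 : Tendsto (fun n : ℕ => radT F D n - radT F D a) atTop
      (𝓝 (∫ x in {x | a < ‖x‖}, D x ∂(polM N))) := by
    refine (hlim hD).congr' ?_
    filter_upwards [eventually_ge_atTop ⌈a⌉₊] with n hn
    exact (h.diff a n ha (Nat.ceil_le.1 hn)).symm
  have := tendsto_nhds_unique h1 (hT.sub_const _)
  rw [this]; simp

/-- A radial function is recovered from its `radT`. -/
lemma RadPair.radial_ae [CompleteSpace E]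
    (hN : 3 ≤ N) {F D : Pt N → E} (h : RadPair F D) {k : ℝ → E}
    (hk : StronglyMeasurable k) (hFk : ∀ᵐ x ∂(polM N), F x = k ‖x‖) :
    ∀ᵐ r ∂(volume.restrict (Set.Ioi (0 : ℝ))), radT F D r = sphArea N • k r := by
  have hkint : ∀ a b : ℝ, 0 < a → a ≤ b → IntervalIntegrable k volume a b := by
    intro a b ha hab
    rw [intervalIntegrable_iff_integrableOn_Ioc_of_le hab]
    have h1 : Integrable (fun x : Pt N => (Set.Ioc a b).indicator k ‖x‖) (polM N) := by
      have := (h.intF a b ha).congr (ae_restrict_of_ae hFk)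
      rw [← IntegrableOn, ← integrable_indicator_iff (measurableSet_ann a b)] at this
      exact this
    have h2 := (integrable_polM_radial hN
      ((hk.aestronglyMeasurable).indicator measurableSet_Ioc)).1 h1
    rw [IntegrableOn, integrable_indicator_iff measurableSet_Ioc, IntegrableOn,
      Measure.restrict_restrict measurableSet_Ioc, Set.inter_eq_left.2] at h2
    · exact h2
    · exact fun r hr => ha.trans hr.1
  -- Both functions have the same integral over every interval: `avg` handles one, radiality of F
  -- and polar coordinates the other.
  have hint : ∀ a b : ℝ, 0 < a → a ≤ b →
      ∫ r in a..b, radT F D r = sphArea N • ∫ r in a..b, k r := by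
    intro a b ha hab
    rw [h.avg a b ha hab, ← integral_ann_radial ha hab hk.aestronglyMeasurable]
    exact integral_congr_ae (ae_restrict_of_ae hFk)
  -- The common primitive is differentiated: almost everywhere on the side of k (Lebesgue),
  -- everywhere on the side of the continuous `radT`. The intervals (1/(n+1), n+1) exhaust the half
  -- line.
  have hloc : ∀ n : ℕ, ∀ᵐ r : ℝ, r ∈ Set.Ioo (1 / ((n : ℝ) + 1)) (n + 1) →
      radT F D r = sphArea N • k r := by
    intro n
    have hn : 0 < 1 / ((n : ℝ) + 1) := by positivity
    have hle : 1 / ((n : ℝ) + 1) ≤ n + 1 := by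
      rw [div_le_iff₀ (by positivity)]
      nlinarith [Nat.cast_nonneg (α := ℝ) n]
    filter_upwards [(hkint _ _ hn hle).ae_hasDerivAt_integral] with r hr hmem
    have h1 := (hr (by rw [Set.uIcc_of_le hle]; exact ⟨hmem.1.le, hmem.2.le⟩) _
      Set.left_mem_uIcc).const_smul (sphArea N)
    have hr0 : 0 < r := hn.trans hmem.1
    have hsub : Set.uIcc (1 / ((n : ℝ) + 1)) r ⊆ Set.Ioi 0 := by
      rw [Set.uIcc_of_le hmem.1.le]
      exact fun s hs => hn.trans_le hs.1
    have h2 : HasDerivAt (fun s => ∫ t in (1 / ((n : ℝ) + 1))..s, radT F D t) (radT F D r) r :=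
      intervalIntegral.integral_hasDerivAt_right (h.cont.mono hsub).intervalIntegrable
        (h.cont.stronglyMeasurableAtFilter isOpen_Ioi r hr0)
        (h.cont.continuousAt (Ioi_mem_nhds hr0))
    refine h2.unique (h1.congr_of_eventuallyEq ?_)
    filter_upwards [Ioi_mem_nhds hmem.1] with s hs
    exact hint _ _ hn (le_of_lt hs)
  rw [ae_restrict_iff' measurableSet_Ioi]
  filter_upwards [ae_all_iff.2 hloc] with r hr hr0
  have hr0 : 0 < r := hr0
  obtain ⟨n, hn⟩ := exists_nat_gt (max r (1 / r))
  have hn1 : r < n := (le_max_left _ _).trans_lt hn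
  have hn2 : 1 / r < n := (le_max_right _ _).trans_lt hn
  refine hr n ⟨?_, by linarith⟩
  rw [div_lt_comm₀ (by positivity) hr0]
  linarith

end HardyNLS

namespace HardyNLS

/-! ### Square integrable functions for `|x|^{-(N-2)} dx` -/

section L2

variable {α : Type*} [MeasurableSpace α] {μ : Measure α} {E F : Type*}
  [NormedAddCommGroup E] [InnerProductSpace ℝ E] [NormedAddCommGroup F] [InnerProductSpace ℝ F]

lemma integral_mul_le_sqrt {f g : α → ℝ} (hf : MemLp f 2 μ) (hg : MemLp g 2 μ) (hf0 : ∀ x, 0 ≤ f x)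
    (hg0 : ∀ x, 0 ≤ g x) :
    ∫ x, f x * g x ∂μ ≤ √(∫ x, f x ^ 2 ∂μ) * √(∫ x, g x ^ 2 ∂μ) := by
  have h := integral_mul_le_Lp_mul_Lq_of_nonneg (μ := μ) Real.HolderConjugate.two_two
    (Eventually.of_forall hf0) (Eventually.of_forall hg0) (by simpa using hf) (by simpa using hg)
  simpa [Real.sqrt_eq_rpow] using h

lemma Lp_norm_sq_eq (A : Lp E 2 μ) : ‖A‖ ^ 2 = ∫ x, ‖A x‖ ^ 2 ∂μ := by
  rw [← real_inner_self_eq_norm_sq, L2.inner_def]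
  simp only [real_inner_self_eq_norm_sq]

lemma Lp_norm_eq_sqrt (A : Lp E 2 μ) : ‖A‖ = √(∫ x, ‖A x‖ ^ 2 ∂μ) := by
  rw [← Lp_norm_sq_eq, Real.sqrt_sq (norm_nonneg _)]

omit [InnerProductSpace ℝ E] in
lemma integrable_Lp_norm_sq (A : Lp E 2 μ) : Integrable (fun x => ‖A x‖ ^ 2) μ :=
  (memLp_two_iff_integrable_sq_norm (Lp.memLp A).1).1 (Lp.memLp A)

omit [InnerProductSpace ℝ E] [InnerProductSpace ℝ F] in
lemma integrable_Lp_norm_mul (A : Lp E 2 μ) (B : Lp F 2 μ) :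
    Integrable (fun x => ‖A x‖ * ‖B x‖) μ :=
  MemLp.integrable_mul (Lp.memLp A).norm (Lp.memLp B).norm

lemma integral_Lp_norm_mul_le (A : Lp E 2 μ) (B : Lp F 2 μ) :
    ∫ x, ‖A x‖ * ‖B x‖ ∂μ ≤ ‖A‖ * ‖B‖ := by
  rw [Lp_norm_eq_sqrt A, Lp_norm_eq_sqrt B]
  exact integral_mul_le_sqrt (Lp.memLp A).norm (Lp.memLp B).norm (fun _ => norm_nonneg _)
    fun _ => norm_nonneg _

lemma integrable_Lp_inner (A B : Lp E 2 μ) : Integrable (fun x => inner ℝ (A x) (B x)) μ :=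
  L2.integrable_inner A B

/-- Splitting the difference bilinearly and applying Cauchy–Schwarz: L² convergence of both factors
gives L¹ convergence of the inner products. -/
lemma integral_inner_sub_inner_le (A B A' B' : Lp E 2 μ) :
    ∫ x, ‖inner ℝ (A x) (B x) - inner ℝ (A' x) (B' x)‖ ∂μ ≤ ‖A - A'‖ * ‖B‖ + ‖A'‖ * ‖B - B'‖ := by
  refine le_trans ?_ (add_le_add (integral_Lp_norm_mul_le (A - A') B)
    (integral_Lp_norm_mul_le A' (B - B')))
  rw [← integral_add (integrable_Lp_norm_mul _ _) (integrable_Lp_norm_mul _ _)]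
  refine integral_mono_ae ((integrable_Lp_inner A B).sub (integrable_Lp_inner A' B')).norm
    ((integrable_Lp_norm_mul _ _).add (integrable_Lp_norm_mul _ _)) ?_
  filter_upwards [Lp.coeFn_sub A A', Lp.coeFn_sub B B'] with x hA hB
  rw [hA, hB]
  simp only [Pi.sub_apply]
  have : inner ℝ (A x) (B x) - inner ℝ (A' x) (B' x) =
      inner ℝ (A x - A' x) (B x) + inner ℝ (A' x) (B x - B' x) := by
    rw [inner_sub_left, inner_sub_right]; ring
  rw [this]
  exact (norm_add_le _ _).trans (add_le_add (norm_inner_le_norm _ _) (norm_inner_le_norm _ _))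

end L2

variable {N : ℕ} {E : Type*} [NormedAddCommGroup E] [InnerProductSpace ℝ E]

lemma integral_ann_inv {a b : ℝ} (ha : 0 < a) (hab : a ≤ b) :
    ∫ x in ann N a b, ‖x‖⁻¹ ∂(polM N) = sphArea N * Real.log (b / a) := by
  rw [integral_ann_radial (k := fun r => r⁻¹) ha hab (by fun_prop), smul_eq_mul, integral_inv]
  rw [Set.uIcc_of_le hab]
  exact fun h => absurd h.1 (not_le.2 ha)

/-- Cauchy–Schwarz in L²(dμ) against K = 1/|x| on the annulus: the density |x| cancels K in the
product, while ∫ K² dμ = ∫ |x|^{-1} dσ dr is the logarithm typical of dimension two. -/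
lemma integrableOn_ann_Lp (hN : 3 ≤ N) (A : Lp E 2 (wMeasure N)) {a b : ℝ} (ha : 0 < a)
    (hab : a ≤ b) :
    IntegrableOn A (ann N a b) (polM N) ∧
      ∫ x in ann N a b, ‖A x‖ ∂(polM N) ≤ ‖A‖ * √(sphArea N * Real.log (b / a)) := by
  set K : Pt N → ℝ := (ann N a b).indicator fun x => ‖x‖⁻¹ with hK
  have hKm : Measurable K := Measurable.indicator (by fun_prop) (measurableSet_ann a b)
  have hK0 : ∀ x, 0 ≤ K x := fun x => Set.indicator_nonneg (fun y _ => by positivity) x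
  have hK2 : (fun x : Pt N => ‖x‖ • K x ^ 2) = (ann N a b).indicator fun x => ‖x‖⁻¹ := by
    ext x
    by_cases hx : x ∈ ann N a b
    · have : 0 < ‖x‖ := ha.trans hx.1
      simp only [hK, Set.indicator_of_mem hx, smul_eq_mul]
      field_simp
    · simp [hK, Set.indicator_of_notMem hx]
  have hint : IntegrableOn (fun x : Pt N => ‖x‖⁻¹) (ann N a b) (polM N) :=
    integrableOn_ann_of_continuousOn ha
      (continuous_norm.continuousOn.inv₀ fun x hx => by simpa using hx)
  have hKL : MemLp K 2 (wMeasure N) := by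
    rw [memLp_two_iff_integrable_sq hKm.aestronglyMeasurable, integrable_wMeasure hN, hK2,
      integrable_indicator_iff (measurableSet_ann a b)]
    exact hint
  have hKI : ∫ x, K x ^ 2 ∂(wMeasure N) = sphArea N * Real.log (b / a) := by
    rw [integral_wMeasure hN, hK2, integral_indicator (measurableSet_ann a b), integral_ann_inv ha hab]
  have hprod : (fun x : Pt N => ‖x‖ • (‖A x‖ * K x)) = (ann N a b).indicator fun x => ‖A x‖ := by
    ext x
    by_cases hx : x ∈ ann N a b
    · have : 0 < ‖x‖ := ha.trans hx.1
      simp only [hK, Set.indicator_of_mem hx, smul_eq_mul]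
      field_simp
    · simp [hK, Set.indicator_of_notMem hx]
  constructor
  · have h1 : Integrable (fun x => ‖A x‖ * K x) (wMeasure N) :=
      MemLp.integrable_mul (Lp.memLp A).norm hKL
    rw [integrable_wMeasure hN, hprod, integrable_indicator_iff (measurableSet_ann a b)] at h1
    refine (integrable_norm_iff ?_).1 h1
    exact ((Lp.memLp A).1.mono_ac (polM_ac_wMeasure hN)).restrict
  · have h2 := integral_mul_le_sqrt (Lp.memLp A).norm hKL (fun _ => norm_nonneg _) hK0
    rw [hKI, ← Lp_norm_eq_sqrt, integral_wMeasure hN, hprod,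
      integral_indicator (measurableSet_ann a b)] at h2
    exact h2

/-- Outside radius a the density |x| of `wMeasure` is at least a, so `polM` is dominated there. -/
lemma integrableOn_exterior (hN : 3 ≤ N) {G : Pt N → E} (hG : Integrable G (wMeasure N)) {a : ℝ}
    (ha : 0 < a) :
    IntegrableOn G {x | a < ‖x‖} (polM N) ∧
      ∫ x in {x | a < ‖x‖}, ‖G x‖ ∂(polM N) ≤ a⁻¹ * ∫ x, ‖G x‖ ∂(wMeasure N) := by
  have hm : MeasurableSet {x : Pt N | a < ‖x‖} := measurableSet_lt measurable_const measurable_norm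
  have h1 := (integrable_wMeasure hN).1 hG
  have h2 : Integrable (fun x : Pt N => a⁻¹ * ‖‖x‖ • G x‖) (polM N) := h1.norm.const_mul _
  have h3 : ∀ x ∈ {x : Pt N | a < ‖x‖}, ‖G x‖ ≤ a⁻¹ * ‖‖x‖ • G x‖ := by
    intro x hx
    have hx : a < ‖x‖ := hx
    rw [norm_smul, norm_norm, ← mul_assoc, ← div_eq_inv_mul]
    exact le_mul_of_one_le_left (norm_nonneg _) ((one_le_div ha).2 hx.le)
  have h4 : IntegrableOn G {x | a < ‖x‖} (polM N) := by
    refine Integrable.mono' h2.integrableOn ?_ ((ae_restrict_iff' hm).2 (Eventually.of_forall h3))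
    exact (hG.1.mono_ac (polM_ac_wMeasure hN)).restrict
  refine ⟨h4, ?_⟩
  refine (setIntegral_mono_on h4.norm h2.integrableOn hm h3).trans ?_
  rw [integral_wMeasure hN, ← integral_const_mul]
  refine (setIntegral_le_integral h2 (Eventually.of_forall fun _ => by positivity)).trans_eq ?_
  simp only [norm_smul, norm_norm, smul_eq_mul]

/-! ### The radial component of the gradient -/

/-- The radial component `x/|x| · g`. -/
def radialPart (g : Grad N) (x : Pt N) : ℂ := ∑ i, ((x i / ‖x‖ : ℝ) : ℂ) * g i

lemma norm_radialPart_le (g : Grad N) (x : Pt N) : ‖radialPart g x‖ ≤ ‖g‖ := by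
  set y : Grad N := WithLp.toLp 2 fun i => ((x i / ‖x‖ : ℝ) : ℂ) with hy
  have h1 : radialPart g x = inner ℂ y g := by
    simp [radialPart, hy, PiLp.inner_apply, mul_comm]
  have h2 : ‖y‖ ≤ 1 := by
    rw [EuclideanSpace.norm_eq, Real.sqrt_le_iff]
    refine ⟨zero_le_one, ?_⟩
    rw [one_pow]
    simp only [hy, Complex.norm_real, Real.norm_eq_abs, sq_abs, div_pow]
    rw [← Finset.sum_div, EuclideanSpace.real_norm_sq_eq]
    -- An inequality rather than an equality, since at the origin the quotient is 0/0 = 0.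
    exact div_self_le_one _
  rw [h1]
  exact (norm_inner_le_norm _ _).trans (mul_le_of_le_one_left (norm_nonneg _) h2)

lemma radialPart_add (g g' : Grad N) (x : Pt N) :
    radialPart (g + g') x = radialPart g x + radialPart g' x := by
  simp [radialPart, mul_add, Finset.sum_add_distrib]

lemma radialPart_smul (c : ℝ) (g : Grad N) (x : Pt N) :
    radialPart (c • g) x = c • radialPart g x := by
  simp only [radialPart, PiLp.smul_apply, Complex.real_smul, Finset.mul_sum]
  exact Finset.sum_congr rfl fun i _ => by ring

lemma radialPart_classicalGrad (φ : Pt N → ℂ) (x : Pt N) :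
    radialPart (classicalGrad φ x) x = radDeriv φ x := by
  have hx : ‖x‖⁻¹ • x = ∑ i, (x i / ‖x‖) • EuclideanSpace.single i (1 : ℝ) := by
    ext j
    simp [Finset.sum_apply, div_eq_inv_mul, Pi.single_apply]
  rw [radDeriv, hx, map_sum]
  simp [radialPart, classicalGrad]

lemma aestronglyMeasurable_radialPart (g : Lp (Grad N) 2 (wMeasure N)) :
    AEStronglyMeasurable (fun x => radialPart (g x) x) (wMeasure N) := by
  unfold radialPart
  have hg : AEStronglyMeasurable (fun x => g x) (wMeasure N) := (Lp.memLp g).1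
  refine Finset.aestronglyMeasurable_fun_sum _ fun i _ => AEStronglyMeasurable.mul ?_ ?_
  · have : Measurable fun x : Pt N => ((x i / ‖x‖ : ℝ) : ℂ) :=
      Complex.measurable_ofReal.comp (by fun_prop)
    exact this.aestronglyMeasurable
  · have h : Continuous fun y : Grad N => y i := by fun_prop
    exact h.comp_aestronglyMeasurable hg

lemma memLp_radialPart (g : Lp (Grad N) 2 (wMeasure N)) :
    MemLp (fun x => radialPart (g x) x) 2 (wMeasure N) :=
  (Lp.memLp g).of_le (aestronglyMeasurable_radialPart g)
    (Eventually.of_forall fun _ => norm_radialPart_le _ _)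

/-- The radial component of a field in `L²(dμ)`. -/
def radL (N : ℕ) : Lp (Grad N) 2 (wMeasure N) →L[ℝ] Lp ℂ 2 (wMeasure N) :=
  LinearMap.mkContinuous
    { toFun := fun g => (memLp_radialPart g).toLp
      map_add' := fun g g' => by
        rw [← MemLp.toLp_add]
        refine MemLp.toLp_congr _ _ ?_
        filter_upwards [Lp.coeFn_add g g'] with x hx
        rw [hx]
        exact radialPart_add _ _ _
      map_smul' := fun c g => by
        rw [RingHom.id_apply, ← MemLp.toLp_const_smul]
        refine MemLp.toLp_congr _ _ ?_
        filter_upwards [Lp.coeFn_smul c g] with x hx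
        rw [hx]
        exact radialPart_smul _ _ _ } 1 fun g => by
    rw [one_mul]
    refine Lp.norm_le_norm_of_ae_le ?_
    filter_upwards [(memLp_radialPart g).coeFn_toLp] with x hx
    simp only [LinearMap.coe_mk, AddHom.coe_mk]
    rw [hx]
    exact norm_radialPart_le _ _

lemma radL_ae (g : Lp (Grad N) 2 (wMeasure N)) :
    radL N g =ᵐ[wMeasure N] fun x => radialPart (g x) x := (memLp_radialPart g).coeFn_toLp

lemma norm_radL_le (g : Lp (Grad N) 2 (wMeasure N)) : ‖radL N g‖ ≤ ‖g‖ := by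
  refine Lp.norm_le_norm_of_ae_le ?_
  filter_upwards [radL_ae g] with x hx
  rw [hx]
  exact norm_radialPart_le _ _

end HardyNLS

namespace HardyNLS

variable {N : ℕ}

/-! ### Elements of the weighted space and their radial profiles -/

section Congr

variable {E : Type*} [NormedAddCommGroup E] [NormedSpace ℝ E]

lemma radT_congr {F D F' D' : Pt N → E} (hF : F =ᵐ[polM N] F') (hD : D =ᵐ[polM N] D') (r : ℝ) :
    radT F D r = radT F' D' r := by
  refine integral_congr_ae (ae_restrict_of_ae ?_)
  filter_upwards [hF, hD] with x h1 h2
  rw [h1, h2]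

lemma RadPair.congr {F D F' D' : Pt N → E} (h : RadPair F D) (hF : F =ᵐ[polM N] F')
    (hD : D =ᵐ[polM N] D') : RadPair F' D' := by
  have hT : radT F D = radT F' D' := funext (radT_congr hF hD)
  refine ⟨fun a b ha => (h.intF a b ha).congr (ae_restrict_of_ae hF),
    fun a b ha => (h.intD a b ha).congr (ae_restrict_of_ae hD), fun a b ha hab => ?_,
    fun a b ha hab => ?_, hT ▸ h.cont⟩
  · rw [← hT, h.diff a b ha hab]
    exact integral_congr_ae (ae_restrict_of_ae hD)
  · rw [← hT, h.avg a b ha hab]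
    exact integral_congr_ae (ae_restrict_of_ae hF)

end Congr

lemma radL_ae_polM (hN : 3 ≤ N) (g : Lp (Grad N) 2 (wMeasure N)) :
    radL N g =ᵐ[polM N] fun x => radialPart (g x) x := polM_ac_wMeasure hN (radL_ae g)

lemma integrableOn_ann_of_Lp {E : Type*} [NormedAddCommGroup E] [InnerProductSpace ℝ E] (hN : 3 ≤ N)
    (A : Lp E 2 (wMeasure N)) (a b : ℝ) (ha : 0 < a) : IntegrableOn A (ann N a b) (polM N) := by
  rcases le_total a b with hab | hab
  · exact (integrableOn_ann_Lp hN A ha hab).1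
  · have : ann N a b = ∅ := by
      refine Set.eq_empty_of_forall_notMem fun x hx => ?_
      have := hx.1.trans_le hx.2
      linarith
    rw [this]; exact integrableOn_empty

lemma tendsto_ann_of_Lp {E : Type*} [NormedAddCommGroup E] [InnerProductSpace ℝ E] (hN : 3 ≤ N)
    {A : ℕ → Lp E 2 (wMeasure N)} {A' : Lp E 2 (wMeasure N)} (h : Tendsto A atTop (𝓝 A')) (a b : ℝ)
    (ha : 0 < a) :
    Tendsto (fun n => ∫ x in ann N a b, ‖A n x - A' x‖ ∂(polM N)) atTop (𝓝 0) := by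
  have h0 : Tendsto (fun n => ‖A n - A'‖ * √(sphArea N * Real.log (max a b / a))) atTop (𝓝 0) := by
    have := (tendsto_iff_norm_sub_tendsto_zero.1 h).mul_const √(sphArea N * Real.log (max a b / a))
    rwa [zero_mul] at this
  refine squeeze_zero (fun n => integral_nonneg fun _ => norm_nonneg _) (fun n => ?_) h0
  refine le_trans ?_ (integrableOn_ann_Lp hN (A n - A') ha (le_max_left a b)).2
  have he : ∫ x in ann N a b, ‖A n x - A' x‖ ∂(polM N) = ∫ x in ann N a b, ‖(A n - A') x‖ ∂(polM N) := by
    refine integral_congr_ae (ae_restrict_of_ae ?_)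
    filter_upwards [polM_ac_wMeasure hN (Lp.coeFn_sub (A n) A')] with x hx
    rw [hx]; rfl
  rw [he]
  exact setIntegral_mono_set (integrableOn_ann_of_Lp hN _ _ _ ha).norm
    (Eventually.of_forall fun _ => norm_nonneg _)
    (LE.le.eventuallyLE (ann_mono le_rfl (le_max_right _ _)))

lemma tendsto_ann_inner (hN : 3 ≤ N)
    {A B : ℕ → Lp ℂ 2 (wMeasure N)} {A' B' : Lp ℂ 2 (wMeasure N)} (hA : Tendsto A atTop (𝓝 A'))
    (hB : Tendsto B atTop (𝓝 B')) (a b : ℝ) (ha : 0 < a) :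
    Tendsto (fun n => ∫ x in ann N a b,
      ‖inner ℝ (A n x) (B n x) - inner ℝ (A' x) (B' x)‖ ∂(polM N)) atTop (𝓝 0) := by
  have h0 : Tendsto (fun n => a⁻¹ * (‖A n - A'‖ * ‖B n‖ + ‖A'‖ * ‖B n - B'‖)) atTop (𝓝 0) := by
    have := (((tendsto_iff_norm_sub_tendsto_zero.1 hA).mul hB.norm).add
      ((tendsto_iff_norm_sub_tendsto_zero.1 hB).const_mul ‖A'‖)).const_mul a⁻¹
    simpa using this
  refine squeeze_zero (fun n => integral_nonneg fun _ => norm_nonneg _) (fun n => ?_) h0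
  have h1 := integrableOn_exterior hN
    ((integrable_Lp_inner (A n) (B n)).sub (integrable_Lp_inner A' B')) ha
  refine (setIntegral_mono_set h1.1.norm (Eventually.of_forall fun _ => norm_nonneg _)
    (LE.le.eventuallyLE fun x hx => hx.1)).trans (h1.2.trans ?_)
  exact mul_le_mul_of_nonneg_left (integral_inner_sub_inner_le _ _ _ _) (by positivity)

lemma exists_seq_smoothGraph {p : Ambient N} (hp : p ∈ SpaceH N) :
    ∃ P : ℕ → Ambient N, (∀ n, P n ∈ smoothGraph N) ∧ Tendsto P atTop (𝓝 p) := by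
  have : p ∈ closure ((smoothGraph N : Submodule ℝ (Ambient N)) : Set (Ambient N)) := by
    rw [← Submodule.topologicalClosure_coe]; exact hp
  exact mem_closure_iff_seq_limit.1 this

lemma radPair_smooth (hN : 3 ≤ N) {p : Ambient N} (hp : p ∈ smoothGraph N) :
    ∃ φ : Pt N → ℂ, ContDiff ℝ ∞ φ ∧ p.fst =ᵐ[polM N] φ ∧ radL N p.snd =ᵐ[polM N] radDeriv φ := by
  obtain ⟨φ, h1, -, h3, h4⟩ := hp
  refine ⟨φ, h1, polM_ac_wMeasure hN h3, ?_⟩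
  filter_upwards [radL_ae_polM hN p.snd, polM_ac_wMeasure hN h4] with x h5 h6
  rw [h5, h6, radialPart_classicalGrad]

lemma tendsto_fst {P : ℕ → Ambient N} {p : Ambient N} (h : Tendsto P atTop (𝓝 p)) :
    Tendsto (fun n => (P n).fst) atTop (𝓝 p.fst) :=
  ((WithLp.fstL 2 ℝ _ _).continuous.tendsto p).comp h

lemma tendsto_snd {P : ℕ → Ambient N} {p : Ambient N} (h : Tendsto P atTop (𝓝 p)) :
    Tendsto (fun n => (P n).snd) atTop (𝓝 p.snd) :=
  ((WithLp.sndL 2 ℝ _ _).continuous.tendsto p).comp h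

/-- Smooth pairs are dense in `SpaceH`, and L²(dμ) convergence implies L¹ convergence on annuli,
under which radial pairs are stable. -/
lemma radPair_of_mem (hN : 3 ≤ N) {p : Ambient N} (hp : p ∈ SpaceH N) :
    RadPair p.fst (radL N p.snd) := by
  obtain ⟨P, hP, hlim⟩ := exists_seq_smoothGraph hp
  refine RadPair.of_tendsto (F := fun n => (P n).fst) (D := fun n => radL N (P n).snd) (fun n => ?_)
    (integrableOn_ann_of_Lp hN _) (integrableOn_ann_of_Lp hN _)
    (tendsto_ann_of_Lp hN (tendsto_fst hlim))
    (tendsto_ann_of_Lp hN (((radL N).continuous.tendsto _).comp (tendsto_snd hlim)))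
  obtain ⟨φ, h1, h2, h3⟩ := radPair_smooth hN (hP n)
  exact (RadPair.of_contDiff (h1.of_le (by simp))).congr h2.symm h3.symm

/-- The product rule for |v|² holds for smooth v and passes to the limit because inner products
converge in L¹ away from the origin. This pair yields both the decay of radial elements and the
boundary term in the Hardy energy. -/
lemma radPair_sq_of_mem (hN : 3 ≤ N) {p : Ambient N} (hp : p ∈ SpaceH N) :
    RadPair (fun x => inner ℝ (p.fst x) (p.fst x))
      (fun x => inner ℝ ((2 : ℝ) • p.fst x) (radL N p.snd x)) := by
  obtain ⟨P, hP, hlim⟩ := exists_seq_smoothGraph hp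
  -- The factor 2 is put inside the `Lp` element, so that both entries are inner products of
  -- convergent `Lp` sequences; the pointwise form is restored at the end.
  have key : RadPair (fun x => inner ℝ (p.fst x) (p.fst x))
      (fun x => inner ℝ (((2 : ℝ) • p.fst : Lp ℂ 2 (wMeasure N)) x) (radL N p.snd x)) := by
    have hint : ∀ A B : Lp ℂ 2 (wMeasure N), ∀ a b : ℝ, 0 < a →
        IntegrableOn (fun x => inner ℝ (A x) (B x)) (ann N a b) (polM N) := fun A B a b ha =>
      (integrableOn_exterior hN (integrable_Lp_inner A B) ha).1.mono_set fun x hx => hx.1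
    refine RadPair.of_tendsto (F := fun n x => inner ℝ ((P n).fst x) ((P n).fst x))
      (D := fun n x => inner ℝ (((2 : ℝ) • (P n).fst : Lp ℂ 2 (wMeasure N)) x)
        (radL N (P n).snd x)) (fun n => ?_)
      (hint _ _) (hint _ _)
      (tendsto_ann_inner hN (tendsto_fst hlim) (tendsto_fst hlim))
      (tendsto_ann_inner hN ((tendsto_fst hlim).const_smul (2 : ℝ))
        (((radL N).continuous.tendsto _).comp (tendsto_snd hlim)))
    obtain ⟨φ, h1, h2, h3⟩ := radPair_smooth hN (hP n)
    refine (RadPair.of_contDiff (F := fun x => inner ℝ (φ x) (φ x))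
      ((h1.of_le (by simp)).inner ℝ (h1.of_le (by simp)))).congr ?_ ?_
    · filter_upwards [h2] with x hx
      rw [hx]
    · filter_upwards [h2, h3, polM_ac_wMeasure hN (Lp.coeFn_smul (2 : ℝ) (P n).fst)] with x hx h3 h4
      rw [h4, Pi.smul_apply, hx, h3, radDeriv, radDeriv, fderiv_inner_apply]
      · rw [real_inner_comm, real_inner_smul_left, two_mul]
        rw [real_inner_comm]
      · exact h1.differentiable (by simp) x
      · exact h1.differentiable (by simp) x
  refine key.congr EventuallyEq.rfl ?_
  filter_upwards [polM_ac_wMeasure hN (Lp.coeFn_smul (2 : ℝ) p.fst)] with x hx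
  rw [hx]; rfl

/-- The spherical mean of `p` at radius `r`. -/
def prof (p : Ambient N) (r : ℝ) : ℂ := (sphArea N)⁻¹ • radT p.fst (radL N p.snd) r

/-- The spherical mean at radius `r` as a bounded linear functional. -/
lemma exists_prof_clm (hN : 3 ≤ N) {r : ℝ} (hr : 0 < r) :
    ∃ ℓ : Ambient N →L[ℝ] ℂ, ∀ p, ℓ p = prof p r := by
  let L : Ambient N →ₗ[ℝ] ℂ :=
    { toFun := fun p => prof p r
      map_add' := fun p p' => by
        have i1 := fun A : Lp ℂ 2 (wMeasure N) => integrableOn_ann_of_Lp hN A r (r + 1) hr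
        have hneg : radT (p + p').fst (radL N (p + p').snd) r =
            radT p.fst (radL N p.snd) r + radT p'.fst (radL N p'.snd) r := by
          have h := radT_sub (i1 (p + p').fst) (i1 (radL N (p + p').snd)) (i1 p'.fst)
            (i1 (radL N p'.snd))
          rw [← sub_eq_iff_eq_add, ← h]
          refine radT_congr ?_ ?_ r
          · filter_upwards [polM_ac_wMeasure hN (Lp.coeFn_add p.fst p'.fst)] with x hx
            rw [WithLp.add_fst, hx]; simp
          · rw [WithLp.add_snd, map_add]
            filter_upwards [polM_ac_wMeasure hN (Lp.coeFn_add (radL N p.snd) (radL N p'.snd))]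
              with x hx
            rw [hx]; simp
        simp only [prof]
        rw [hneg, smul_add]
      map_smul' := fun c p => by
        have : radT (c • p).fst (radL N (c • p).snd) r = c • radT p.fst (radL N p.snd) r := by
          unfold radT
          rw [← integral_smul]
          refine integral_congr_ae (ae_restrict_of_ae ?_)
          rw [WithLp.smul_snd, map_smul, WithLp.smul_fst]
          filter_upwards [polM_ac_wMeasure hN (Lp.coeFn_smul c p.fst),
            polM_ac_wMeasure hN (Lp.coeFn_smul c (radL N p.snd))] with x h1 h2
          rw [h1, h2, Pi.smul_apply, Pi.smul_apply, smul_sub, smul_comm c]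
        simp only [prof, RingHom.id_apply]
        rw [this, smul_comm] }
  -- The function and its radial derivative each contribute one logarithmic annulus bound with ratio
  -- (r+1)/r, and each of their norms is at most ‖p‖; hence the factor 2.
  refine ⟨L.mkContinuous ((sphArea N)⁻¹ * (2 * √(sphArea N * Real.log ((r + 1) / r)))) ?_,
    fun p => rfl⟩
  intro p
  have hσ := sphArea_pos hN
  change ‖(sphArea N)⁻¹ • radT p.fst (radL N p.snd) r‖ ≤ _
  rw [norm_smul, Real.norm_of_nonneg (by positivity), mul_assoc]
  refine mul_le_mul_of_nonneg_left ?_ (by positivity)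
  obtain ⟨i1, b1⟩ := integrableOn_ann_Lp hN p.fst hr (by linarith : r ≤ r + 1)
  obtain ⟨i2, b2⟩ := integrableOn_ann_Lp hN (radL N p.snd) hr (by linarith : r ≤ r + 1)
  have h1 := norm_radT_le i1 i2
  have h2 := WithLp.norm_fst_le (p := 2) _ p
  have h3 := (norm_radL_le p.snd).trans (WithLp.norm_snd_le (p := 2) _ p)
  have h4 : 0 ≤ √(sphArea N * Real.log ((r + 1) / r)) := Real.sqrt_nonneg _
  nlinarith

end HardyNLS

namespace HardyNLS

variable {N : ℕ}

/-! ### Continuity, growth, decay and mass of the radial profile -/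

lemma continuousOn_prof (hN : 3 ≤ N) {p : Ambient N} (hp : p ∈ SpaceH N) :
    ContinuousOn (prof p) (Set.Ioi 0) :=
  (radPair_of_mem hN hp).cont.const_smul (sphArea N)⁻¹

lemma aestronglyMeasurable_prof (hN : 3 ≤ N) {p : Ambient N} (hp : p ∈ SpaceH N) :
    AEStronglyMeasurable (prof p) (volume.restrict (Set.Ioi 0)) :=
  (continuousOn_prof hN hp).aestronglyMeasurable measurableSet_Ioi

/-- A radial element is almost everywhere equal to its profile. -/
lemma fst_eq_prof (hN : 3 ≤ N) {p : Ambient N} (hp : p ∈ SpaceHr N) :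
    ∀ᵐ x ∂(polM N), p.fst x = prof p ‖x‖ := by
  obtain ⟨hp1, k, hk, hpk⟩ := hp
  have hpk' : ∀ᵐ x ∂(polM N), p.fst x = k ‖x‖ := polM_ac_wMeasure hN hpk
  have h := (radPair_of_mem hN hp1).radial_ae hN hk.stronglyMeasurable hpk'
  have hσ := sphArea_pos hN
  have h2 : ∀ᵐ r ∂(volume.restrict (Set.Ioi (0 : ℝ))), prof p r = k r := by
    filter_upwards [h] with r hr
    rw [prof, hr, smul_smul, inv_mul_cancel₀ hσ.ne', one_smul]
  have h3 : ∀ᵐ x ∂(polM N), prof p ‖x‖ = k ‖x‖ := by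
    have h4 : ∀ᵐ r ∂(Measure.map (fun x : Pt N => ‖x‖) (polM N)), prof p r = k r := by
      rw [map_norm_polM]
      exact Measure.ae_smul_measure h2 _
    exact ae_of_ae_map measurable_norm.aemeasurable h4
  filter_upwards [hpk', h3] with x h1 h2
  rw [h1, h2]

/-- The increment is the integral of the radial derivative over the annulus, so its size is at most
the square root of a logarithm. -/
lemma norm_prof_sub_le (hN : 3 ≤ N) {p : Ambient N} (hp : p ∈ SpaceH N) {a b : ℝ} (ha : 0 < a)
    (hab : a ≤ b) :
    ‖prof p b - prof p a‖ ≤ (sphArea N)⁻¹ * (‖p.snd‖ * √(sphArea N * Real.log (b / a))) := by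
  have hσ := sphArea_pos hN
  rw [prof, prof, ← smul_sub, (radPair_of_mem hN hp).diff a b ha hab, norm_smul,
    Real.norm_of_nonneg (by positivity)]
  refine mul_le_mul_of_nonneg_left ?_ (by positivity)
  refine (norm_integral_le_integral_norm _).trans ((integrableOn_ann_Lp hN _ ha hab).2.trans ?_)
  exact mul_le_mul_of_nonneg_right (norm_radL_le _) (Real.sqrt_nonneg _)

/-- For a radial function the mean of the square is the square of the mean. This holds for almost
every radius, hence for all, both sides being continuous. -/
lemma radT_sq_eq (hN : 3 ≤ N) {p : Ambient N} (hp : p ∈ SpaceHr N) {r : ℝ} (hr : 0 < r) :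
    radT (fun x => inner ℝ (p.fst x) (p.fst x))
      (fun x => inner ℝ ((2 : ℝ) • p.fst x) (radL N p.snd x)) r = sphArea N * ‖prof p r‖ ^ 2 := by
  have hP := radPair_sq_of_mem hN hp.1
  obtain ⟨hp1, k, hk, hpk⟩ := hp
  have hpk' : ∀ᵐ x ∂(polM N), p.fst x = k ‖x‖ := polM_ac_wMeasure hN hpk
  have hσ := sphArea_pos hN
  have h1 := (radPair_of_mem hN hp1).radial_ae hN hk.stronglyMeasurable hpk'
  have h2 := hP.radial_ae hN (k := fun r => inner ℝ (k r) (k r))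
    (hk.inner hk).stronglyMeasurable (by filter_upwards [hpk'] with x hx; rw [hx])
  have h3 : ∀ᵐ r ∂(volume.restrict (Set.Ioi (0 : ℝ))), radT (fun x => inner ℝ (p.fst x) (p.fst x))
      (fun x => inner ℝ ((2 : ℝ) • p.fst x) (radL N p.snd x)) r = sphArea N * ‖prof p r‖ ^ 2 := by
    filter_upwards [h1, h2] with r h1 h2
    rw [h2, prof, h1, smul_smul, inv_mul_cancel₀ hσ.ne', one_smul, real_inner_self_eq_norm_sq,
      smul_eq_mul]
  exact Measure.eqOn_open_of_ae_eq h3 isOpen_Ioi hP.cont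
    (((continuousOn_prof hN hp1).norm.pow 2).const_mul _) hr

/-- The derivative of |v|² is integrated from infinity. The same integral is the cross term of the
Hardy energy outside a ball. -/
lemma sq_prof_eq (hN : 3 ≤ N) {p : Ambient N} (hp : p ∈ SpaceHr N) {r : ℝ} (hr : 0 < r) :
    sphArea N * ‖prof p r‖ ^ 2 =
      -∫ x in {x | r < ‖x‖}, inner ℝ ((2 : ℝ) • p.fst x) (radL N p.snd x) ∂(polM N) := by
  have h1 : Integrable (fun x => inner ℝ ((2 : ℝ) • p.fst x) (radL N p.snd x)) (wMeasure N) := by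
    simpa only [real_inner_smul_left] using
      (integrable_Lp_inner p.fst (radL N p.snd)).const_mul (2 : ℝ)
  rw [← radT_sq_eq hN hp hr]
  exact (radPair_sq_of_mem hN hp.1).radT_eq hr
    (integrableOn_exterior hN (integrable_Lp_inner p.fst p.fst) hr).1
    (integrableOn_exterior hN h1 hr).1

/-- A Strauss type decay estimate: Cauchy–Schwarz in the exterior integral, whose density is at
least r. -/
lemma sq_prof_le (hN : 3 ≤ N) {p : Ambient N} (hp : p ∈ SpaceHr N) {r : ℝ} (hr : 0 < r) :
    sphArea N * ‖prof p r‖ ^ 2 ≤ 2 * (‖p.fst‖ * ‖p.snd‖) / r := by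
  have h1 : Integrable (fun x => inner ℝ ((2 : ℝ) • p.fst x) (radL N p.snd x)) (wMeasure N) := by
    simpa only [real_inner_smul_left] using
      (integrable_Lp_inner p.fst (radL N p.snd)).const_mul (2 : ℝ)
  rw [sq_prof_eq hN hp hr]
  refine (neg_le_abs _).trans ((norm_integral_le_integral_norm _).trans
    ((integrableOn_exterior hN h1 hr).2.trans ?_))
  rw [div_eq_inv_mul]
  refine mul_le_mul_of_nonneg_left ?_ (by positivity)
  have h2 : ∫ x, ‖inner ℝ ((2 : ℝ) • p.fst x) (radL N p.snd x)‖ ∂(wMeasure N) ≤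
      ∫ x, 2 * (‖p.fst x‖ * ‖radL N p.snd x‖) ∂(wMeasure N) := by
    refine integral_mono h1.norm ((integrable_Lp_norm_mul _ _).const_mul 2) fun x => ?_
    dsimp only
    refine (norm_inner_le_norm _ _).trans_eq ?_
    rw [norm_smul, Real.norm_of_nonneg zero_le_two, mul_assoc]
  refine h2.trans ?_
  rw [integral_const_mul]
  refine mul_le_mul_of_nonneg_left ((integral_Lp_norm_mul_le _ _).trans ?_) zero_le_two
  exact mul_le_mul_of_nonneg_left (norm_radL_le _) (norm_nonneg _)

/-- The mass of a radial element in terms of its profile. -/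
lemma integral_sq_prof (hN : 3 ≤ N) {p : Ambient N} (hp : p ∈ SpaceHr N) :
    IntegrableOn (fun r => r * ‖prof p r‖ ^ 2) (Set.Ioi 0) ∧
      sphArea N * ∫ r in Set.Ioi (0 : ℝ), r * ‖prof p r‖ ^ 2 = ‖p.fst‖ ^ 2 := by
  have hm : AEStronglyMeasurable (fun r => r * ‖prof p r‖ ^ 2) (volume.restrict (Set.Ioi (0 : ℝ))) :=
    AEStronglyMeasurable.mul (by fun_prop) ((aestronglyMeasurable_prof hN hp.1).norm.pow 2)
  have he : (fun x => ‖x‖ • ‖p.fst x‖ ^ 2) =ᵐ[polM N] fun x => ‖x‖ * ‖prof p ‖x‖‖ ^ 2 := by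
    filter_upwards [fst_eq_prof hN hp] with x hx
    rw [hx, smul_eq_mul]
  constructor
  · refine (integrable_polM_radial hN hm).1 ?_
    exact ((integrable_wMeasure hN).1 (integrable_Lp_norm_sq p.fst)).congr he
  · rw [Lp_norm_sq_eq, integral_wMeasure hN, integral_congr_ae he, integral_polM_radial hm, smul_eq_mul]

end HardyNLS

namespace HardyNLS

variable {N : ℕ}

/-! ### The weak gradient of `|x|^{-(N-2)/2} v` -/

lemma exists_ann {K : Set (Pt N)} (hK : IsCompact K) (h0 : K ⊆ {0}ᶜ) :
    ∃ a b : ℝ, 0 < a ∧ a ≤ b ∧ K ⊆ ann N a b := by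
  rcases K.eq_empty_or_nonempty with rfl | hne
  · exact ⟨1, 1, one_pos, le_rfl, Set.empty_subset _⟩
  obtain ⟨x, hx, hmin⟩ := hK.exists_isMinOn hne continuous_norm.continuousOn
  obtain ⟨y, hy, hmax⟩ := hK.exists_isMaxOn hne continuous_norm.continuousOn
  have hx0 : 0 < ‖x‖ := norm_pos_iff.2 (h0 hx)
  refine ⟨‖x‖ / 2, ‖y‖, by linarith, ?_, fun z hz => ⟨?_, hmax hz⟩⟩
  · have : ‖x‖ ≤ ‖y‖ := hmax hx
    linarith
  · have : ‖x‖ ≤ ‖z‖ := hmin hz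
    linarith

section Lp

variable {E : Type*} [NormedAddCommGroup E] [InnerProductSpace ℝ E]

lemma locallyIntegrableOn_Lp (hN : 3 ≤ N) (A : Lp E 2 (wMeasure N)) :
    LocallyIntegrableOn A {0}ᶜ := by
  rw [locallyIntegrableOn_iff isOpen_compl_singleton.isLocallyClosed]
  intro K hK0 hK
  obtain ⟨a, b, ha, hab, hKs⟩ := exists_ann hK hK0
  refine IntegrableOn.mono_set ?_ hKs
  have h1 := integrableOn_ann_of_Lp hN A a b ha
  rw [← integrable_indicator_iff (measurableSet_ann a b), integrable_volume hN]
  have h2 : IntegrableOn (fun x : Pt N => ‖x‖ ^ (N - 1) • A x) (ann N a b) (polM N) :=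
    h1.continuousOn_smul_of_subset (K := {x : Pt N | a ≤ ‖x‖ ∧ ‖x‖ ≤ b}) (by fun_prop)
      (isCompact_closedAnnulus a b) (measurableSet_ann a b) fun x hx => ⟨hx.1.le, hx.2⟩
  rw [← integrable_indicator_iff (measurableSet_ann a b)] at h2
  refine h2.congr (Eventually.of_forall fun x => ?_)
  by_cases hx : x ∈ ann N a b <;> simp [hx]

lemma integrable_smul_of_locallyIntegrableOn {F : Pt N → E} (hF : LocallyIntegrableOn F {0}ᶜ)
    {ψ : Pt N → ℝ} (hψ : Continuous ψ) (hc : HasCompactSupport ψ) (h0 : tsupport ψ ⊆ {0}ᶜ) :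
    Integrable fun x => ψ x • F x := by
  have h1 : IntegrableOn (fun x => ψ x • F x) (tsupport ψ) :=
    (hF.integrableOn_compact_subset h0 hc).continuousOn_smul hψ.continuousOn hc
  refine (integrableOn_iff_integrable_of_support_subset ?_).1 h1
  exact (Function.support_smul_subset_left _ _).trans (subset_tsupport ψ)

lemma tendsto_integral_smul_Lp (hN : 3 ≤ N) {A : ℕ → Lp E 2 (wMeasure N)} {A' : Lp E 2 (wMeasure N)}
    (h : Tendsto A atTop (𝓝 A')) {ψ : Pt N → ℝ} (hψ : Continuous ψ) (hc : HasCompactSupport ψ)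
    (h0 : tsupport ψ ⊆ {0}ᶜ) :
    Tendsto (fun n => ∫ x, ψ x • A n x) atTop (𝓝 (∫ x, ψ x • A' x)) := by
  obtain ⟨a, b, ha, hab, hKs⟩ := exists_ann hc h0
  have hcc : HasCompactSupport fun x : Pt N => ‖x‖ ^ (N - 1) * ψ x := hc.mul_left
  obtain ⟨C, hC⟩ := hcc.exists_bound_of_continuous (by fun_prop)
  have hi := fun B : Lp E 2 (wMeasure N) =>
    integrable_smul_of_locallyIntegrableOn (locallyIntegrableOn_Lp hN B) hψ hc h0
  refine tendsto_integral_of_tendsto_norm_sub (fun n => hi _) (hi _) ?_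
  have h1 := (tendsto_ann_of_Lp hN h a b ha).const_mul C
  rw [mul_zero] at h1
  refine squeeze_zero (fun n => integral_nonneg fun _ => norm_nonneg _) (fun n => ?_) h1
  rw [integral_volume hN, ← integral_const_mul, ← integral_indicator (measurableSet_ann a b)]
  refine integral_mono_of_nonneg (Eventually.of_forall fun x => ?_) ?_ (Eventually.of_forall fun x => ?_)
  · simp only [Pi.zero_apply, smul_eq_mul]; positivity
  · rw [integrable_indicator_iff (measurableSet_ann a b)]
    exact (((integrableOn_ann_of_Lp hN _ a b ha).sub (integrableOn_ann_of_Lp hN _ a b ha)).norm).const_mul C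
  · by_cases hx : x ∈ ann N a b
    · simp only [Set.indicator_of_mem hx]
      rw [← smul_sub, norm_smul, smul_eq_mul, ← mul_assoc]
      refine mul_le_mul_of_nonneg_right ?_ (norm_nonneg _)
      refine le_trans (le_of_eq ?_) (hC x)
      rw [norm_mul, norm_pow, norm_norm]
    · have : ψ x = 0 := image_eq_zero_of_notMem_tsupport fun h => hx (hKs h)
      simp [this, Set.indicator_of_notMem hx]

end Lp

lemma apply_grad_integral {F : Pt N → Grad N} (hF : Integrable F) (i : Fin N) :
    (∫ x, F x) i = ∫ x, F x i := by
  have := (EuclideanSpace.proj (𝕜 := ℂ) i : Grad N →L[ℂ] ℂ).integral_comp_comm hF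
  exact this.symm

/-- The second component of an element of `SpaceH` is the weak gradient of the first. -/
lemma weak_deriv_of_mem (hN : 3 ≤ N) {p : Ambient N} (hp : p ∈ SpaceH N) {χ : Pt N → ℝ}
    (hχ : ContDiff ℝ ∞ χ) (hc : HasCompactSupport χ) (h0 : tsupport χ ⊆ {0}ᶜ) (i : Fin N) :
    ∫ x, fderiv ℝ χ x (EuclideanSpace.single i 1) • p.fst x = -∫ x, χ x • p.snd x i := by
  obtain ⟨P, hP, hlim⟩ := exists_seq_smoothGraph hp
  have hdc : Continuous fun x => fderiv ℝ χ x (EuclideanSpace.single i 1) :=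
    (hχ.continuous_fderiv (by simp)).clm_apply continuous_const
  have hds : HasCompactSupport fun x => fderiv ℝ χ x (EuclideanSpace.single i 1) :=
    hc.fderiv_apply ℝ _
  have hdt : tsupport (fun x => fderiv ℝ χ x (EuclideanSpace.single i 1)) ⊆ {0}ᶜ :=
    (tsupport_fderiv_apply_subset ℝ _).trans h0
  have h1 := tendsto_integral_smul_Lp hN (tendsto_fst hlim) hdc hds hdt
  have h2 := tendsto_integral_smul_Lp hN (tendsto_snd hlim) hχ.continuous hc h0
  have h3 := ((EuclideanSpace.proj (𝕜 := ℂ) i : Grad N →L[ℂ] ℂ).continuous.tendsto _).comp h2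
  have hcomp : ∀ q : Ambient N, (∫ x, χ x • q.snd x) i = ∫ x, χ x • q.snd x i := fun q =>
    apply_grad_integral (integrable_smul_of_locallyIntegrableOn (locallyIntegrableOn_Lp hN q.snd)
      hχ.continuous hc h0) i
  have h4 : Tendsto (fun n => -∫ x, χ x • (P n).snd x i) atTop (𝓝 (-∫ x, χ x • p.snd x i)) := by
    rw [← hcomp]
    simp only [← hcomp]
    exact h3.neg
  refine tendsto_nhds_unique (h1.congr fun n => ?_) h4
  -- Both sides pass to the limit, so only the smooth members of the sequence remain, for which this
  -- is classical integration by parts.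
  obtain ⟨φ, k1, k2, k3, k4⟩ := hP n
  have k3' := volume_ac_polM hN (polM_ac_wMeasure hN k3)
  have k4' := volume_ac_polM hN (polM_ac_wMeasure hN k4)
  have e1 : ∫ x, fderiv ℝ χ x (EuclideanSpace.single i 1) • (P n).fst x =
      ∫ x, fderiv ℝ χ x (EuclideanSpace.single i 1) • φ x :=
    integral_congr_ae (by filter_upwards [k3'] with x hx; rw [hx])
  have e2 : ∫ x, χ x • (P n).snd x i = ∫ x, χ x • fderiv ℝ φ x (EuclideanSpace.single i 1) :=
    integral_congr_ae (by filter_upwards [k4'] with x hx; rw [hx]; rfl)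
  have hdφ : Continuous fun x => fderiv ℝ φ x (EuclideanSpace.single i 1) :=
    (k1.continuous_fderiv (by simp)).clm_apply continuous_const
  rw [e1, e2, integral_smul_fderiv_eq_neg_fderiv_smul_of_integrable, neg_neg]
  · exact (hdc.smul k1.continuous).integrable_of_hasCompactSupport hds.smul_right
  · exact (hχ.continuous.smul hdφ).integrable_of_hasCompactSupport hc.smul_right
  · exact (hχ.continuous.smul k1.continuous).integrable_of_hasCompactSupport hc.smul_right
  · exact fun x _ => hχ.differentiable (by simp) x
  · exact fun x _ => k1.differentiable (by simp) x

/-- The coordinate vector `x`, with complex entries. -/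
def coordVec (x : Pt N) : Grad N := WithLp.toLp 2 fun i => (x i : ℂ)

lemma continuous_coordVec : Continuous (coordVec : Pt N → Grad N) := by
  unfold coordVec
  fun_prop

/-- The gradient of `|x|^{-(N-2)/2} v`. -/
def transfGrad (p : Ambient N) (x : Pt N) : Grad N :=
  (‖x‖ ^ (-(((N : ℝ) - 2) / 2))) • p.snd x -
    p.fst x • ((((N : ℝ) - 2) / 2 * ‖x‖ ^ (-(((N : ℝ) - 2) / 2) - 2)) • coordVec x)

lemma continuousOn_norm_rpow (c : ℝ) : ContinuousOn (fun x : Pt N => ‖x‖ ^ c) {0}ᶜ :=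
  continuous_norm.continuousOn.rpow_const fun x hx => Or.inl (by simpa using hx)

lemma contDiffAt_norm_rpow (c : ℝ) {x : Pt N} (hx : x ≠ 0) :
    ContDiffAt ℝ ∞ (fun x : Pt N => ‖x‖ ^ c) x :=
  (contDiffAt_norm ℝ hx).rpow_const_of_ne (norm_ne_zero_iff.2 hx)

lemma fderiv_norm_rpow_single (c : ℝ) {x : Pt N} (hx : x ≠ 0) (i : Fin N) :
    fderiv ℝ (fun x : Pt N => ‖x‖ ^ c) x (EuclideanSpace.single i 1) = c * ‖x‖ ^ (c - 2) * x i := by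
  have hpos : 0 < ‖x‖ := norm_pos_iff.2 hx
  have h1 := (hasStrictFDerivAt_norm_sq x).hasFDerivAt.rpow_const (p := c / 2)
    (Or.inl (by positivity))
  have h2 : (fun x : Pt N => (‖x‖ ^ 2) ^ (c / 2)) = fun x : Pt N => ‖x‖ ^ c := by
    ext y
    rw [← Real.rpow_natCast_mul (norm_nonneg _)]
    congr 1
    push_cast; ring
  rw [h2] at h1
  rw [h1.fderiv, ← Real.rpow_natCast_mul (norm_nonneg _)]
  have h3 : ((2 : ℕ) : ℝ) * (c / 2 - 1) = c - 2 := by push_cast; ring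
  rw [h3]
  simp [EuclideanSpace.inner_single_right]
  ring

lemma tsupport_ne_zero_mul {φ w : Pt N → ℝ} : tsupport (fun x => φ x * w x) ⊆ tsupport φ :=
  closure_mono fun x hx => by
    simp only [Function.mem_support] at hx ⊢
    exact left_ne_zero_of_mul hx

lemma contDiff_mul_norm_rpow {φ : Pt N → ℝ} (hφ : ContDiff ℝ ∞ φ) (h0 : tsupport φ ⊆ {0}ᶜ) (c : ℝ) :
    ContDiff ℝ ∞ fun x => φ x * ‖x‖ ^ c := by
  rw [contDiff_iff_contDiffAt]
  intro x
  rcases eq_or_ne x 0 with rfl | hx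
  · have : (0 : Pt N) ∉ tsupport φ := fun h => h0 h rfl
    have h1 := notMem_tsupport_iff_eventuallyEq.1 this
    refine contDiffAt_const (c := (0 : ℝ)) |>.congr_of_eventuallyEq ?_
    filter_upwards [h1] with y hy
    rw [hy]; simp
  · exact hφ.contDiffAt.mul (contDiffAt_norm_rpow c hx)

/-- The weight is moved onto the test function. The product φ|x|^{-a} is again an admissible test
function because φ vanishes near the origin, and differentiating the weight produces the zeroth
order term of `transfGrad`. -/
lemma isWeakGrad_transf (hN : 3 ≤ N) {p : Ambient N} (hp : p ∈ SpaceH N) :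
    IsWeakGrad (transf p.fst) (transfGrad p) := by
  set a : ℝ := ((N : ℝ) - 2) / 2 with ha
  have hlc : IsLocallyClosed ({0}ᶜ : Set (Pt N)) := isOpen_compl_singleton.isLocallyClosed
  have hv := locallyIntegrableOn_Lp hN p.fst
  have hg := locallyIntegrableOn_Lp hN p.snd
  have hw : ContinuousOn (fun x : Pt N => (a * ‖x‖ ^ (-a - 2))) {0}ᶜ :=
    continuousOn_const.mul (continuousOn_norm_rpow _)
  have l1 : LocallyIntegrableOn (fun x => (‖x‖ ^ (-a)) • p.fst x) {0}ᶜ :=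
    hv.continuousOn_smul hlc (continuousOn_norm_rpow _)
  have l2 : LocallyIntegrableOn (fun x => (‖x‖ ^ (-a)) • p.snd x) {0}ᶜ :=
    hg.continuousOn_smul hlc (continuousOn_norm_rpow _)
  have l3 : LocallyIntegrableOn (fun x => p.fst x • ((a * ‖x‖ ^ (-a - 2)) • coordVec x)) {0}ᶜ :=
    hv.smul_continuousOn hlc (hw.smul continuous_coordVec.continuousOn)
  have lG : LocallyIntegrableOn (transfGrad p) {0}ᶜ := l2.sub l3
  refine ⟨?_, lG, fun φ hφ hc h0 i => ?_⟩
  · refine l1.congr (Eventually.of_forall fun x => ?_)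
    simp [transf, ha]
  have hχ := contDiff_mul_norm_rpow hφ h0 (-a)
  have hχc : HasCompactSupport fun x => φ x * ‖x‖ ^ (-a) := hc.mul_right
  have hχ0 : tsupport (fun x => φ x * ‖x‖ ^ (-a)) ⊆ {0}ᶜ := tsupport_ne_zero_mul.trans h0
  have key := weak_deriv_of_mem hN hp hχ hχc hχ0 i
  have hη : Continuous fun x => φ x * ‖x‖ ^ (-a - 2) :=
    (contDiff_mul_norm_rpow hφ h0 (-a - 2)).continuous
  have hη' : Continuous fun x => (φ x * ‖x‖ ^ (-a - 2)) * (a * x i) := hη.mul (by fun_prop)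
  have hηc : HasCompactSupport fun x => (φ x * ‖x‖ ^ (-a - 2)) * (a * x i) := hc.mul_right.mul_right
  have hη0 : tsupport (fun x => (φ x * ‖x‖ ^ (-a - 2)) * (a * x i)) ⊆ {0}ᶜ :=
    tsupport_ne_zero_mul.trans (tsupport_ne_zero_mul.trans h0)
  have i1 := integrable_smul_of_locallyIntegrableOn hv hη' hηc hη0
  have i2 := integrable_smul_of_locallyIntegrableOn hv
    (ψ := fun x => fderiv ℝ (fun x => φ x * ‖x‖ ^ (-a)) x (EuclideanSpace.single i 1))
    ((hχ.continuous_fderiv (by simp)).clm_apply continuous_const) (hχc.fderiv_apply ℝ _)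
    ((tsupport_fderiv_apply_subset ℝ _).trans hχ0)
  have i3 : Integrable fun x => (φ x * ‖x‖ ^ (-a)) • p.snd x i :=
    ((EuclideanSpace.proj (𝕜 := ℂ) i : Grad N →L[ℂ] ℂ).integrable_comp
      (integrable_smul_of_locallyIntegrableOn hg hχ.continuous hχc hχ0))
  have hne : ∀ᵐ x : Pt N, 0 < ‖x‖ := (ae_volume_iff hN).2 polM_ae_ne_zero
  have e1 : ∫ x, fderiv ℝ φ x (EuclideanSpace.single i 1) • transf p.fst x =
      ∫ x, (fderiv ℝ (fun x => φ x * ‖x‖ ^ (-a)) x (EuclideanSpace.single i 1) • p.fst x +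
        ((φ x * ‖x‖ ^ (-a - 2)) * (a * x i)) • p.fst x) := by
    refine integral_congr_ae ?_
    filter_upwards [hne] with x hx
    have hx0 : x ≠ 0 := norm_pos_iff.1 hx
    rw [fderiv_fun_mul (hφ.differentiable (by simp) x)
      ((contDiffAt_norm_rpow (-a) hx0).differentiableAt (by simp))]
    simp only [add_apply, smul_apply, smul_eq_mul]
    rw [fderiv_norm_rpow_single _ hx0, transf, ← ha]
    simp only [Complex.real_smul]
    push_cast
    ring
  have e2 : ∫ x, φ x • transfGrad p x i = ∫ x, ((φ x * ‖x‖ ^ (-a)) • p.snd x i -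
      ((φ x * ‖x‖ ^ (-a - 2)) * (a * x i)) • p.fst x) := by
    refine integral_congr_ae (Eventually.of_forall fun x => ?_)
    simp only [transfGrad, ← ha, PiLp.sub_apply, PiLp.smul_apply, coordVec, Complex.real_smul,
      smul_eq_mul]
    push_cast
    ring
  rw [e1, e2, integral_add i2 i1, integral_sub i3 i1, key]
  ring

/-- The fundamental lemma of the calculus of variations in each coordinate. It identifies
`weakGrad`, an arbitrary choice, with the explicit gradient. -/
lemma IsWeakGrad.ae_eq {u : Pt N → ℂ} {G G' : Pt N → Grad N} (h : IsWeakGrad u G)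
    (h' : IsWeakGrad u G') : ∀ᵐ x : Pt N, x ≠ 0 → G x = G' x := by
  have hi : ∀ i : Fin N, ∀ᵐ x : Pt N, x ∈ ({0}ᶜ : Set (Pt N)) → G x i - G' x i = 0 := by
    intro i
    have hl : ∀ {F : Pt N → Grad N}, LocallyIntegrableOn F {0}ᶜ →
        LocallyIntegrableOn (fun x => F x i) {0}ᶜ := by
      intro F hF
      rw [locallyIntegrableOn_iff isOpen_compl_singleton.isLocallyClosed] at hF ⊢
      intro K hK0 hK
      exact (EuclideanSpace.proj (𝕜 := ℂ) i : Grad N →L[ℂ] ℂ).integrable_comp (hF K hK0 hK)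
    refine isOpen_compl_singleton.ae_eq_zero_of_integral_contDiff_smul_eq_zero
      ((hl h.2.1).sub (hl h'.2.1)) fun φ hφ hc h0 => ?_
    have j1 := integrable_smul_of_locallyIntegrableOn (hl h.2.1) hφ.continuous hc h0
    have j2 := integrable_smul_of_locallyIntegrableOn (hl h'.2.1) hφ.continuous hc h0
    simp only [smul_sub]
    rw [integral_sub j1 j2]
    have := h.2.2 φ hφ hc h0 i
    rw [h'.2.2 φ hφ hc h0 i] at this
    rw [neg_inj.1 this, sub_self]
  filter_upwards [ae_all_iff.2 hi] with x hx hx0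
  ext i
  exact sub_eq_zero.1 (hx i hx0)

lemma weakGrad_transf (hN : 3 ≤ N) {p : Ambient N} (hp : p ∈ SpaceH N) :
    ∀ᵐ x ∂(polM N), weakGrad (transf p.fst) x = transfGrad p x := by
  have hex : ∃ G, IsWeakGrad (transf p.fst) G := ⟨_, isWeakGrad_transf hN hp⟩
  have h1 : IsWeakGrad (transf p.fst) (weakGrad (transf p.fst)) := by
    rw [weakGrad, dif_pos hex]
    exact hex.choose_spec
  filter_upwards [(ae_volume_iff hN).1 (h1.ae_eq (isWeakGrad_transf hN hp)), polM_ae_ne_zero]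
    with x hx hx0
  exact hx (norm_pos_iff.1 hx0)

end HardyNLS

namespace HardyNLS

variable {N : ℕ}

/-! ### The energy of a radial element -/

lemma inner_smul_coordVec (g : Grad N) (z : ℂ) {x : Pt N} (hx : 0 < ‖x‖) :
    inner ℝ g (z • coordVec x) = ‖x‖ * inner ℝ z (radialPart g x) := by
  rw [PiLp.inner_apply, radialPart, inner_sum, Finset.mul_sum]
  refine Finset.sum_congr rfl fun i _ => ?_
  simp only [coordVec, PiLp.smul_apply, smul_eq_mul, Complex.inner]
  simp only [Complex.mul_re, Complex.conj_re, Complex.conj_im, Complex.mul_im, Complex.ofReal_re,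
    Complex.ofReal_im]
  field_simp
  ring

lemma norm_coordVec (x : Pt N) : ‖coordVec x‖ = ‖x‖ := by
  simp [EuclideanSpace.norm_eq, coordVec]

lemma rpow_weight (hN : 3 ≤ N) {x : Pt N} (hx : 0 < ‖x‖) :
    ‖x‖ ^ (N - 1) * (‖x‖ ^ (-(((N : ℝ) - 2) / 2))) ^ 2 = ‖x‖ := by
  rw [← Real.rpow_natCast, ← Real.rpow_natCast, ← Real.rpow_mul hx.le, ← Real.rpow_add hx,
    Nat.cast_sub (by omega)]
  convert Real.rpow_one ‖x‖ using 2
  push_cast; ring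

lemma norm_transf_sq (v : Pt N → ℂ) (x : Pt N) :
    ‖transf v x‖ ^ 2 = (‖x‖ ^ (-(((N : ℝ) - 2) / 2))) ^ 2 * ‖v x‖ ^ 2 := by
  rw [transf, norm_mul, mul_pow, Complex.norm_real, Real.norm_eq_abs, sq_abs]

/-- The square is expanded: the last term is the Hardy density, and the middle one is a multiple of
the radial derivative of |v|². -/
lemma norm_transfGrad_sq (hN : 3 ≤ N) (p : Ambient N) {x : Pt N} (hx : 0 < ‖x‖) :
    ‖x‖ ^ (N - 1) * ‖transfGrad p x‖ ^ 2 = ‖x‖ * ‖p.snd x‖ ^ 2 -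
      ((N : ℝ) - 2) / 2 * inner ℝ ((2 : ℝ) • p.fst x) (radialPart (p.snd x) x) +
      (((N : ℝ) - 2) / 2) ^ 2 * (‖p.fst x‖ ^ 2 / ‖x‖) := by
  set a : ℝ := ((N : ℝ) - 2) / 2 with ha
  have h1 : transfGrad p x = (‖x‖ ^ (-a)) •
      (p.snd x - (a / ‖x‖ ^ 2) • (p.fst x • coordVec x)) := by
    rw [transfGrad, ← ha, smul_sub, smul_smul, smul_comm (p.fst x)]
    congr 2
    rw [Real.rpow_sub hx, Real.rpow_two]
    ring
  rw [h1, norm_smul, mul_pow, ← mul_assoc, Real.norm_eq_abs, sq_abs, rpow_weight hN hx,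
    norm_sub_sq_real, inner_smul_right, inner_smul_coordVec _ _ hx, norm_smul, norm_smul,
    norm_coordVec, real_inner_smul_left, Real.norm_eq_abs, mul_pow, sq_abs]
  field_simp

lemma polM_ae_norm_ne (ε : ℝ) : ∀ᵐ x ∂(polM N), ‖x‖ ≠ ε := by
  have h1 : ∀ᵐ r ∂(Measure.map (fun x : Pt N => ‖x‖) (polM N)), r ≠ ε := by
    rw [map_norm_polM]
    exact Measure.ae_smul_measure (ae_restrict_of_ae (Measure.ae_ne volume ε)) _
  exact ae_of_ae_map measurable_norm.aemeasurable h1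

lemma compl_ball_ae_eq (ε : ℝ) : ((Metric.ball (0 : Pt N) ε)ᶜ : Set (Pt N)) =ᵐ[polM N] {x | ε < ‖x‖} := by
  filter_upwards [polM_ae_norm_ne ε] with x hx
  refine propext (show x ∈ ((Metric.ball (0 : Pt N) ε)ᶜ : Set (Pt N)) ↔ ε < ‖x‖ from ?_)
  simp only [Set.mem_compl_iff, mem_ball_zero_iff, not_lt]
  exact ⟨fun h => lt_of_le_of_ne h hx.symm, le_of_lt⟩

lemma setIntegral_volume (hN : 3 ≤ N) {S : Set (Pt N)} (hS : MeasurableSet S) (F : Pt N → ℝ) :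
    ∫ x in S, F x = ∫ x in S, ‖x‖ ^ (N - 1) * F x ∂(polM N) := by
  rw [← integral_indicator hS, integral_volume hN, ← integral_indicator hS]
  congr 1
  ext x
  by_cases hx : x ∈ S <;> simp [hx]

/-- The Hardy densities cancel and the cross term becomes a boundary value through `sq_prof_eq`. -/
lemma hardyExterior_eq (hN : 3 ≤ N) {p : Ambient N} (hp : p ∈ SpaceHr N) {ε : ℝ} (hε : 0 < ε) :
    hardyExterior ε (transf p.fst) =
      ∫ x in (Metric.ball (0 : Pt N) ε)ᶜ, ‖x‖ * ‖p.snd x‖ ^ 2 ∂(polM N) +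
        ((N : ℝ) - 2) / 2 * (sphArea N * ‖prof p ε‖ ^ 2) := by
  have hS : MeasurableSet ((Metric.ball (0 : Pt N) ε)ᶜ) := measurableSet_ball.compl
  -- The complement of the open ball and the open exterior differ by a sphere, which is a null set.
  rw [hardyExterior, setIntegral_volume hN hS, setIntegral_volume hN hS, sq_prof_eq hN hp hε,
    ← setIntegral_congr_set (compl_ball_ae_eq ε)]
  set a : ℝ := ((N : ℝ) - 2) / 2 with ha
  have e1 : ∫ x in (Metric.ball (0 : Pt N) ε)ᶜ, ‖x‖ ^ (N - 1) * ‖weakGrad (transf p.fst) x‖ ^ 2 ∂(polM N)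
      = ∫ x in (Metric.ball (0 : Pt N) ε)ᶜ, (‖x‖ * ‖p.snd x‖ ^ 2 -
      a * inner ℝ ((2 : ℝ) • p.fst x) (radL N p.snd x) + a ^ 2 * (‖p.fst x‖ ^ 2 / ‖x‖)) ∂(polM N) := by
    refine integral_congr_ae (ae_restrict_of_ae ?_)
    filter_upwards [weakGrad_transf hN hp.1, polM_ae_ne_zero, radL_ae_polM hN p.snd] with x h1 h2 h3
    rw [h1, h3, norm_transfGrad_sq hN p h2]
  have e2 : ∫ x in (Metric.ball (0 : Pt N) ε)ᶜ, ‖x‖ ^ (N - 1) * (‖transf p.fst x‖ ^ 2 / ‖x‖ ^ 2) ∂(polM N)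
      = ∫ x in (Metric.ball (0 : Pt N) ε)ᶜ, ‖p.fst x‖ ^ 2 / ‖x‖ ∂(polM N) := by
    refine integral_congr_ae (ae_restrict_of_ae ?_)
    filter_upwards [polM_ae_ne_zero] with x hx
    rw [norm_transf_sq, mul_div_assoc, ← mul_assoc, rpow_weight hN hx]
    field_simp
  have i1 : Integrable (fun x : Pt N => ‖x‖ * ‖p.snd x‖ ^ 2) (polM N) :=
    (integrable_wMeasure hN).1 (integrable_Lp_norm_sq p.snd)
  have i2 : IntegrableOn (fun x => inner ℝ ((2 : ℝ) • p.fst x) (radL N p.snd x))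
      (Metric.ball (0 : Pt N) ε)ᶜ (polM N) := by
    have h1 : Integrable (fun x => inner ℝ ((2 : ℝ) • p.fst x) (radL N p.snd x)) (wMeasure N) := by
      simpa only [real_inner_smul_left] using
        (integrable_Lp_inner p.fst (radL N p.snd)).const_mul (2 : ℝ)
    exact (integrableOn_exterior hN h1 hε).1.congr_set_ae (compl_ball_ae_eq ε)
  have i3 : IntegrableOn (fun x => ‖p.fst x‖ ^ 2 / ‖x‖) (Metric.ball (0 : Pt N) ε)ᶜ (polM N) := by
    have h1 : Integrable (fun x : Pt N => ‖x‖ * ‖p.fst x‖ ^ 2) (polM N) :=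
      (integrable_wMeasure hN).1 (integrable_Lp_norm_sq p.fst)
    refine Integrable.mono' (h1.integrableOn.const_mul (ε ^ 2)⁻¹) ?_ ?_
    · refine AEStronglyMeasurable.restrict ?_
      have h2 : AEStronglyMeasurable (p.fst : Pt N → ℂ) (polM N) :=
        (Lp.memLp p.fst).1.mono_ac (polM_ac_wMeasure hN)
      exact (h2.norm.aemeasurable.pow_const 2 |>.div (by fun_prop)).aestronglyMeasurable
    · refine (ae_restrict_iff' hS).2 (Eventually.of_forall fun x hx => ?_)
      have hx : ε ≤ ‖x‖ := by simpa using hx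
      have hx0 : 0 < ‖x‖ := hε.trans_le hx
      rw [Real.norm_of_nonneg (by positivity), ← mul_assoc, div_eq_inv_mul]
      refine mul_le_mul_of_nonneg_right ?_ (by positivity)
      rw [inv_mul_eq_div, le_div_iff₀ (by positivity), inv_mul_le_iff₀ hx0]
      nlinarith
  have i12 : IntegrableOn (fun x => ‖x‖ * ‖p.snd x‖ ^ 2 -
      a * inner ℝ ((2 : ℝ) • p.fst x) (radL N p.snd x)) (Metric.ball (0 : Pt N) ε)ᶜ (polM N) :=
    i1.integrableOn.sub (i2.const_mul a)
  rw [e1, e2, integral_add i12 (i3.const_mul _),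
    integral_sub i1.integrableOn (i2.const_mul a), integral_const_mul, integral_const_mul]
  ring

lemma integral_ball_transf (hN : 3 ≤ N) {p : Ambient N} (hp : p ∈ SpaceHr N) {r : ℝ} (hr : 0 < r) :
    ∫ x in Metric.ball (0 : Pt N) r, ‖transf p.fst x‖ ^ 2 =
      sphArea N * ∫ s in (0 : ℝ)..r, s * ‖prof p s‖ ^ 2 := by
  have hm : AEStronglyMeasurable ((Set.Iio r).indicator fun s => s * ‖prof p s‖ ^ 2)
      (volume.restrict (Set.Ioi (0 : ℝ))) :=
    (AEStronglyMeasurable.mul (by fun_prop)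
      ((aestronglyMeasurable_prof hN hp.1).norm.pow 2)).indicator measurableSet_Iio
  rw [setIntegral_volume hN measurableSet_ball, ← integral_indicator measurableSet_ball]
  have e1 : ∫ x, (Metric.ball (0 : Pt N) r).indicator
      (fun x => ‖x‖ ^ (N - 1) * ‖transf p.fst x‖ ^ 2) x ∂(polM N) =
      ∫ x, (Set.Iio r).indicator (fun s => s * ‖prof p s‖ ^ 2) ‖x‖ ∂(polM N) := by
    refine integral_congr_ae ?_
    filter_upwards [fst_eq_prof hN hp, polM_ae_ne_zero] with x hx h0
    by_cases h : ‖x‖ < r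
    · rw [Set.indicator_of_mem (by simpa using h), Set.indicator_of_mem (by simpa using h),
        norm_transf_sq, ← mul_assoc, rpow_weight hN h0, hx]
    · rw [Set.indicator_of_notMem (by simpa using h), Set.indicator_of_notMem (by simpa using h)]
  rw [e1, integral_polM_radial hm, smul_eq_mul, integral_indicator measurableSet_Iio,
    Measure.restrict_restrict measurableSet_Iio, intervalIntegral.integral_of_le hr.le,
    integral_Ioc_eq_integral_Ioo]
  congr 3
  ext s
  simp [and_comm]

/-- The mass in a ball is a primitive of s|prof|², which is integrable at 0 and continuous for s >
0, so it is differentiable at every ε > 0. -/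
lemma sphereIntegral_eq (hN : 3 ≤ N) {p : Ambient N} (hp : p ∈ SpaceHr N) {ε : ℝ} (hε : 0 < ε) :
    sphereIntegral ε (transf p.fst) = sphArea N * (ε * ‖prof p ε‖ ^ 2) := by
  have hc : ContinuousOn (fun s => s * ‖prof p s‖ ^ 2) (Set.Ioi (0 : ℝ)) :=
    continuousOn_id.mul ((continuousOn_prof hN hp.1).norm.pow 2)
  have hi : IntervalIntegrable (fun s => s * ‖prof p s‖ ^ 2) volume 0 ε := by
    rw [intervalIntegrable_iff_integrableOn_Ioc_of_le hε.le]
    exact (integral_sq_prof hN hp).1.mono_set fun s hs => hs.1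
  have h1 : HasDerivAt (fun r => ∫ s in (0 : ℝ)..r, s * ‖prof p s‖ ^ 2) (ε * ‖prof p ε‖ ^ 2) ε :=
    intervalIntegral.integral_hasDerivAt_right hi
      (hc.stronglyMeasurableAtFilter isOpen_Ioi ε hε) (hc.continuousAt (Ioi_mem_nhds hε))
  refine HasDerivAt.deriv ((h1.const_mul (sphArea N)).congr_of_eventuallyEq ?_)
  filter_upwards [Ioi_mem_nhds hε] with r hr
  exact integral_ball_transf hN hp hr

/-- The surface term cancels the boundary term exactly for each ε. What is left is the weighted
Dirichlet integral outside a ball, which exhausts ‖∇v‖² by dominated convergence. -/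
lemma tendsto_hardy (hN : 3 ≤ N) {p : Ambient N} (hp : p ∈ SpaceHr N) :
    Tendsto (fun ε => hardyExterior ε (transf p.fst) - hardySurface ε (transf p.fst)) (𝓝[>] (0 : ℝ))
      (𝓝 (‖p.snd‖ ^ 2)) := by
  have i1 : Integrable (fun x : Pt N => ‖x‖ * ‖p.snd x‖ ^ 2) (polM N) :=
    (integrable_wMeasure hN).1 (integrable_Lp_norm_sq p.snd)
  have hlim : Tendsto (fun ε : ℝ => ∫ x, ((Metric.ball (0 : Pt N) ε)ᶜ).indicator
      (fun x => ‖x‖ * ‖p.snd x‖ ^ 2) x ∂(polM N)) (𝓝[>] (0 : ℝ)) (𝓝 (‖p.snd‖ ^ 2)) := by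
    rw [Lp_norm_sq_eq, integral_wMeasure hN]
    refine tendsto_integral_filter_of_dominated_convergence (fun x => ‖x‖ * ‖p.snd x‖ ^ 2)
      (Eventually.of_forall fun ε => i1.1.indicator measurableSet_ball.compl)
      (Eventually.of_forall fun ε => Eventually.of_forall fun x => ?_) i1 ?_
    · refine (norm_indicator_le_norm_self _ _).trans_eq ?_
      rw [Real.norm_of_nonneg (by positivity)]
    · filter_upwards [polM_ae_ne_zero] with x hx
      refine tendsto_const_nhds.congr' ?_
      filter_upwards [mem_nhdsWithin_of_mem_nhds (Iio_mem_nhds hx)] with ε hε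
      rw [Set.indicator_of_mem]
      · rfl
      · simpa using le_of_lt hε
  refine hlim.congr' ?_
  filter_upwards [self_mem_nhdsWithin] with ε hε
  have hε : 0 < ε := hε
  rw [integral_indicator measurableSet_ball.compl, hardyExterior_eq hN hp hε, hardySurface,
    sphereIntegral_eq hN hp hε]
  field_simp
  ring

/-- The nonlinear term `∫ |u|^q dx`. -/
def potential (q : ℝ) (p : Ambient N) : ℝ := ∫ x, ‖transf p.fst x‖ ^ q

lemma J_eq (hN : 3 ≤ N) (q : ℝ) (v : SpaceHr N) :
    J q v = 1 / 2 * ‖v.1.snd‖ ^ 2 - 1 / q * potential q v.1 + 1 / 2 * ‖v.1.fst‖ ^ 2 := by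
  rw [J, energy, (tendsto_hardy hN v.2).limUnder_eq, potential, Lp_norm_sq_eq v.1.fst,
    integral_wMeasure hN, integral_volume hN (fun x => ‖x‖ ^ (-((N : ℝ) - 2)) * ‖v.1.fst x‖ ^ 2)]
  congr 2
  refine integral_congr_ae ?_
  filter_upwards [polM_ae_ne_zero] with x hx
  rw [smul_eq_mul, smul_eq_mul, ← mul_assoc]
  congr 1
  rw [← Real.rpow_natCast, ← Real.rpow_add hx, Nat.cast_sub (by omega)]
  convert Real.rpow_one ‖x‖ using 2
  push_cast; ring

lemma mem_GamTilde_iff (hN : 3 ≤ N) {γ : ℝ} (v : SpaceHr N) :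
    v ∈ GamTilde N γ ↔ ‖v.1.fst‖ ^ 2 = γ := by
  have h1 : ∫ x, ‖transf v.1.fst x‖ ^ 2 = ‖v.1.fst‖ ^ 2 := by
    rw [Lp_norm_sq_eq, integral_wMeasure hN, integral_volume hN]
    refine integral_congr_ae ?_
    filter_upwards [polM_ae_ne_zero] with x hx
    rw [smul_eq_mul, norm_transf_sq, ← mul_assoc, rpow_weight hN hx, smul_eq_mul]
  rw [GamTilde, Set.mem_ofPred_eq, Gam, Set.mem_ofPred_eq, h1]
  exact ⟨fun h => h.2, fun h => ⟨⟨v.1, v.2.1, EventuallyEq.rfl⟩, h⟩⟩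

lemma potential_eq (hN : 3 ≤ N) (q : ℝ) {p : Ambient N} (hp : p ∈ SpaceHr N) :
    potential q p = sphArea N * ∫ r in Set.Ioi (0 : ℝ),
      r ^ ((N : ℝ) - 1 - q * (((N : ℝ) - 2) / 2)) * ‖prof p r‖ ^ q := by
  rw [potential, integral_volume hN, ← smul_eq_mul (sphArea N), ← integral_polM_radial]
  · refine integral_congr_ae ?_
    filter_upwards [polM_ae_ne_zero, fst_eq_prof hN hp] with x hx h1
    rw [transf, norm_mul, Complex.norm_real, Real.norm_of_nonneg (by positivity),
      Real.mul_rpow (by positivity) (norm_nonneg _), smul_eq_mul, ← mul_assoc, h1]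
    congr 1
    rw [← Real.rpow_natCast, ← Real.rpow_mul hx.le, ← Real.rpow_add hx, Nat.cast_sub (by omega)]
    congr 1
    push_cast; ring
  · exact AEStronglyMeasurable.mul (Measurable.aestronglyMeasurable (by fun_prop))
      ((aestronglyMeasurable_prof hN hp.1).norm.aemeasurable.pow_const q).aestronglyMeasurable

end HardyNLS

namespace HardyNLS

variable {N : ℕ}

/-! ### Bounds for the nonlinear term -/

/-- The exponent of the radial weight in the nonlinear term. -/
def radExp (N : ℕ) (q : ℝ) : ℝ := (N : ℝ) - 1 - q * (((N : ℝ) - 2) / 2)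

/-- Used for decay at infinity, where the density is compared with that of the mass, of exponent 1.
-/
lemma radExp_lt_one (hN : 3 ≤ N) {q : ℝ} (hq : 2 < q) : radExp N q < 1 := by
  have : (3 : ℝ) ≤ N := by exact_mod_cast hN
  unfold radExp
  nlinarith

/-- Used for integrability of the nonlinear term at the origin. -/
lemma radExp_gt (hN : 3 ≤ N) {q : ℝ} (hq : q < 4 / (N : ℝ) + 2) : -1 < radExp N q := by
  have h3 : (3 : ℝ) ≤ N := by exact_mod_cast hN
  have h1 : q * N < 4 + 2 * N := by
    have : 4 / (N : ℝ) + 2 = (4 + 2 * N) / N := by field_simp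
    rw [this, lt_div_iff₀ (by linarith)] at hq
    exact hq
  unfold radExp
  nlinarith

/-- The left side is N(q-2)/2: this is where the mass critical exponent 2 + 4/N enters. -/
lemma radExp_subcritical (hN : 3 ≤ N) {q : ℝ} (hq : q < 4 / (N : ℝ) + 2) : q - radExp N q - 1 < 2 := by
  have h3 : (3 : ℝ) ≤ N := by exact_mod_cast hN
  have h1 : q * N < 4 + 2 * N := by
    have : 4 / (N : ℝ) + 2 = (4 + 2 * N) / N := by field_simp
    rw [this, lt_div_iff₀ (by linarith)] at hq
    exact hq
  unfold radExp
  nlinarith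

/-- The radial density of the nonlinear term. -/
def potDens (q : ℝ) (p : Ambient N) (r : ℝ) : ℝ := r ^ radExp N q * ‖prof p r‖ ^ q

lemma potDens_nonneg (q : ℝ) (p : Ambient N) {r : ℝ} (hr : 0 < r) : 0 ≤ potDens q p r := by
  unfold potDens; positivity

lemma aestronglyMeasurable_potDens (hN : 3 ≤ N) (q : ℝ) {p : Ambient N} (hp : p ∈ SpaceH N) :
    AEStronglyMeasurable (potDens q p) (volume.restrict (Set.Ioi 0)) :=
  AEStronglyMeasurable.mul (Measurable.aestronglyMeasurable (by fun_prop))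
    ((aestronglyMeasurable_prof hN hp).norm.aemeasurable.pow_const q).aestronglyMeasurable

lemma norm_prof_le (hN : 3 ≤ N) {p : Ambient N} (hp : p ∈ SpaceHr N) {m s r : ℝ} (hm : ‖p.fst‖ ≤ m)
    (hs : ‖p.snd‖ ≤ s) (hr : 0 < r) : ‖prof p r‖ ≤ √(2 * (m * s) / (sphArea N * r)) := by
  have hσ := sphArea_pos hN
  refine Real.le_sqrt_of_sq_le ?_
  rw [le_div_iff₀ (by positivity)]
  have h1 := sq_prof_le hN hp hr
  rw [le_div_iff₀ hr] at h1
  have h2 : ‖p.fst‖ * ‖p.snd‖ ≤ m * s :=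
    mul_le_mul hm hs (norm_nonneg _) ((norm_nonneg _).trans hm)
  linarith

/-- The constant in the pointwise bound near the origin. -/
def inConst (N : ℕ) (δ m s R : ℝ) : ℝ :=
  √(2 * (m * s) / (sphArea N * R)) + (sphArea N)⁻¹ * √(sphArea N / (2 * δ)) * s

/-- The profile at r is the one at R plus an increment of order √(log(R/r)), and any positive power
of R/r dominates this. -/
lemma norm_prof_inner_le (hN : 3 ≤ N) {p : Ambient N} (hp : p ∈ SpaceHr N) {δ m s r R : ℝ} (hδ : 0 < δ)
    (hm : ‖p.fst‖ ≤ m) (hs : ‖p.snd‖ ≤ s) (hr : 0 < r) (hR : r ≤ R) :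
    ‖prof p r‖ ≤ inConst N δ m s R * (R / r) ^ δ := by
  have hσ := sphArea_pos hN
  have hR0 : 0 < R := hr.trans_le hR
  have h1 : (1 : ℝ) ≤ (R / r) ^ δ := Real.one_le_rpow ((one_le_div hr).2 hR) hδ.le
  have h2 := norm_prof_le hN hp hm hs hR0
  have h3 := norm_prof_sub_le hN hp.1 hr hR
  have h4 : √(sphArea N * Real.log (R / r)) ≤ √(sphArea N / (2 * δ)) * (R / r) ^ δ := by
    -- The exponent is 2δ so that δ remains after the square root.
    have h5 : Real.log (R / r) ≤ (R / r) ^ (2 * δ) / (2 * δ) :=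
      Real.log_le_rpow_div (by positivity) (by positivity)
    have h6 : (R / r) ^ (2 * δ) = ((R / r) ^ δ) ^ 2 := by
      rw [← Real.rpow_natCast, ← Real.rpow_mul (by positivity)]
      congr 1; push_cast; ring
    calc √(sphArea N * Real.log (R / r)) ≤ √(sphArea N / (2 * δ) * ((R / r) ^ δ) ^ 2) := by
          refine Real.sqrt_le_sqrt ?_
          rw [← h6, div_mul_eq_mul_div, mul_div_assoc]
          exact mul_le_mul_of_nonneg_left h5 hσ.le
      _ = _ := by rw [Real.sqrt_mul (by positivity), Real.sqrt_sq (by positivity)]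
  have h7 : ‖prof p r‖ ≤ ‖prof p R‖ + ‖prof p R - prof p r‖ := by
    have := norm_sub_le (prof p R) (prof p R - prof p r)
    rwa [sub_sub_cancel] at this
  have hs0 : 0 ≤ s := (norm_nonneg _).trans hs
  have h8 : (sphArea N)⁻¹ * (‖p.snd‖ * √(sphArea N * Real.log (R / r))) ≤
      (sphArea N)⁻¹ * (s * (√(sphArea N / (2 * δ)) * (R / r) ^ δ)) := by
    gcongr
  have h9 : √(2 * (m * s) / (sphArea N * R)) ≤ √(2 * (m * s) / (sphArea N * R)) * (R / r) ^ δ :=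
    le_mul_of_one_le_right (Real.sqrt_nonneg _) h1
  rw [inConst, add_mul]
  calc ‖prof p r‖ ≤ ‖prof p R‖ + ‖prof p R - prof p r‖ := h7
    _ ≤ √(2 * (m * s) / (sphArea N * R)) * (R / r) ^ δ +
        (sphArea N)⁻¹ * (s * (√(sphArea N / (2 * δ)) * (R / r) ^ δ)) :=
      add_le_add (h2.trans h9) (h3.trans h8)
    _ = _ := by ring

lemma inConst_nonneg (hN : 3 ≤ N) {δ m s R : ℝ} (hs : 0 ≤ s) : 0 ≤ inConst N δ m s R := by
  have hσ := sphArea_pos hN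
  unfold inConst
  positivity

/-- The exponent of the pointwise bound near the origin. -/
def inExp (N : ℕ) (q : ℝ) : ℝ := (radExp N q + 1) / (2 * q)

/-- With δ = (κ+1)/(2q), κ being `radExp`, the weight r^κ (R/r)^{δq} has exponent (κ-1)/2 in r. This
is halfway between κ and -1, hence still integrable at 0. -/
lemma potDens_inner_le (hN : 3 ≤ N) {q : ℝ} (hq : 2 < q) (hq₂ : q < 4 / (N : ℝ) + 2) {p : Ambient N}
    (hp : p ∈ SpaceHr N) {m s r R : ℝ} (hm : ‖p.fst‖ ≤ m) (hs : ‖p.snd‖ ≤ s) (hr : 0 < r) (hR : r ≤ R) :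
    potDens q p r ≤ inConst N (inExp N q) m s R ^ q * R ^ ((radExp N q + 1) / 2) *
      r ^ ((radExp N q - 1) / 2) := by
  have hκ := radExp_gt hN hq₂
  have hδ : 0 < inExp N q := div_pos (by linarith) (by linarith)
  have hR0 : 0 < R := hr.trans_le hR
  have hM := inConst_nonneg hN (δ := inExp N q) (m := m) (R := R) ((norm_nonneg _).trans hs)
  have h1 := Real.rpow_le_rpow (norm_nonneg _) (norm_prof_inner_le hN hp hδ hm hs hr hR)
    (by linarith : 0 ≤ q)
  have hqe : inExp N q * q = (radExp N q + 1) / 2 := by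
    unfold inExp; field_simp
  rw [Real.mul_rpow hM (by positivity), ← Real.rpow_mul (by positivity), hqe,
    Real.div_rpow hR0.le hr.le] at h1
  have h2 : r ^ radExp N q = r ^ ((radExp N q - 1) / 2) * r ^ ((radExp N q + 1) / 2) := by
    rw [← Real.rpow_add hr]; congr 1; ring
  unfold potDens
  calc r ^ radExp N q * ‖prof p r‖ ^ q ≤ r ^ radExp N q * (inConst N (inExp N q) m s R ^ q *
        (R ^ ((radExp N q + 1) / 2) / r ^ ((radExp N q + 1) / 2))) := by gcongr
    _ = _ := by
      rw [h2]
      have : r ^ ((radExp N q + 1) / 2) ≠ 0 := (Real.rpow_pos_of_pos hr _).ne'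
      field_simp

lemma integral_inner_weight {κ R : ℝ} (hκ : -1 < κ) (hR : 0 < R) :
    IntegrableOn (fun r : ℝ => r ^ ((κ - 1) / 2)) (Set.Ioc 0 R) ∧
      ∫ r in Set.Ioc 0 R, r ^ ((κ - 1) / 2) = R ^ ((κ + 1) / 2) / ((κ + 1) / 2) := by
  have h : -1 < (κ - 1) / 2 := by linarith
  constructor
  · exact (intervalIntegrable_iff_integrableOn_Ioc_of_le hR.le).1
      (intervalIntegral.intervalIntegrable_rpow' h)
  · rw [← intervalIntegral.integral_of_le hR.le, integral_rpow (Or.inl h),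
      Real.zero_rpow (by linarith), sub_zero]
    congr 2 <;> ring

lemma potDens_inner (hN : 3 ≤ N) {q : ℝ} (hq : 2 < q) (hq₂ : q < 4 / (N : ℝ) + 2) {p : Ambient N}
    (hp : p ∈ SpaceHr N) {m s R : ℝ} (hm : ‖p.fst‖ ≤ m) (hs : ‖p.snd‖ ≤ s) (hR : 0 < R) :
    IntegrableOn (potDens q p) (Set.Ioc 0 R) ∧ ∫ r in Set.Ioc 0 R, potDens q p r ≤
      inConst N (inExp N q) m s R ^ q * R ^ (radExp N q + 1) * (2 / (radExp N q + 1)) := by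
  have hκ := radExp_gt hN hq₂
  obtain ⟨i1, e1⟩ := integral_inner_weight hκ hR
  set C := inConst N (inExp N q) m s R ^ q * R ^ ((radExp N q + 1) / 2) with hC
  have hle : ∀ r ∈ Set.Ioc 0 R, potDens q p r ≤ C * r ^ ((radExp N q - 1) / 2) := fun r hr =>
    potDens_inner_le hN hq hq₂ hp hm hs hr.1 hr.2
  have hint : IntegrableOn (potDens q p) (Set.Ioc 0 R) := by
    refine Integrable.mono' (i1.const_mul C) ((aestronglyMeasurable_potDens hN q hp.1).mono_measure
      (Measure.restrict_mono (fun r hr => hr.1) le_rfl)) ?_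
    refine (ae_restrict_iff' measurableSet_Ioc).2 (Eventually.of_forall fun r hr => ?_)
    rw [Real.norm_of_nonneg (potDens_nonneg q p hr.1)]
    exact hle r hr
  refine ⟨hint, (setIntegral_mono_on hint (i1.const_mul C) measurableSet_Ioc hle).trans_eq ?_⟩
  rw [integral_const_mul, e1, hC]
  have h2 : R ^ (radExp N q + 1) = R ^ ((radExp N q + 1) / 2) * R ^ ((radExp N q + 1) / 2) := by
    rw [← Real.rpow_add hR]; congr 1; ring
  rw [h2]
  field_simp

/-- The density is r^{κ-1}|prof|^{q-2} times the mass density r|prof|². The first two factors are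
largest at R: by κ < 1 for one, and for the other in the decay bound. -/
lemma potDens_outer (hN : 3 ≤ N) {q : ℝ} (hq : 2 < q) {p : Ambient N}
    (hp : p ∈ SpaceHr N) {m s R : ℝ} (hm : ‖p.fst‖ ≤ m) (hs : ‖p.snd‖ ≤ s) (hR : 0 < R) :
    IntegrableOn (potDens q p) (Set.Ioi R) ∧ ∫ r in Set.Ioi R, potDens q p r ≤
      R ^ (radExp N q - 1) * √(2 * (m * s) / (sphArea N * R)) ^ (q - 2) * (m ^ 2 / sphArea N) := by
  have hκ := radExp_lt_one hN hq
  have hσ := sphArea_pos hN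
  obtain ⟨i1, e1⟩ := integral_sq_prof hN hp
  have hsub : Set.Ioi R ⊆ Set.Ioi 0 := Set.Ioi_subset_Ioi hR.le
  set C := R ^ (radExp N q - 1) * √(2 * (m * s) / (sphArea N * R)) ^ (q - 2) with hC
  have hm0 : 0 ≤ m := (norm_nonneg _).trans hm
  have hs0 : 0 ≤ s := (norm_nonneg _).trans hs
  have hle : ∀ r ∈ Set.Ioi R, potDens q p r ≤ C * (r * ‖prof p r‖ ^ 2) := by
    intro r hr
    have hrR : R < r := hr
    have hr0 : 0 < r := hR.trans hr
    have h1 : r ^ radExp N q = r ^ (radExp N q - 1) * r := by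
      rw [← Real.rpow_add_one hr0.ne', sub_add_cancel]
    have h2 : ‖prof p r‖ ^ q = ‖prof p r‖ ^ (q - 2) * ‖prof p r‖ ^ 2 := by
      rw [← Real.rpow_natCast, ← Real.rpow_add_of_nonneg (norm_nonneg _) (by linarith) (by positivity)]
      congr 1; push_cast; ring
    have h3 : r ^ (radExp N q - 1) ≤ R ^ (radExp N q - 1) :=
      Real.rpow_le_rpow_of_nonpos hR hrR.le (by linarith)
    have h4 : ‖prof p r‖ ≤ √(2 * (m * s) / (sphArea N * R)) := by
      refine (norm_prof_le hN hp hm hs hr0).trans (Real.sqrt_le_sqrt ?_)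
      gcongr
    have h5 : ‖prof p r‖ ^ (q - 2) ≤ √(2 * (m * s) / (sphArea N * R)) ^ (q - 2) :=
      Real.rpow_le_rpow (norm_nonneg _) h4 (by linarith)
    unfold potDens
    rw [h1, h2, hC]
    calc r ^ (radExp N q - 1) * r * (‖prof p r‖ ^ (q - 2) * ‖prof p r‖ ^ 2)
        = (r ^ (radExp N q - 1) * ‖prof p r‖ ^ (q - 2)) * (r * ‖prof p r‖ ^ 2) := by ring
      _ ≤ _ := by gcongr
  have hint : IntegrableOn (potDens q p) (Set.Ioi R) := by
    refine Integrable.mono' ((i1.mono_set hsub).const_mul C)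
      ((aestronglyMeasurable_potDens hN q hp.1).mono_measure (Measure.restrict_mono hsub le_rfl)) ?_
    refine (ae_restrict_iff' measurableSet_Ioi).2 (Eventually.of_forall fun r hr => ?_)
    rw [Real.norm_of_nonneg (potDens_nonneg q p (hR.trans hr))]
    exact hle r hr
  refine ⟨hint, (setIntegral_mono_on hint ((i1.mono_set hsub).const_mul C) measurableSet_Ioi hle).trans ?_⟩
  rw [integral_const_mul]
  refine mul_le_mul_of_nonneg_left ?_ (by positivity)
  have h6 : ∫ r in Set.Ioi R, r * ‖prof p r‖ ^ 2 ≤ ∫ r in Set.Ioi 0, r * ‖prof p r‖ ^ 2 := by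
    refine setIntegral_mono_set i1 ?_ hsub.eventuallyLE
    refine (ae_restrict_iff' measurableSet_Ioi).2 (Eventually.of_forall fun r hr => ?_)
    have hr : 0 < r := hr
    simp only [Pi.zero_apply]; positivity
  refine h6.trans ?_
  rw [le_div_iff₀ hσ, mul_comm, e1]
  gcongr

lemma potential_split (hN : 3 ≤ N) {q : ℝ} (hq : 2 < q) (hq₂ : q < 4 / (N : ℝ) + 2) {p : Ambient N}
    (hp : p ∈ SpaceHr N) {R : ℝ} (hR : 0 < R) :
    potential q p = sphArea N * ((∫ r in Set.Ioc 0 R, potDens q p r) +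
      ∫ r in Set.Ioi R, potDens q p r) := by
  rw [potential_eq hN q hp, ← setIntegral_union (Set.Ioc_disjoint_Ioi le_rfl) measurableSet_Ioi
    (potDens_inner hN hq hq₂ hp le_rfl le_rfl hR).1 (potDens_outer hN hq hp le_rfl le_rfl hR).1,
    Set.Ioc_union_Ioi_eq_Ioi hR.le]
  rfl

/-- A subcritical Gagliardo–Nirenberg type bound at fixed mass. -/
lemma potential_le (hN : 3 ≤ N) {q : ℝ} (hq : 2 < q) (hq₂ : q < 4 / (N : ℝ) + 2) (m : ℝ) (hm : 0 ≤ m) :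
    ∃ C : ℝ, 0 ≤ C ∧ ∀ p ∈ SpaceHr N, ‖p.fst‖ ≤ m → ∀ L : ℝ, 1 ≤ L → ‖p.snd‖ ≤ L →
      potential q p ≤ C * L ^ (q - radExp N q - 1) := by
  have hσ := sphArea_pos hN
  have hκ := radExp_gt hN hq₂
  have hδ : 0 < inExp N q := div_pos (by linarith) (by linarith)
  set A := √(2 * m / sphArea N) with hA
  set B := A + (sphArea N)⁻¹ * √(sphArea N / (2 * inExp N q)) with hB
  refine ⟨sphArea N * (B ^ q * (2 / (radExp N q + 1)) + A ^ (q - 2) * (m ^ 2 / sphArea N)), ?_, ?_⟩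
  · have : 0 ≤ 2 / (radExp N q + 1) := div_nonneg zero_le_two (by linarith)
    positivity
  intro p hp hpm L hL hpL
  have hL0 : 0 < L := by linarith
  -- Cutting at R = 1/L balances the two regions: both pointwise constants become multiples of L,
  -- and both integrals scale like L^{q-κ-1}.
  have hR : 0 < L⁻¹ := by positivity
  have h1 : √(2 * (m * L) / (sphArea N * L⁻¹)) = A * L := by
    have : 2 * (m * L) / (sphArea N * L⁻¹) = 2 * m / sphArea N * L ^ 2 := by field_simp
    rw [this, Real.sqrt_mul (by positivity), Real.sqrt_sq hL0.le]
  have h2 : inConst N (inExp N q) m L L⁻¹ = B * L := by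
    rw [inConst, h1, hB]; ring
  have hB0 : 0 ≤ B := by positivity
  have e1 := (potDens_inner hN hq hq₂ hp hpm hpL hR).2
  have e2 := (potDens_outer hN hq hp hpm hpL hR).2
  rw [h2, Real.mul_rpow hB0 hL0.le, Real.inv_rpow hL0.le, ← Real.rpow_neg hL0.le] at e1
  rw [h1, Real.mul_rpow (by positivity) hL0.le, Real.inv_rpow hL0.le, ← Real.rpow_neg hL0.le] at e2
  have p1 : L ^ q * L ^ (-(radExp N q + 1)) = L ^ (q - radExp N q - 1) := by
    rw [← Real.rpow_add hL0]; congr 1; ring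
  have p2 : L ^ (-(radExp N q - 1)) * L ^ (q - 2) = L ^ (q - radExp N q - 1) := by
    rw [← Real.rpow_add hL0]; congr 1; ring
  rw [potential_split hN hq hq₂ hp hR, mul_assoc]
  refine mul_le_mul_of_nonneg_left ((add_le_add e1 e2).trans_eq ?_) hσ.le
  linear_combination (B ^ q * (2 / (radExp N q + 1))) * p1 + (A ^ (q - 2) * (m ^ 2 / sphArea N)) * p2

/-- The nonlinear term is continuous along bounded sequences whose profiles converge pointwise. -/
lemma tendsto_potential (hN : 3 ≤ N) {q : ℝ} (hq : 2 < q) (hq₂ : q < 4 / (N : ℝ) + 2)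
    {P : ℕ → Ambient N} {p : Ambient N} (hP : ∀ n, P n ∈ SpaceHr N) (hp : p ∈ SpaceHr N) {M : ℝ}
    (hM : ∀ n, ‖P n‖ ≤ M) (hpM : ‖p‖ ≤ M)
    (hlim : ∀ r, 0 < r → Tendsto (fun n => prof (P n) r) atTop (𝓝 (prof p r))) :
    Tendsto (fun n => potential q (P n)) atTop (𝓝 (potential q p)) := by
  have hσ := sphArea_pos hN
  have hκ := radExp_gt hN hq₂
  have hκ1 := radExp_lt_one hN hq
  have h1 := fun n => (WithLp.norm_fst_le (p := 2) _ (P n)).trans (hM n)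
  have h2 := fun n => (WithLp.norm_snd_le (p := 2) _ (P n)).trans (hM n)
  have h3 := (WithLp.norm_fst_le (p := 2) _ p).trans hpM
  have h4 := (WithLp.norm_snd_le (p := 2) _ p).trans hpM
  have hM0 : 0 ≤ M := (norm_nonneg _).trans hpM
  -- On a bounded interval the pointwise bound near the origin is a common integrable majorant.
  have hin : ∀ R : ℝ, 0 < R → Tendsto (fun n => ∫ r in Set.Ioc 0 R, potDens q (P n) r) atTop
      (𝓝 (∫ r in Set.Ioc 0 R, potDens q p r)) := by
    intro R hR
    refine tendsto_integral_of_dominated_convergence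
      (fun r => inConst N (inExp N q) M M R ^ q * R ^ ((radExp N q + 1) / 2) *
        r ^ ((radExp N q - 1) / 2)) (fun n => (potDens_inner hN hq hq₂ (hP n) (h1 n) (h2 n) hR).1.1)
      ((integral_inner_weight hκ hR).1.const_mul _) (fun n => ?_) ?_
    · refine (ae_restrict_iff' measurableSet_Ioc).2 (Eventually.of_forall fun r hr => ?_)
      rw [Real.norm_of_nonneg (potDens_nonneg q _ hr.1)]
      exact potDens_inner_le hN hq hq₂ (hP n) (h1 n) (h2 n) hr.1 hr.2
    · refine (ae_restrict_iff' measurableSet_Ioc).2 (Eventually.of_forall fun r hr => ?_)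
      exact ((hlim r hr.1).norm.rpow_const (Or.inr (by linarith))).const_mul _
  have htail : Tendsto (fun R : ℝ => R ^ (radExp N q - 1) *
      (√(2 * (M * M) / (sphArea N * 1)) ^ (q - 2) * (M ^ 2 / sphArea N))) atTop (𝓝 0) := by
    have := (tendsto_rpow_neg_atTop (by linarith : 0 < 1 - radExp N q)).mul_const
      (√(2 * (M * M) / (sphArea N * 1)) ^ (q - 2) * (M ^ 2 / sphArea N))
    rwa [zero_mul, neg_sub] at this
  -- The tail is small uniformly over the ball of radius M, by the factor R^{κ-1}.
  have hout : ∀ p' ∈ SpaceHr N, ‖p'.fst‖ ≤ M → ‖p'.snd‖ ≤ M → ∀ R : ℝ, 1 ≤ R →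
      |∫ r in Set.Ioi R, potDens q p' r| ≤ R ^ (radExp N q - 1) *
      (√(2 * (M * M) / (sphArea N * 1)) ^ (q - 2) * (M ^ 2 / sphArea N)) := by
    intro p' hp' h1 h2 R hR
    have hR0 : 0 < R := by linarith
    rw [abs_of_nonneg (setIntegral_nonneg measurableSet_Ioi
      fun r hr => potDens_nonneg q p' (hR0.trans hr)), ← mul_assoc]
    refine (potDens_outer hN hq hp' h1 h2 hR0).2.trans ?_
    have : √(2 * (M * M) / (sphArea N * R)) ^ (q - 2) ≤
        √(2 * (M * M) / (sphArea N * 1)) ^ (q - 2) := by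
      refine Real.rpow_le_rpow (Real.sqrt_nonneg _) (Real.sqrt_le_sqrt ?_) (by linarith)
      gcongr
    gcongr
  rw [Metric.tendsto_atTop]
  intro ε hε
  -- Three errors of size ε/(4σ), σ being the sphere area, add up to 3ε/4 after multiplication by σ.
  obtain ⟨R, hR1, hRε⟩ := ((eventually_ge_atTop (1 : ℝ)).and
    (htail.eventually (gt_mem_nhds (show 0 < ε / (4 * sphArea N) by positivity)))).exists
  have hR0 : 0 < R := by linarith
  obtain ⟨n₀, hn₀⟩ := Metric.tendsto_atTop.1 (hin R hR0) (ε / (4 * sphArea N)) (by positivity)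
  refine ⟨n₀, fun n hn => ?_⟩
  have k1 := hn₀ n hn
  have k2 := (hout _ (hP n) (h1 n) (h2 n) R hR1).trans_lt hRε
  have k3 := (hout _ hp h3 h4 R hR1).trans_lt hRε
  rw [Real.dist_eq] at k1 ⊢
  rw [potential_split hN hq hq₂ (hP n) hR0, potential_split hN hq hq₂ hp hR0, ← mul_sub, abs_mul,
    abs_of_pos hσ, add_sub_add_comm]
  have k4 := (abs_add_le ((∫ r in Set.Ioc 0 R, potDens q (P n) r) - ∫ r in Set.Ioc 0 R, potDens q p r)
      ((∫ r in Set.Ioi R, potDens q (P n) r) - ∫ r in Set.Ioi R, potDens q p r)).trans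
    (add_le_add le_rfl (abs_sub _ _))
  have k5 : 3 * (ε / (4 * sphArea N)) =
      ε / (4 * sphArea N) + (ε / (4 * sphArea N) + ε / (4 * sphArea N)) := by ring
  have k6 := k4.trans_lt ((add_lt_add k1 (add_lt_add k2 k3)).trans_eq k5.symm)
  calc _ < sphArea N * (3 * (ε / (4 * sphArea N))) := by gcongr
    _ = 3 / 4 * ε := by field_simp
    _ < ε := by linarith

end HardyNLS

namespace HardyNLS

variable {N : ℕ}

/-! ### The space of radial elements is closed -/

/-- Radiality as measurability for the σ-algebra generated by |x|: in this form it is a closed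
condition in L². -/
lemma isRadial_iff (v : Pt N → ℂ) :
    IsRadial v ↔ AEStronglyMeasurable[MeasurableSpace.comap (fun x : Pt N => ‖x‖) inferInstance] v
      (wMeasure N) := by
  constructor
  · rintro ⟨f, hf, h⟩
    refine ⟨fun x => f ‖x‖, Measurable.stronglyMeasurable ?_, h⟩
    exact hf.comp (comap_measurable _)
  · rintro ⟨g, hg, h⟩
    obtain ⟨f, hf, hfg⟩ := (Measurable.exists_eq_measurable_comp (f := fun x : Pt N => ‖x‖)
      hg.measurable)
    exact ⟨f, hf, h.trans (Eventually.of_forall fun x => by rw [hfg]; rfl)⟩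

lemma isClosed_SpaceHr : IsClosed ((SpaceHr N : Submodule ℝ (Ambient N)) : Set (Ambient N)) := by
  have hm : MeasurableSpace.comap (fun x : Pt N => ‖x‖) inferInstance ≤
      (inferInstance : MeasurableSpace (Pt N)) := measurable_norm.comap_le
  have h1 : IsClosed ((SpaceH N : Submodule ℝ (Ambient N)) : Set (Ambient N)) :=
    Submodule.isClosed_topologicalClosure _
  have h2 := (isClosed_aestronglyMeasurable (F := ℂ) (p := 2) (μ := wMeasure N) hm).preimage
    (WithLp.fstL 2 ℝ (Lp ℂ 2 (wMeasure N)) (Lp (Grad N) 2 (wMeasure N))).continuous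
  convert h1.inter h2 using 1
  ext p
  exact and_congr Iff.rfl (isRadial_iff _)

/-! ### Basic properties of the nonlinear term -/

lemma potential_smul (hN : 3 ≤ N) (q : ℝ) {t : ℝ} (ht : 0 ≤ t) (p : Ambient N) :
    potential q (t • p) = t ^ q * potential q p := by
  unfold potential
  rw [← integral_const_mul]
  refine integral_congr_ae ?_
  filter_upwards [volume_ac_polM hN (polM_ac_wMeasure hN (Lp.coeFn_smul t p.fst))] with x hx
  rw [transf, WithLp.smul_fst, hx, Pi.smul_apply, mul_smul_comm, norm_smul, Real.norm_of_nonneg ht,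
    Real.mul_rpow ht (norm_nonneg _)]
  rfl

lemma potential_nonneg (q : ℝ) (p : Ambient N) : 0 ≤ potential q p :=
  integral_nonneg fun _ => by positivity

lemma potential_eq_zero (hN : 3 ≤ N) {q : ℝ} (hq : 2 < q) {p : Ambient N} (h : p.fst = 0) :
    potential q p = 0 := by
  unfold potential
  refine integral_eq_zero_of_ae ?_
  filter_upwards [volume_ac_polM hN (polM_ac_wMeasure hN (Lp.coeFn_zero ℂ 2 (wMeasure N)))] with x hx
  rw [transf, h, hx]
  simp [Real.zero_rpow (by linarith : q ≠ 0)]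

lemma potential_pos (hN : 3 ≤ N) {q : ℝ} (hq : 2 < q) (hq₂ : q < 4 / (N : ℝ) + 2) {p : Ambient N}
    (hp : p ∈ SpaceHr N) (h : p.fst ≠ 0) : 0 < potential q p := by
  refine lt_of_le_of_ne (potential_nonneg q p) fun h0 => h ?_
  have hσ := sphArea_pos hN
  have hI : IntegrableOn (potDens q p) (Set.Ioi 0) := by
    rw [← Set.Ioc_union_Ioi_eq_Ioi (zero_le_one (α := ℝ))]
    exact (potDens_inner hN hq hq₂ hp le_rfl le_rfl one_pos).1.union
      (potDens_outer hN hq hp le_rfl le_rfl one_pos).1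
  rw [potential_eq hN q hp, eq_comm, mul_eq_zero, or_iff_right hσ.ne'] at h0
  have h1 := (setIntegral_eq_zero_iff_of_nonneg_ae ((ae_restrict_iff' measurableSet_Ioi).2
    (Eventually.of_forall fun r hr => potDens_nonneg q p hr)) hI).1 h0
  have h2 : ∀ᵐ r ∂(volume.restrict (Set.Ioi (0 : ℝ))), r * ‖prof p r‖ ^ 2 = 0 := by
    filter_upwards [h1, ae_restrict_mem measurableSet_Ioi] with r hr hr0
    have hr0 : 0 < r := hr0
    have h3 : ‖prof p r‖ ^ q = 0 := by
      refine (mul_eq_zero.1 hr).resolve_left ?_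
      exact (Real.rpow_pos_of_pos hr0 _).ne'
    rw [(Real.rpow_eq_zero (norm_nonneg _) (by linarith)).1 h3]
    ring
  have h3 := (integral_sq_prof hN hp).2
  rw [integral_eq_zero_of_ae h2, mul_zero] at h3
  exact norm_eq_zero.1 (pow_eq_zero_iff two_ne_zero |>.1 h3.symm)

/-! ### A radial function of negative energy -/

lemma wMeasure_closedBall_lt_top (hN : 3 ≤ N) (R : ℝ) : wMeasure N (Metric.closedBall 0 R) < ⊤ := by
  have h1 : polM N (Metric.closedBall 0 R) < ⊤ := by
    have : polM N (Metric.closedBall 0 R) =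
        Measure.map (fun x : Pt N => ‖x‖) (polM N) (Set.Iic R) := by
      rw [Measure.map_apply measurable_norm measurableSet_Iic]
      congr 1
      ext x
      simp
    rw [this, map_norm_polM]
    simp only [Measure.smul_apply, smul_eq_mul]
    refine ENNReal.mul_lt_top (measure_lt_top _ _) ?_
    rw [Measure.restrict_apply measurableSet_Iic, Set.inter_comm, Set.Ioi_inter_Iic]
    simp
  rw [wMeasure_eq_withDensity_polM hN, withDensity_apply _ Metric.isClosed_closedBall.measurableSet]
  refine (setLIntegral_mono (g := fun _ => ENNReal.ofReal R) measurable_const fun x hx => ?_).trans_lt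
    ?_
  · have hx : ‖x‖ ≤ R := by simpa using hx
    rw [← ENNReal.ofReal_coe_nnreal]
    exact ENNReal.ofReal_le_ofReal hx
  · rw [setLIntegral_const]
    exact ENNReal.mul_lt_top ENNReal.ofReal_lt_top h1

lemma memLp_of_compactSupport (hN : 3 ≤ N) {E : Type*} [NormedAddCommGroup E] 
    {F : Pt N → E} (hF : Continuous F) (hc : HasCompactSupport F) : MemLp F 2 (wMeasure N) := by
  have : IsFiniteMeasureOnCompacts (wMeasure N) := by
    refine ⟨fun K hK => ?_⟩
    obtain ⟨R, hR⟩ := hK.isBounded.subset_closedBall 0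
    exact (measure_mono hR).trans_lt (wMeasure_closedBall_lt_top hN R)
  exact hF.memLp_of_hasCompactSupport hc

lemma continuous_classicalGrad {φ : Pt N → ℂ} (hφ : ContDiff ℝ ∞ φ) : Continuous (classicalGrad φ) := by
  unfold classicalGrad
  refine (PiLp.continuous_toLp 2 _).comp (continuous_pi fun i => ?_)
  exact (hφ.continuous_fderiv (by simp)).clm_apply continuous_const

lemma hasCompactSupport_classicalGrad {φ : Pt N → ℂ} (hc : HasCompactSupport φ) :
    HasCompactSupport (classicalGrad φ) := by
  refine (hc.fderiv (𝕜 := ℝ)).mono fun x hx h => hx ?_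
  rw [Function.mem_support] at hx
  ext i
  simp only [classicalGrad]
  rw [h]; rfl

/-- A smooth compactly supported function as an element of the weighted space. -/
lemma exists_mem_smoothGraph (hN : 3 ≤ N) {φ : Pt N → ℂ} (hφ : ContDiff ℝ ∞ φ)
    (hc : HasCompactSupport φ) : ∃ p ∈ smoothGraph N, p.fst =ᵐ[wMeasure N] φ ∧
      p.snd =ᵐ[wMeasure N] classicalGrad φ := by
  have h1 := memLp_of_compactSupport hN hφ.continuous hc
  have h2 := memLp_of_compactSupport hN (continuous_classicalGrad hφ)
    (hasCompactSupport_classicalGrad hc)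
  refine ⟨WithLp.toLp 2 (h1.toLp, h2.toLp), ⟨φ, hφ, hc, ?_, ?_⟩, ?_, ?_⟩
  · exact h1.coeFn_toLp
  · exact h2.coeFn_toLp
  · exact h1.coeFn_toLp
  · exact h2.coeFn_toLp

/-- A radial bump function. -/
def bump (x : Pt N) : ℂ := (Real.smoothTransition (2 - ‖x‖ ^ 2) : ℝ)

lemma contDiff_bump : ContDiff ℝ ∞ (bump : Pt N → ℂ) := by
  unfold bump
  exact Complex.ofRealCLM.contDiff.comp
    (Real.smoothTransition.contDiff.comp (contDiff_const.sub (contDiff_norm_sq ℝ)))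

lemma hasCompactSupport_bump : HasCompactSupport (bump : Pt N → ℂ) := by
  refine HasCompactSupport.of_support_subset_isCompact (isCompact_closedBall (0 : Pt N) 2)
    fun x hx => ?_
  rw [mem_closedBall_zero_iff]
  by_contra h
  refine hx ?_
  rw [bump, Real.smoothTransition.zero_of_nonpos (by nlinarith)]
  simp

lemma exists_scaled (hN : 3 ≤ N) {l : ℝ} (hl : 0 < l) :
    ∃ p ∈ SpaceHr N, p.fst =ᵐ[polM N] (fun x => bump (l • x)) ∧
      p.snd =ᵐ[polM N] fun x => l • classicalGrad bump (l • x) := by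
  have h1 : ContDiff ℝ ∞ fun x : Pt N => bump (l • x) := contDiff_bump.comp (contDiff_const_smul l)
  have h2 : HasCompactSupport fun x : Pt N => bump (l • x) :=
    hasCompactSupport_bump.comp_smul hl.ne'
  obtain ⟨p, hp, e1, e2⟩ := exists_mem_smoothGraph hN h1 h2
  refine ⟨p, ⟨Submodule.le_topologicalClosure _ hp, ?_⟩, polM_ac_wMeasure hN e1, ?_⟩
  · refine ⟨fun r => (Real.smoothTransition (2 - (l * r) ^ 2) : ℝ), ?_, ?_⟩
    · exact Complex.measurable_ofReal.comp
        (Real.smoothTransition.continuous.measurable.comp (by fun_prop))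
    · filter_upwards [e1] with x hx
      rw [hx, bump, norm_smul, Real.norm_of_nonneg hl.le]
  · filter_upwards [polM_ac_wMeasure hN e2] with x hx
    rw [hx]
    ext i
    simp only [classicalGrad, PiLp.smul_apply]
    rw [fderiv_comp_smul]
    rfl

lemma integral_rpow_scale (F : Pt N → ℝ) (s : ℝ) {l : ℝ} (hl : 0 < l) :
    ∫ x, ‖x‖ ^ s * F (l • x) = l ^ (-s - N) * ∫ x, ‖x‖ ^ s * F x := by
  have h1 : ∀ x : Pt N, ‖x‖ ^ s * F (l • x) = l ^ (-s) * (‖l • x‖ ^ s * F (l • x)) := by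
    intro x
    rw [norm_smul, Real.norm_of_nonneg hl.le, Real.mul_rpow hl.le (norm_nonneg _), ← mul_assoc,
      ← mul_assoc, ← Real.rpow_add hl]
    simp
  simp only [h1]
  rw [integral_const_mul, Measure.integral_comp_smul volume (fun x : Pt N => ‖x‖ ^ s * F x) l,
    finrank_euclideanSpace_fin, smul_eq_mul, ← mul_assoc, abs_of_pos (by positivity),
    Real.rpow_sub hl, Real.rpow_natCast]
  rfl

lemma integral_wMeasure_eq (hN : 3 ≤ N) (F : Pt N → ℝ) :
    ∫ x, F x ∂(wMeasure N) = ∫ x, ‖x‖ ^ (-((N : ℝ) - 2)) * F x := by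
  rw [integral_wMeasure hN, integral_volume hN]
  refine integral_congr_ae ?_
  filter_upwards [polM_ae_ne_zero] with x hx
  rw [smul_eq_mul, smul_eq_mul, ← mul_assoc]
  congr 1
  rw [← Real.rpow_natCast, ← Real.rpow_add hx, Nat.cast_sub (by omega)]
  convert (Real.rpow_one ‖x‖).symm using 2
  push_cast; ring

/-- For the bump x ↦ lD φ(lx) the mass is independent of l, the gradient energy is of order l², and
the nonlinear term is of order l^ϑ with ϑ < 2. For small l the nonlinear term wins. -/
lemma exists_neg_energy (hN : 3 ≤ N) {q : ℝ} (hq : 2 < q) (hq₂ : q < 4 / (N : ℝ) + 2) {γ : ℝ}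
    (hγ : 0 < γ) : ∃ p ∈ SpaceHr N, ‖p.fst‖ ^ 2 = γ ∧
      1 / 2 * ‖p.snd‖ ^ 2 - 1 / q * potential q p < 0 := by
  set A : ℝ := ∫ x : Pt N, ‖x‖ ^ (-((N : ℝ) - 2)) * ‖bump x‖ ^ 2 with hA
  set B : ℝ := ∫ x : Pt N, ‖x‖ ^ (-((N : ℝ) - 2)) * ‖classicalGrad bump x‖ ^ 2 with hB
  set Q : ℝ := ∫ x : Pt N, ‖x‖ ^ (-(((N : ℝ) - 2) / 2) * q) * ‖bump x‖ ^ q with hQ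
  have key : ∀ l : ℝ, 0 < l → ∃ p ∈ SpaceHr N, p.fst ≠ 0 ∧ ‖p.fst‖ ^ 2 = l ^ (-2 : ℝ) * A ∧ ‖p.snd‖ ^ 2 = B ∧
      potential q p = l ^ ((((N : ℝ) - 2) / 2) * q - N) * Q := by
    intro l hl
    obtain ⟨p, hp, e1, e2⟩ := exists_scaled hN hl
    have v1 := volume_ac_polM hN e1
    refine ⟨p, hp, fun h0 => ?_, ?_, ?_, ?_⟩
    · have h1 : (fun x : Pt N => bump (l • x)) =ᵐ[volume] fun _ => 0 := by
        filter_upwards [v1, volume_ac_polM hN (polM_ac_wMeasure hN (Lp.coeFn_zero ℂ 2 (wMeasure N)))]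
          with x hx h2
        rw [← hx, h0, h2]; rfl
      have h2 := (Continuous.ae_eq_iff_eq volume (contDiff_bump.continuous.comp
        (continuous_const_smul l)) continuous_const).1 h1
      have h3 := congrFun h2 0
      simp only [Function.comp_apply, smul_zero, bump, norm_zero] at h3
      rw [Real.smoothTransition.one_of_one_le (by norm_num)] at h3
      simp at h3
    · rw [Lp_norm_sq_eq, integral_wMeasure_eq hN]
      have : ∫ x, ‖x‖ ^ (-((N : ℝ) - 2)) * ‖p.fst x‖ ^ 2 =
          ∫ x : Pt N, ‖x‖ ^ (-((N : ℝ) - 2)) * ‖bump (l • x)‖ ^ 2 :=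
        integral_congr_ae (by filter_upwards [v1] with x hx; rw [hx])
      rw [this, integral_rpow_scale (fun x => ‖bump x‖ ^ 2) _ hl]
      congr 2; ring
    · rw [Lp_norm_sq_eq, integral_wMeasure_eq hN]
      have : ∫ x, ‖x‖ ^ (-((N : ℝ) - 2)) * ‖p.snd x‖ ^ 2 =
          l ^ 2 * ∫ x : Pt N, ‖x‖ ^ (-((N : ℝ) - 2)) * ‖classicalGrad bump (l • x)‖ ^ 2 := by
        rw [← integral_const_mul]
        refine integral_congr_ae ?_
        filter_upwards [volume_ac_polM hN e2] with x hx
        rw [hx, norm_smul, mul_pow, Real.norm_eq_abs, sq_abs]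
        ring
      rw [this, integral_rpow_scale (fun x => ‖classicalGrad bump x‖ ^ 2) _ hl, ← mul_assoc,
        ← Real.rpow_natCast, ← Real.rpow_add hl]
      have h0 : ((2 : ℕ) : ℝ) + (-(-((N : ℝ) - 2)) - N) = 0 := by push_cast; ring
      rw [h0, Real.rpow_zero, one_mul]
    · have : potential q p = ∫ x : Pt N, ‖x‖ ^ (-(((N : ℝ) - 2) / 2) * q) * ‖bump (l • x)‖ ^ q := by
        refine integral_congr_ae ?_
        filter_upwards [v1] with x hx
        rw [transf, norm_mul, Complex.norm_real, Real.norm_of_nonneg (by positivity),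
          Real.mul_rpow (by positivity) (norm_nonneg _), ← Real.rpow_mul (norm_nonneg _), hx]
      rw [this, integral_rpow_scale (fun x => ‖bump x‖ ^ q) _ hl]
      congr 2; ring
  have hAQ : 0 < A ∧ 0 < Q := by
    -- At l = 1 the integrals A and Q are the mass and the nonlinear term of a nonzero element,
    -- hence positive.
    obtain ⟨p, hp, hne, e1, -, e3⟩ := key 1 one_pos
    rw [Real.one_rpow, one_mul] at e1 e3
    refine ⟨?_, ?_⟩
    · rw [← e1]
      have := norm_pos_iff.2 hne
      positivity
    · rw [← e3]
      exact potential_pos hN hq hq₂ hp hne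
  obtain ⟨hA0, hQ0⟩ := hAQ
  set D : ℝ := √(γ / A) with hD
  have hD0 : 0 < D := Real.sqrt_pos.2 (by positivity)
  have hD2 : D ^ 2 * A = γ := by
    rw [hD, Real.sq_sqrt (by positivity)]; field_simp
  set ϑ : ℝ := q - radExp N q - 1 with hϑ
  have hϑ2 : 0 < 2 - ϑ := by linarith [radExp_subcritical hN hq₂]
  have hlim : Tendsto (fun l : ℝ => l ^ (2 - ϑ) * (1 / 2 * D ^ 2 * B)) (𝓝[>] 0) (𝓝 0) := by
    have h1 := (Real.continuousAt_rpow_const 0 (2 - ϑ) (Or.inr hϑ2.le)).tendsto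
    rw [Real.zero_rpow hϑ2.ne'] at h1
    have h2 := (h1.mono_left (nhdsWithin_le_nhds (s := Set.Ioi 0))).mul_const (1 / 2 * D ^ 2 * B)
    rwa [zero_mul] at h2
  obtain ⟨l, hl1, hl⟩ := ((hlim.eventually (gt_mem_nhds
    (show 0 < 1 / q * (D ^ q * Q) by positivity))).and self_mem_nhdsWithin).exists
  have hl : 0 < l := hl
  obtain ⟨p, hp, -, e1, e2, e3⟩ := key l hl
  have hc : 0 ≤ l * D := by positivity
  -- The unscaled element has mass l^{-2}A, so amplitude lD restores D²A = γ.
  refine ⟨(l * D) • p, Submodule.smul_mem _ _ hp, ?_, ?_⟩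
  · rw [WithLp.smul_fst, norm_smul, Real.norm_of_nonneg hc, mul_pow, e1, ← hD2, Real.rpow_neg hl.le,
      Real.rpow_two]
    field_simp
  · rw [WithLp.smul_snd, norm_smul, Real.norm_of_nonneg hc, mul_pow, e2, potential_smul hN q hc, e3,
      Real.mul_rpow hl.le hD0.le]
    have h1 : l ^ q * l ^ (((N : ℝ) - 2) / 2 * q - N) = l ^ ϑ := by
      rw [← Real.rpow_add hl]
      congr 1
      rw [hϑ, radExp]
      ring
    have h2 : l ^ 2 = l ^ ϑ * l ^ (2 - ϑ) := by
      rw [← Real.rpow_add hl, add_sub_cancel, Real.rpow_two]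
    have h3 : 0 < l ^ ϑ := Real.rpow_pos_of_pos hl _
    have h4 : 1 / 2 * ((l * D) ^ 2 * B) -
        1 / q * (l ^ q * D ^ q * (l ^ (((N : ℝ) - 2) / 2 * q - N) * Q)) =
        l ^ ϑ * (l ^ (2 - ϑ) * (1 / 2 * D ^ 2 * B) - 1 / q * (D ^ q * Q)) := by
      linear_combination (1 / 2 * D ^ 2 * B) * h2 - (1 / q * D ^ q * Q) * h1
    rw [h4]
    exact mul_neg_of_pos_of_neg h3 (by linarith)

end HardyNLS

namespace HardyNLS

/-! ### Weak convergence in a Hilbert space -/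

section Weak

variable {X : Type*} [NormedAddCommGroup X] [InnerProductSpace ℝ X]

/-- Sequential Banach–Alaoglu in the dual of a separable space, carried back by the Riesz
isomorphism. -/
lemma exists_weak_subseq [CompleteSpace X] [TopologicalSpace.SeparableSpace X] {x : ℕ → X} {M : ℝ}
    (hM : ∀ n, ‖x n‖ ≤ M) : ∃ (s : ℕ → ℕ) (w : X), StrictMono s ∧
      ∀ ℓ : X →L[ℝ] ℝ, Tendsto (fun n => ℓ (x (s n))) atTop (𝓝 (ℓ w)) := by
  obtain ⟨a, -, s, hs, hlim⟩ := WeakDual.isSeqCompact_closedBall ℝ X 0 M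
    (x := fun n => StrongDual.toWeakDual (InnerProductSpace.toDual ℝ X (x n))) fun n => by
      change InnerProductSpace.toDual ℝ X (x n) ∈ Metric.closedBall 0 M
      rw [mem_closedBall_zero_iff, LinearIsometryEquiv.norm_map]
      exact hM n
  refine ⟨s, (InnerProductSpace.toDual ℝ X).symm (WeakDual.toStrongDual a), hs, fun ℓ => ?_⟩
  obtain ⟨y, rfl⟩ := (InnerProductSpace.toDual ℝ X).surjective ℓ
  have h1 := ((WeakDual.eval_continuous y).tendsto a).comp hlim
  simp only [InnerProductSpace.toDual_apply_apply]
  rw [real_inner_comm, InnerProductSpace.toDual_symm_apply]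
  refine h1.congr fun n => ?_
  exact real_inner_comm _ _

lemma norm_sq_le_of_weak {x : ℕ → X} {w : X} {b : ℝ}
    (h : Tendsto (fun n => inner ℝ w (x n)) atTop (𝓝 (‖w‖ ^ 2)))
    (hb : Tendsto (fun n => ‖x n‖ ^ 2) atTop (𝓝 b)) :
    Tendsto (fun n => ‖x n - w‖ ^ 2) atTop (𝓝 (b - ‖w‖ ^ 2)) ∧ ‖w‖ ^ 2 ≤ b := by
  have h1 : Tendsto (fun n => ‖x n - w‖ ^ 2) atTop (𝓝 (b - ‖w‖ ^ 2)) := by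
    have h2 := (hb.sub (h.const_mul 2)).add_const (‖w‖ ^ 2)
    have h3 : b - 2 * ‖w‖ ^ 2 + ‖w‖ ^ 2 = b - ‖w‖ ^ 2 := by ring
    rw [h3] at h2
    refine h2.congr fun n => ?_
    rw [norm_sub_sq_real, real_inner_comm]
  exact ⟨h1, sub_nonneg.1 (ge_of_tendsto' h1 fun n => sq_nonneg _)⟩

end Weak

variable {N : ℕ}

/-! ### The minimisation problem -/

lemma secondCountableTopology_ambient (N : ℕ) : SecondCountableTopology (Ambient N) := by
  have : SFinite (wMeasure N) := by unfold wMeasure; infer_instance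
  have : Fact ((2 : ENNReal) ≠ ⊤) := ⟨by simp⟩
  have : SecondCountableTopology (Lp ℂ 2 (wMeasure N)) := Lp.SecondCountableTopology
  have : SecondCountableTopology (Lp (Grad N) 2 (wMeasure N)) := Lp.SecondCountableTopology
  exact WithLp.secondCountableTopology 2 _ _

/-- The part of `J` besides the mass term. -/
def redEnergy (q : ℝ) (p : Ambient N) : ℝ := 1 / 2 * ‖p.snd‖ ^ 2 - 1 / q * potential q p

/-- A quantity growing like L^ϑ with ϑ < 2 is absorbed by L²/4 beyond some L₀ and is bounded below
it. -/
lemma potential_coercive (hN : 3 ≤ N) {q : ℝ} (hq : 2 < q) (hq₂ : q < 4 / (N : ℝ) + 2) (γ : ℝ) :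
    ∃ K : ℝ, ∀ p ∈ SpaceHr N, ‖p.fst‖ ^ 2 = γ → 1 / q * potential q p ≤ 1 / 4 * ‖p.snd‖ ^ 2 + K := by
  obtain ⟨C, hC0, hC⟩ := potential_le hN hq hq₂ √γ (Real.sqrt_nonneg _)
  set ϑ : ℝ := q - radExp N q - 1 with hϑ
  have hϑ2 : 0 < 2 - ϑ := by linarith [radExp_subcritical hN hq₂]
  have hϑ0 : 0 < ϑ := by linarith [radExp_lt_one hN hq]
  have hlim : Tendsto (fun L : ℝ => 1 / q * C * L ^ (-(2 - ϑ))) atTop (𝓝 0) := by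
    simpa using (tendsto_rpow_neg_atTop hϑ2).const_mul (1 / q * C)
  obtain ⟨L₀, hL₀⟩ := eventually_atTop.1 ((hlim.eventually (gt_mem_nhds
    (show (0 : ℝ) < 1 / 4 by norm_num))).and (eventually_ge_atTop 1))
  have hL₀1 : 1 ≤ L₀ := (hL₀ L₀ le_rfl).2
  refine ⟨1 / 4 + 1 / q * C * L₀ ^ ϑ, fun p hp hpγ => ?_⟩
  have hm : ‖p.fst‖ ≤ √γ := by rw [← hpγ, Real.sqrt_sq (norm_nonneg _)]
  -- This choice satisfies both L ≥ 1 and ‖p.snd‖ ≤ L; the excess 1 in L² accounts for the summand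
  -- 1/4 of the constant.
  set L : ℝ := √(1 + ‖p.snd‖ ^ 2) with hL
  have hL2 : L ^ 2 = 1 + ‖p.snd‖ ^ 2 := Real.sq_sqrt (by positivity)
  have hL1 : 1 ≤ L := Real.one_le_sqrt.2 (by nlinarith [sq_nonneg ‖p.snd‖])
  have hLs : ‖p.snd‖ ≤ L := Real.le_sqrt_of_sq_le (by linarith)
  have h1 := hC p hp hm L hL1 hLs
  have hq0 : 0 < 1 / q := by positivity
  have h2 : 1 / q * potential q p ≤ 1 / q * C * L ^ ϑ := by
    rw [mul_assoc]; exact mul_le_mul_of_nonneg_left h1 hq0.le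
  have h3 : 1 / q * C * L ^ ϑ ≤ 1 / 4 * L ^ 2 + 1 / q * C * L₀ ^ ϑ := by
    have hL0 : 0 < L := by linarith
    rcases le_total L₀ L with h | h
    · have h4 := (hL₀ L h).1
      have h5 : L ^ ϑ = L ^ (-(2 - ϑ)) * L ^ 2 := by
        rw [← Real.rpow_two, ← Real.rpow_add hL0]; congr 1; ring
      have h6 : 0 ≤ 1 / q * C * L₀ ^ ϑ := by positivity
      have h7 : 0 ≤ L ^ 2 := sq_nonneg _
      rw [h5]
      nlinarith
    · have h4 : L ^ ϑ ≤ L₀ ^ ϑ := Real.rpow_le_rpow hL0.le h hϑ0.le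
      have h5 : 1 / q * C * L ^ ϑ ≤ 1 / q * C * L₀ ^ ϑ := by gcongr
      nlinarith [sq_nonneg L]
  linarith

/-- The quadratic part scales by t² and the subtracted nonlinear part by t^q ≥ t². -/
lemma redEnergy_smul_le (hN : 3 ≤ N) {q : ℝ} (hq : 2 < q) {t : ℝ} (ht : 1 ≤ t) (p : Ambient N) :
    redEnergy q (t • p) ≤ t ^ 2 * redEnergy q p := by
  have ht0 : 0 ≤ t := by linarith
  have h1 : t ^ 2 ≤ t ^ q := by
    rw [← Real.rpow_two]
    exact Real.rpow_le_rpow_of_exponent_le ht hq.le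
  have h2 : 0 ≤ 1 / q * potential q p :=
    mul_nonneg (by positivity) (potential_nonneg q p)
  rw [redEnergy, redEnergy, potential_smul hN q ht0, WithLp.smul_snd, norm_smul,
    Real.norm_of_nonneg ht0, mul_pow]
  nlinarith

/-- Weak convergence is tested by real functionals, so the real and imaginary parts of the bounded
evaluation are used separately. -/
lemma tendsto_prof_of_weak (hN : 3 ≤ N) {x : ℕ → SpaceHr N} {w : SpaceHr N}
    (h : ∀ ℓ : SpaceHr N →L[ℝ] ℝ, Tendsto (fun n => ℓ (x n)) atTop (𝓝 (ℓ w))) {r : ℝ} (hr : 0 < r) :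
    Tendsto (fun n => prof (x n).1 r) atTop (𝓝 (prof w.1 r)) := by
  obtain ⟨ℓ, hℓ⟩ := exists_prof_clm hN hr
  have h1 := h (Complex.reCLM.comp (ℓ.comp (SpaceHr N).subtypeL))
  have h2 := h (Complex.imCLM.comp (ℓ.comp (SpaceHr N).subtypeL))
  have h3 := ((Complex.continuous_ofReal.tendsto _).comp h1).add
    (((Complex.continuous_ofReal.tendsto _).comp h2).mul_const Complex.I)
  simp only [ContinuousLinearMap.comp_apply, Submodule.subtypeL_apply, hℓ, Complex.reCLM_apply,
    Complex.imCLM_apply, Function.comp_def, Complex.re_add_im] at h3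
  exact h3

lemma tendsto_of_components {x : ℕ → Ambient N} {w : Ambient N}
    (h1 : Tendsto (fun n => ‖(x n).fst - w.fst‖ ^ 2) atTop (𝓝 0))
    (h2 : Tendsto (fun n => ‖(x n).snd - w.snd‖ ^ 2) atTop (𝓝 0)) : Tendsto x atTop (𝓝 w) := by
  rw [tendsto_iff_norm_sub_tendsto_zero]
  have h3 := (Real.continuous_sqrt.tendsto _).comp (h1.add h2)
  rw [add_zero, Real.sqrt_zero] at h3
  refine h3.congr fun n => ?_
  rw [WithLp.prod_norm_eq_of_L2, WithLp.sub_fst, WithLp.sub_snd]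
  rfl

/-- Minimising sequences are relatively compact. -/
theorem exists_minimizer_of_tendsto (hN : 3 ≤ N) {q : ℝ} (hq₁ : 2 < q) (hq₂ : q < 4 / (N : ℝ) + 2)
    {γ : ℝ} (hγ : 0 < γ) {v : ℕ → SpaceHr N} (hv : ∀ n, v n ∈ GamTilde N γ)
    (hJ : Tendsto (fun n => J q (v n)) atTop (𝓝 (kTilde N q γ))) :
    ∃ (s : ℕ → ℕ) (w : SpaceHr N), StrictMono s ∧ Tendsto (fun n => v (s n)) atTop (𝓝 w) ∧
      w ∈ GamTilde N γ ∧ IsMinOn (J q) (GamTilde N γ) w := by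
  have hJe : ∀ z ∈ GamTilde N γ, J q z = redEnergy q z.1 + 1 / 2 * γ := by
    intro z hz
    rw [J_eq hN, (mem_GamTilde_iff hN z).1 hz]; rfl
  obtain ⟨K, hK⟩ := potential_coercive hN hq₁ hq₂ γ
  have hlow : ∀ z ∈ GamTilde N γ, 1 / 4 * ‖z.1.snd‖ ^ 2 - K ≤ redEnergy q z.1 := by
    intro z hz
    have := hK z.1 z.2 ((mem_GamTilde_iff hN z).1 hz)
    unfold redEnergy
    linarith
  have hbdd : BddBelow (J q '' GamTilde N γ) := by
    refine ⟨-K + 1 / 2 * γ, ?_⟩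
    rintro _ ⟨z, hz, rfl⟩
    rw [hJe z hz]
    have := hlow z hz
    nlinarith [sq_nonneg ‖z.1.snd‖]
  have hmin : ∀ z ∈ GamTilde N γ, kTilde N q γ ≤ J q z := fun z hz => csInf_le hbdd ⟨z, hz, rfl⟩
  set κ : ℝ := kTilde N q γ - 1 / 2 * γ with hκ
  have hmin' : ∀ z ∈ GamTilde N γ, κ ≤ redEnergy q z.1 := by
    intro z hz
    have := hmin z hz
    rw [hJe z hz] at this
    linarith
  -- Negativity excludes both a vanishing weak limit and a loss of mass.
  have hκ0 : κ < 0 := by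
    obtain ⟨p, hp, h1, h2⟩ := exists_neg_energy hN hq₁ hq₂ hγ
    exact (hmin' ⟨p, hp⟩ ((mem_GamTilde_iff hN _).2 h1)).trans_lt h2
  have he : Tendsto (fun n => redEnergy q (v n).1) atTop (𝓝 κ) := by
    refine (hJ.sub_const (1 / 2 * γ)).congr fun n => ?_
    rw [hJe _ (hv n)]; ring
  obtain ⟨B, hB⟩ := he.bddAbove_range
  have hnorm : ∀ n, ‖(v n).1‖ ≤ √(γ + 4 * (B + K)) := by
    intro n
    refine Real.le_sqrt_of_sq_le ?_
    rw [WithLp.prod_norm_sq_eq_of_L2, (mem_GamTilde_iff hN _).1 (hv n)]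
    have h1 := hlow _ (hv n)
    have h2 : redEnergy q (v n).1 ≤ B := hB ⟨n, rfl⟩
    linarith
  have : CompleteSpace (SpaceHr N) := isClosed_SpaceHr.completeSpace_coe
  have := secondCountableTopology_ambient N
  obtain ⟨s, w, hs, hw⟩ := exists_weak_subseq (x := v) hnorm
  have hprof := fun r (hr : (0 : ℝ) < r) => tendsto_prof_of_weak hN hw hr
  have hQ : Tendsto (fun n => potential q (v (s n)).1) atTop (𝓝 (potential q w.1)) :=
    tendsto_potential hN hq₁ hq₂ (M := max √(γ + 4 * (B + K)) ‖w.1‖) (fun n => (v (s n)).2) w.2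
      (fun n => (hnorm _).trans (le_max_left _ _)) (le_max_right _ _) hprof
  -- The gradient norms converge because the energy and the nonlinear term do; the limit is not yet
  -- known to be ‖w.1.snd‖².
  have hsnd : Tendsto (fun n => ‖(v (s n)).1.snd‖ ^ 2) atTop
      (𝓝 (2 * (κ + 1 / q * potential q w.1))) := by
    refine (((he.comp hs.tendsto_atTop).add (hQ.const_mul (1 / q))).const_mul 2).congr fun n => ?_
    simp only [Function.comp_apply, redEnergy]
    ring
  have hfst : Tendsto (fun n => ‖(v (s n)).1.fst‖ ^ 2) atTop (𝓝 γ) :=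
    tendsto_const_nhds.congr fun n => ((mem_GamTilde_iff hN _).1 (hv (s n))).symm
  have hwf : Tendsto (fun n => inner ℝ w.1.fst (v (s n)).1.fst) atTop (𝓝 (‖w.1.fst‖ ^ 2)) := by
    rw [← real_inner_self_eq_norm_sq]
    exact hw ((innerSL ℝ w.1.fst).comp ((WithLp.fstL 2 ℝ _ _).comp (SpaceHr N).subtypeL))
  have hws : Tendsto (fun n => inner ℝ w.1.snd (v (s n)).1.snd) atTop (𝓝 (‖w.1.snd‖ ^ 2)) := by
    rw [← real_inner_self_eq_norm_sq]
    exact hw ((innerSL ℝ w.1.snd).comp ((WithLp.sndL 2 ℝ _ _).comp (SpaceHr N).subtypeL))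
  obtain ⟨hf1, hf2⟩ := norm_sq_le_of_weak hwf hfst
  obtain ⟨hs1, hs2⟩ := norm_sq_le_of_weak hws hsnd
  -- Lower semicontinuity of the gradient norm, the nonlinear term having passed to the limit.
  have hew : redEnergy q w.1 ≤ κ := by unfold redEnergy; linarith
  have hm0 : 0 < ‖w.1.fst‖ ^ 2 := by
    rcases eq_or_ne w.1.fst 0 with h | h
    · exfalso
      have : 0 ≤ redEnergy q w.1 := by
        rw [redEnergy, potential_eq_zero hN hq₁ h]
        nlinarith [sq_nonneg ‖w.1.snd‖]
      linarith
    · have := norm_pos_iff.2 h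
      positivity
  set m : ℝ := ‖w.1.fst‖ ^ 2 with hm
  -- The multiple of w that has full mass; its factor is at least 1 because the weak limit has mass
  -- m ≤ γ.
  have ht1 : 1 ≤ √(γ / m) := Real.one_le_sqrt.2 ((one_le_div hm0).2 hf2)
  have ht2 : √(γ / m) ^ 2 = γ / m := Real.sq_sqrt (by positivity)
  have htw : √(γ / m) • w ∈ GamTilde N γ := by
    rw [mem_GamTilde_iff hN, Submodule.coe_smul, WithLp.smul_fst, norm_smul, mul_pow, Real.norm_eq_abs,
      sq_abs, ht2, ← hm]
    field_simp
  have h1 := (hmin' _ htw).trans (redEnergy_smul_le hN hq₁ ht1 w.1)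
  rw [ht2] at h1
  -- The comparison gives κ ≤ (γ/m) · `redEnergy` of w ≤ (γ/m)κ, impossible for γ/m > 1 since κ < 0.
  have hmγ : m = γ := by
    refine le_antisymm hf2 ?_
    by_contra hlt
    have h2 : 1 < γ / m := (one_lt_div hm0).2 (not_le.1 hlt)
    nlinarith
  have hwG : w ∈ GamTilde N γ := (mem_GamTilde_iff hN w).2 hmγ
  have hew' : redEnergy q w.1 = κ := le_antisymm hew (hmin' w hwG)
  refine ⟨s, w, hs, ?_, hwG, fun z hz => ?_⟩
  · rw [tendsto_subtype_rng]
    refine tendsto_of_components ?_ ?_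
    · rwa [hmγ, sub_self] at hf1
    -- The defect in the gradient norm is twice the gap between κ and the energy of w, which is
    -- zero.
    · have h2 : 2 * (κ + 1 / q * potential q w.1) - ‖w.1.snd‖ ^ 2 = 0 := by
        rw [← hew', redEnergy]; ring
      rwa [h2] at hs1
  · change J q w ≤ J q z
    rw [hJe w hwG, hJe z hz, hew']
    linarith [hmin' z hz]

end HardyNLS

end

theorem mainTheorem6 (N : ℕ) (hN : 3 ≤ N) (q : ℝ) (hq₁ : 2 < q) (hq₂ : q < 4 / (N : ℝ) + 2)
    (γ : ℝ) (hγ : 0 < γ) (v : ℕ → HardyNLS.SpaceHr N)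
    (hv : ∀ n, v n ∈ HardyNLS.GamTilde N γ)
    (hJ : Tendsto (fun n => HardyNLS.J q (v n)) atTop (𝓝 (HardyNLS.kTilde N q γ)))
    (hJ' : Tendsto (fun n => fderiv ℝ (HardyNLS.J q) (v n)) atTop (𝓝 0) ∨
      Tendsto (fun n => ‖HardyNLS.constrainedDeriv q (v n)‖) atTop (𝓝 0)) :
    ∃ (s : ℕ → ℕ) (w : HardyNLS.SpaceHr N), StrictMono s ∧
      Tendsto (fun n => v (s n)) atTop (𝓝 w) ∧
      w ∈ HardyNLS.GamTilde N γ ∧ IsMinOn (HardyNLS.J q) (HardyNLS.GamTilde N γ) w := by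
  exact HardyNLS.exists_minimizer_of_tendsto hN hq₁ hq₂ hγ hv hJ
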